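/- **Setting.** Let $\mathcal R$ be the infinite square lattice graph with vertex set $\mathbb Z\times\mathbb Z$, where $(i,j)$ lies in row $i$ (rows are numbered downwards, $j$ increases from left to right) and $(i,j)$ is adjacent to the two vertices $(i-1,j)$ and $(i-1,j+1)$ of the row above. A finite connected full subgraph $\Gamma$ of $\mathcal R$ with top nonempty row $a_\Gamma$ is called *ordinary* if, whenever $(i,j),(i,j+1)\in\Gamma$, we have $(i+1,j)\in\Gamma$ and, if $i>a_\Gamma$, also $(i-1,j+1)\in\Gamma$. Let $l_\Gamma$ be the number of vertices of $\Gamma$ in row $a_\Gamma$. For integers $b_1\ge\dots\ge b_{l_\Gamma}$ let $D_\Gamma(b)$ be the polyhedron of all real arrays $s=(s_{i,j})_{(i,j)\in\mathbb Z^2}$ such that $s_{i,j}=0$ for $(i,j)\notin\Gamma$; the coordinates in row $a_\Gamma$ are $b_1,\dots,b_{l_\Gamma}$ from left to right; and, for $(i,j)\in\Gamma$, $s_{i-1,j}\ge s_{i,j}$ if $(i-1,j)\in\Gamma$ and $s_{i,j}\ge s_{i-1,j+1}$ if $(i-1,j+1)\in\Gamma$. For a face $f$ of $D_\Gamma(b)$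 let $\Delta_f$ be the graph on the vertices of $\Gamma$ whose edges are the edges of $\Gamma$ for which the two corresponding coordinates coincide on $f$, and put $$\varphi_{\Gamma}(b)(f)=\prod_{l\ge1}(1-t^l)^{d_l}\in\mathbb Z[t],$$ where $d_l$ is the number of pairs $(E,i)$ of a connected component $E$ of $\Delta_f$ and an integer $i>a_\Gamma$ such that $E$ has exactly $l-1$ vertices in row $i-1$ and exactly $l$ vertices in row $i$. For a rational polyhedron $P$ and a function $\varphi$ from its set of (nonempty) faces to $\mathbb Z[t]$, let $S_\varphi(P)=\sum_{a}\varphi(f_a)e^a$, the sum over the integer points $a$ of $P$, where $f_a$ is the minimal face of $P$ containing $a$ and $e^a$ is the Laurent monomial with exponent $a$; the *weighted integer point transform* $\sigma_\varphi(P)$ is the rational function $L/Q$, where $Q\ne0$ and $L$ are Laurent polynomials over $\mathbb Z[t]$ with $Q\,S_\varphi(P)=L$. If $C$ is the tangent cone of $P$ at a vertex, $\varphi$ also denotes the weight $G\mapsto\varphi(G\cap P)$ on the faces $G$ of $C$. **Statement.** Let $\Gamma$ be an ordinary subgraph, let $b_1>\dots>b_{l_\Gamma}$ and $b'_1\ge\dots\ge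 b'_{l_\Gamma}$ be integers, and let $l_1,\dots,l_m$ be the multiplicities of the $m$ distinct values among the $b'_k$. Let $v_1,\dots,v_N$ be the vertices of $D_\Gamma(b)$, with tangent cones $C_1,\dots,C_N$, and let $\pi(v_i)$ be the vertex of $D_\Gamma(b')$ corresponding to $v_i$ under the degeneration of $D_\Gamma(b)$ into $D_\Gamma(b')$, that is, the face of $D_\Gamma(b')$ whose cone is the smallest cone of the normal fan of $D_\Gamma(b')$ containing the cone of $v_i$ in the normal fan of $D_\Gamma(b)$. Then the points $v_i$ and $\pi(v_i)$ are well defined and integer, all the transforms below exist, and $$[l_1]_t!\cdots[l_m]_t!\;\sigma_{\varphi_\Gamma(b')}\bigl(D_\Gamma(b')\bigr)=\sum_{i=1}^{N}e^{\pi(v_i)-v_i}\,\sigma_{\varphi_\Gamma(b)}(C_i),$$ where $[l]_t!=\prod_{k=1}^{l}(1+t+\dots+t^{k-1})$. -/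

import Mathlib

open Polynomial

noncomputable section

namespace GTPolyhedra

/-! ### The ambient space, its lattice, and rational functions -/

/-- The vertices `(i, j)` of the square lattice: `i` is the number of the row (rows are numbered
from top to bottom), `j` is the position within the row (from left to right). -/
abbrev Node : Type := ℤ × ℤ

/-- The countable-dimensional real space with coordinates enumerated by the lattice vertices. -/
abbrev Space : Type := Node →₀ ℝ

/-- Integer points of `Space`, that is, exponents of Laurent monomials in the variables
`t_{i,j}`. -/
abbrev Exponent : Type := Node →₀ ℤ

/-- An integer point viewed as a point of the real space. -/
def toReal (u : Exponent) : Space := u.mapRange (fun n : ℤ => (n : ℝ)) Int.cast_zero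

/-- Laurent polynomials in the variables `t_{i,j}` with coefficients in `ℤ[t]`. -/
abbrev Laurent : Type := AddMonoidAlgebra ℤ[X] Exponent

/-- Rational functions in the variables `t_{i,j}` with coefficients in `ℤ[t]`. -/
abbrev RatFun : Type := FractionRing Laurent

/-- A coefficient from `ℤ[t]` as a rational function. -/
def scalar (c : ℤ[X]) : RatFun := algebraMap Laurent RatFun (AddMonoidAlgebra.single 0 c)

/-- The Laurent monomial `e^u` as a rational function. -/
def monomialExp (u : Exponent) : RatFun :=
  algebraMap Laurent RatFun (AddMonoidAlgebra.single u 1)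

/-! ### Faces, tangent cones and normal cones of polyhedra -/

/-- `F` is a (nonempty) face of the polyhedron `P`: the set of points of `P` at which some linear
functional attains its maximum over `P` (`P` itself is a face, via the zero functional). -/
def IsFace (P F : Set Space) : Prop :=
  F.Nonempty ∧ ∃ l : Module.Dual ℝ Space, F = {x | x ∈ P ∧ ∀ y ∈ P, l y ≤ l x}

/-- `v` is a vertex of `P`: a zero-dimensional face. -/
def IsVertex (P : Set Space) (v : Space) : Prop := IsFace P {v}

/-- The minimal face of `P` containing `x`. -/
def minFace (P : Set Space) (x : Space) : Set Space := ⋂₀ {F | IsFace P F ∧ x ∈ F}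

/-- The tangent cone to `P` at `v`, with apex `v`. -/
def tangentCone (P : Set Space) (v : Space) : Set Space :=
  {y | ∃ x ∈ P, ∃ c : ℝ, 0 ≤ c ∧ y = v + c • (x - v)}

/-- The cone of the normal fan of `P` that corresponds to the face `F`: the functionals whose
maximum over `P` is attained at every point of `F`. -/
def normalCone (P F : Set Space) : Set (Module.Dual ℝ Space) :=
  {l | ∀ x ∈ F, ∀ y ∈ P, l y ≤ l x}

/-- The map `π` between the faces of `P` and those of its degeneration `P'`, as a relation:
`F'` is the face of `P'` whose cone is the smallest one, among the cones of the normal fan of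
`P'`, that contains the cone of `F` in the normal fan of `P`. There is at most one such `F'`. -/
def IsDegenerationImage (P P' F F' : Set Space) : Prop :=
  IsFace P' F' ∧ normalCone P F ⊆ normalCone P' F' ∧
    ∀ G, IsFace P' G → normalCone P F ⊆ normalCone P' G → normalCone P' F' ⊆ normalCone P' G

/-! ### Weighted integer point transforms -/

open Classical in
/-- The weighted generating series of `P`, a formal Laurent series (infinite in all directions)
given by its coefficients: the coefficient at `e^u` is the weight of the minimal face of `P`
containing `u` if `u ∈ P`, and zero otherwise. -/
def weightedSeries (φ : Set Space → ℤ[X]) (P : Set Space) : Exponent → ℤ[X] :=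
  fun u => if toReal u ∈ P then φ (minFace P (toReal u)) else 0

/-- The product of a Laurent polynomial and a formal Laurent series. -/
def mulSeries (Q : Laurent) (S : Exponent → ℤ[X]) : Exponent → ℤ[X] :=
  fun u => Q.coeff.sum fun d q => q * S (u - d)

/-- The rational function `r` is represented by the formal Laurent series `S`: for some nonzero
Laurent polynomial `Q` the product `Q S` is a Laurent polynomial `L`, and `r = L / Q`. -/
def Represents (S : Exponent → ℤ[X]) (r : RatFun) : Prop :=
  ∃ Q L : Laurent, Q ≠ 0 ∧ mulSeries Q S = (fun u => L.coeff u) ∧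
    r * algebraMap Laurent RatFun Q = algebraMap Laurent RatFun L

/-- The weighted series of `P` represents a rational function, so that the weighted integer point
transform of `P` is defined. -/
def HasIPT (φ : Set Space → ℤ[X]) (P : Set Space) : Prop :=
  ∃ r : RatFun, Represents (weightedSeries φ P) r

open Classical in
/-- The weighted integer point transform `σ_φ(P)`. -/
def ipt (φ : Set Space → ℤ[X]) (P : Set Space) : RatFun :=
  if h : HasIPT φ P then h.choose else 0

/-- The weight function that a weight function `φ` on the faces of `P` induces on the faces of the
tangent cone at a vertex of `P`, through the embedding `G ↦ G ∩ P` of the set of faces of the cone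
into the set of faces of `P`. -/
def coneWeight (φ : Set Space → ℤ[X]) (P : Set Space) : Set Space → ℤ[X] :=
  fun G => φ (G ∩ P)

/-! ### Ordinary subgraphs and the associated polyhedra -/

/-- The infinite square lattice: the two neighbours of `(i, j)` in the row below are `(i + 1, j)`
and `(i + 1, j - 1)`, so that the two in the row above are `(i - 1, j)` and `(i - 1, j + 1)`. -/
def lattice : SimpleGraph Node :=
  SimpleGraph.fromRel fun p q => q = (p.1 + 1, p.2) ∨ q = (p.1 + 1, p.2 - 1)

/-- The number `a_Γ` of the top row containing vertices of `Γ`. -/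
def topRow (Γ : Finset Node) : ℤ := sInf (Prod.fst '' (Γ : Set Node))

/-- Ordinary subgraphs. As they are finite full subgraphs, they are given by finite sets of
vertices. -/
structure IsOrdinary (Γ : Finset Node) : Prop where
  connected : (lattice.induce (Γ : Set Node)).Connected
  below : ∀ i j : ℤ, (i, j) ∈ Γ → (i, j + 1) ∈ Γ → (i + 1, j) ∈ Γ
  above : ∀ i j : ℤ, topRow Γ < i → (i, j) ∈ Γ → (i, j + 1) ∈ Γ → (i - 1, j + 1) ∈ Γ

/-- The positions of the vertices of `Γ` in its top row. -/
def topPositions (Γ : Finset Node) : Finset ℤ :=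
  (Γ.filter fun p => p.1 = topRow Γ).image Prod.snd

/-- The number `l_Γ` of vertices in the top row of `Γ`. -/
def topCount (Γ : Finset Node) : ℕ := (topPositions Γ).card

/-- The `k`-th vertex of the top row of `Γ`, counting from left to right (and from `0`). -/
def topNode (Γ : Finset Node) (k : Fin (topCount Γ)) : Node :=
  (topRow Γ, (topPositions Γ).orderEmbOfFin rfl k)

/-- The polyhedron `D_Γ(b)`. -/
def polyhedron (Γ : Finset Node) (b : Fin (topCount Γ) → ℤ) : Set Space :=
  {s | (∀ p, p ∉ Γ → s p = 0) ∧ (∀ k, s (topNode Γ k) = (b k : ℝ)) ∧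
    ∀ i j : ℤ, (i, j) ∈ Γ →
      ((i - 1, j) ∈ Γ → s (i, j) ≤ s (i - 1, j)) ∧
      ((i - 1, j + 1) ∈ Γ → s (i - 1, j + 1) ≤ s (i, j))}

/-- The graph `Δ_F` of a face `F` of `D_Γ(b)`: its vertices are those of `Γ`, and its edges are the
edges of `Γ` for which the two corresponding coordinates coincide on `F`. -/
def faceGraph (Γ : Finset Node) (F : Set Space) : SimpleGraph {p : Node // p ∈ Γ} where
  Adj p q := lattice.Adj p q ∧ ∀ s ∈ F, s (p : Node) = s (q : Node)
  symm := ⟨fun _ _ h => ⟨h.1.symm, fun s hs => (h.2 s hs).symm⟩⟩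
  loopless := ⟨fun _ h => h.1.ne rfl⟩

/-- The number of vertices in row `i` of a connected component of `Δ_F`. -/
def rowCount {Γ : Finset Node} {F : Set Space} (E : (faceGraph Γ F).ConnectedComponent)
    (i : ℤ) : ℕ :=
  Set.ncard {p : {p : Node // p ∈ Γ} | p ∈ E.supp ∧ p.1.1 = i}

/-- The statistic `d_l` of a face (for `1 ≤ l`): the number of pairs `(E, i)` of a connected
component `E` of `Δ_F` and a row `i` below the top row of `Γ` such that `E` has exactly `l - 1`
vertices in row `i - 1` and exactly `l` vertices in row `i`. -/
def statistic (Γ : Finset Node) (F : Set Space) (l : ℕ) : ℕ :=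
  Set.ncard {q : (faceGraph Γ F).ConnectedComponent × ℤ |
    topRow Γ < q.2 ∧ rowCount q.1 (q.2 - 1) + 1 = l ∧ rowCount q.1 q.2 = l}

/-- The weight `φ_Γ(b)(F) = ∏ (1 - t^l)^{d_l}` of a face `F` of `D_Γ(b)`; it depends on `b` only
through `F`. All `d_l` with `l` greater than the number of vertices of `Γ` vanish. -/
def weight (Γ : Finset Node) (F : Set Space) : ℤ[X] :=
  ∏ l ∈ Finset.Icc 1 Γ.card, (1 - X ^ l) ^ statistic Γ F l

/-- The `t`-factorial `[l]_t! = ∏_{k=1}^{l} (1 + t + ... + t^{k-1})`. -/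
def tFactorial (l : ℕ) : ℤ[X] := ∏ k ∈ Finset.Icc 1 l, ∑ j ∈ Finset.range k, X ^ j

/-- The product `[l_1]_t! ... [l_m]_t!` where `l_1, ..., l_m` are the multiplicities of the
distinct values of the finite sequence `b`. -/
def multiplicityFactor {n : ℕ} (b : Fin n → ℤ) : ℤ[X] :=
  ∏ c ∈ Finset.univ.image b, tFactorial (Finset.univ.filter fun k => b k = c).card

end GTPolyhedra

end

noncomputable section

namespace GTPolyhedra

/-! ### Series that represent rational functions -/

/-! The mechanism is that of Brion's theorem: a series annihilated by a nonzero Laurent polynomial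
represents zero, so a bounded region may be replaced by unbounded ones. In one dimension, the
function on ℤ that is `1 - t` inside an interval, `1` at its end points (`1 + t` if they coincide)
and `0` outside is the sum of two functions supported on half-lines and of the constant `t - 1`,
which represents zero.

The weight of an integer point, multiplied by the t-factorials of its top row, is a polynomial in
such one-dimensional functions. If a value occurs `m` times in one row and `n` times in the next, it
contributes `valueFactor m n`, with t-factorials telescoping from row to row. The product of these
factors over the values is a continuant: each vertex contributes the interval function given by its
upper neighbours, and two neighbours in a row that both equal the vertex above and between them
contribute a correction `-t` (`RowsInterlace.scan`, `IsOrdinary.rowWeight_eq`,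
`IsOrdinary.weight_eq`). The continuant also vanishes off the polyhedron, so it gives the entire
weighted series (`IsOrdinary.weightedSeries_polyhedron`).

For the tangent cone at a vertex `v`, the weight of `u` is read off at `u + N v` with `N` large.
There an edge that is not tight at `v` contributes a constant `1 - t`, which cancels against the `t
- 1`. What remains is the same continuant with only the tight edges allowed
(`IsOrdinary.weightedSeries_tangentCone`). It depends only on differences along tight edges, hence
is unchanged by a translation that is constant along them; translating by `π(v) - v` replaces the
top row `b` by `b'` (`IsOrdinary.continuantSeries_degenerate`).

All these continuants have one common expansion into terms indexed by choices of a parent for each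
lower vertex (`exists_continuant_expansion`). A term with a free vertex is periodic and represents
zero. The other terms are forests rooted in the top row, whose rational functions do not depend on
`v`. Each forest with edges in `Γ` consists of tight edges of exactly one vertex of the polyhedron,
namely the array constant on its trees (`IsOrdinary.sum_vertexSet`). Hence the sum over the cones
and the transform of the polyhedron are the same sum over forests. -/

theorem mulSeries_zero_left (S : Exponent → ℤ[X]) : mulSeries 0 S = 0 := by
  funext u; simp [mulSeries]

theorem mulSeries_add_left (Q Q' : Laurent) (S : Exponent → ℤ[X]) :
    mulSeries (Q + Q') S = mulSeries Q S + mulSeries Q' S := by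
  classical
  funext u
  simp only [mulSeries, AddMonoidAlgebra.coeff_add, Pi.add_apply]
  exact Finsupp.sum_add_index (by simp) (by intros; ring)

theorem mulSeries_single (d : Exponent) (c : ℤ[X]) (S : Exponent → ℤ[X]) (u : Exponent) :
    mulSeries (AddMonoidAlgebra.single d c) S u = c * S (u - d) := by
  simp [mulSeries, AddMonoidAlgebra.coeff_single]

theorem mulSeries_add_right (Q : Laurent) (S T : Exponent → ℤ[X]) :
    mulSeries Q (S + T) = mulSeries Q S + mulSeries Q T := by
  funext u
  simp [mulSeries, mul_add, Finsupp.sum, Finset.sum_add_distrib]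

theorem mulSeries_mul (Q Q' : Laurent) (S : Exponent → ℤ[X]) :
    mulSeries (Q * Q') S = mulSeries Q (mulSeries Q' S) := by
  induction Q using AddMonoidAlgebra.induction_linear with
  | zero => simp [mulSeries_zero_left]
  | add f g hf hg => rw [add_mul, mulSeries_add_left, hf, hg, mulSeries_add_left]
  | single a c =>
    induction Q' using AddMonoidAlgebra.induction_linear with
    | zero =>
      funext u
      simp [mulSeries_zero_left, mulSeries_single]
    | add f g hf hg => rw [mul_add, mulSeries_add_left, hf, hg, mulSeries_add_left,
        mulSeries_add_right]
    | single a' c' =>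
      funext u
      rw [AddMonoidAlgebra.single_mul_single]
      simp only [mulSeries_single]
      rw [mul_assoc, sub_sub]

theorem mulSeries_comm (Q Q' : Laurent) (S : Exponent → ℤ[X]) :
    mulSeries Q (mulSeries Q' S) = mulSeries Q' (mulSeries Q S) := by
  rw [← mulSeries_mul, mul_comm, mulSeries_mul]

theorem mulSeries_coeff (Q L : Laurent) :
    mulSeries Q (fun u => L.coeff u) = fun u => (Q * L).coeff u := by
  induction Q using AddMonoidAlgebra.induction_linear with
  | zero => funext u; simp [mulSeries_zero_left]
  | add f g hf hg => rw [mulSeries_add_left, hf, hg]; funext u; simp [add_mul]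
  | single a c =>
    funext u
    rw [mulSeries_single, AddMonoidAlgebra.coeff_single_mul_apply]
    congr 2
    abel

theorem algebraMap_laurent_ne_zero {Q : Laurent} (h : Q ≠ 0) : algebraMap Laurent RatFun Q ≠ 0 := by
  simpa using h

theorem Represents.unique {S : Exponent → ℤ[X]} {r r' : RatFun} (h : Represents S r)
    (h' : Represents S r') : r = r' := by
  obtain ⟨Q, L, hQ, hS, hr⟩ := h
  obtain ⟨Q', L', hQ', hS', hr'⟩ := h'
  have key : Q * L' = Q' * L := by
    have := mulSeries_comm Q Q' S
    rw [hS, hS', mulSeries_coeff, mulSeries_coeff] at this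
    apply AddMonoidAlgebra.coeff_injective
    ext1 u
    exact congrFun this u
  have h1 := algebraMap_laurent_ne_zero hQ
  have h2 := algebraMap_laurent_ne_zero hQ'
  have := congrArg (algebraMap Laurent RatFun) key
  rw [map_mul, map_mul, ← hr, ← hr'] at this
  apply mul_left_cancel₀ (mul_ne_zero h1 h2)
  linear_combination -this

theorem Represents.add {S S' : Exponent → ℤ[X]} {r r' : RatFun} (h : Represents S r)
    (h' : Represents S' r') : Represents (S + S') (r + r') := by
  obtain ⟨Q, L, hQ, hS, hr⟩ := h
  obtain ⟨Q', L', hQ', hS', hr'⟩ := h'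
  refine ⟨Q * Q', Q' * L + Q * L', mul_ne_zero hQ hQ', ?_, ?_⟩
  · rw [mulSeries_add_right, mulSeries_mul, mulSeries_mul, hS', mulSeries_comm, hS,
      mulSeries_coeff, mulSeries_coeff]
    funext u
    simp
  · simp only [map_mul, map_add]
    rw [← hr, ← hr']
    ring

theorem Represents.zero : Represents 0 0 :=
  ⟨1, 0, one_ne_zero, by funext u; simp [mulSeries], by simp⟩

theorem Represents.mulSeries {S : Exponent → ℤ[X]} {r : RatFun} (h : Represents S r)
    (M : Laurent) : Represents (mulSeries M S) (algebraMap Laurent RatFun M * r) := by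
  obtain ⟨Q, L, hQ, hS, hr⟩ := h
  refine ⟨Q, M * L, hQ, ?_, ?_⟩
  · rw [mulSeries_comm, hS, mulSeries_coeff]
  · rw [map_mul, ← hr]; ring

/-- Applied with `r = 0`, this makes every series annihilated by a nonzero Laurent polynomial
represent zero. Otherwise it serves to build up denominators one factor at a time. -/
theorem Represents.of_mulSeries {S : Exponent → ℤ[X]} {r : RatFun} {M : Laurent} (hM : M ≠ 0)
    (h : Represents (GTPolyhedra.mulSeries M S) r) :
    Represents S (r / algebraMap Laurent RatFun M) := by
  obtain ⟨Q, L, hQ, hS, hr⟩ := h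
  refine ⟨Q * M, L, mul_ne_zero hQ hM, by rw [mulSeries_mul, hS], ?_⟩
  have := algebraMap_laurent_ne_zero hM
  rw [map_mul, ← hr]
  field_simp

theorem Represents.const_mul {S : Exponent → ℤ[X]} {r : RatFun} (h : Represents S r)
    (c : ℤ[X]) : Represents (fun u => c * S u) (scalar c * r) := by
  have := h.mulSeries (AddMonoidAlgebra.single 0 c)
  convert this using 1
  · funext u
    rw [mulSeries_single, sub_zero]
  · rfl

theorem Represents.shift {S : Exponent → ℤ[X]} {r : RatFun} (h : Represents S r)
    (d : Exponent) : Represents (fun u => S (u - d)) (monomialExp d * r) := by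
  have := h.mulSeries (AddMonoidAlgebra.single d 1)
  convert this using 1
  · funext u
    rw [mulSeries_single, one_mul]
  · rfl

theorem Represents.list_sum {ι : Type*} (l : List ι) (S : ι → Exponent → ℤ[X]) (r : ι → RatFun)
    (h : ∀ i ∈ l, Represents (S i) (r i)) :
    Represents (fun u => (l.map fun i => S i u).sum) (l.map r).sum := by
  induction l with
  | nil => exact Represents.zero
  | cons a l ih =>
    simp only [List.map_cons, List.sum_cons]
    exact (h a (by simp)).add (ih fun i hi => h i (by simp [hi]))

theorem Represents.of_finite_support {S : Exponent → ℤ[X]} (h : S.support.Finite) :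
    ∃ r, Represents S r := by
  refine ⟨algebraMap Laurent RatFun (AddMonoidAlgebra.ofCoeff (Finsupp.ofSupportFinite S h)), 1,
    AddMonoidAlgebra.ofCoeff (Finsupp.ofSupportFinite S h), one_ne_zero, ?_, by simp⟩
  funext u
  rw [AddMonoidAlgebra.one_def, mulSeries_single, one_mul, sub_zero]
  rfl

theorem Represents.ipt_eq {φ : Set Space → ℤ[X]} {P : Set Space} {r : RatFun}
    (h : Represents (weightedSeries φ P) r) : ipt φ P = r := by
  have hI : HasIPT φ P := ⟨r, h⟩
  rw [ipt, dif_pos hI]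
  exact hI.choose_spec.unique h

theorem one_sub_single_ne_zero {d : Exponent} (hd : d ≠ 0) :
    (1 - AddMonoidAlgebra.single d 1 : Laurent) ≠ 0 := by
  intro h
  have h1 := sub_eq_zero.1 h
  rw [AddMonoidAlgebra.one_def, AddMonoidAlgebra.single_left_inj one_ne_zero] at h1
  exact hd h1.symm

theorem mulSeries_one_sub_single (d : Exponent) (S : Exponent → ℤ[X]) (u : Exponent) :
    mulSeries (1 - AddMonoidAlgebra.single d 1) S u = S u - S (u - d) := by
  have h := mulSeries_add_left (1 - AddMonoidAlgebra.single d 1) (AddMonoidAlgebra.single d 1) S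
  rw [sub_add_cancel, AddMonoidAlgebra.one_def] at h
  have h := congrFun h u
  rw [Pi.add_apply, mulSeries_single, mulSeries_single] at h
  rw [AddMonoidAlgebra.one_def]
  rw [sub_zero, one_mul, one_mul] at h
  rw [h]; ring

/-! ### The structure of ordinary subgraphs -/

/-- The left neighbour in the row above. -/
def upL (p : Node) : Node := (p.1 - 1, p.2)

/-- The right neighbour in the row above. -/
def upR (p : Node) : Node := (p.1 - 1, p.2 + 1)

theorem lattice_adj_iff (p q : Node) :
    lattice.Adj p q ↔ p = upL q ∨ p = upR q ∨ q = upL p ∨ q = upR p := by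
  obtain ⟨i, j⟩ := p
  obtain ⟨k, l⟩ := q
  simp only [lattice, SimpleGraph.fromRel_adj, upL, upR, Prod.mk.injEq, ne_eq]
  omega

/-- The vertices of `Γ` below its top row. -/
def lower (Γ : Finset Node) : Finset Node := Γ.filter fun p => topRow Γ < p.1

theorem mem_lower {Γ : Finset Node} {p : Node} : p ∈ lower Γ ↔ p ∈ Γ ∧ topRow Γ < p.1 := by
  simp [lower]

theorem topRow_le {Γ : Finset Node} {p : Node} (hp : p ∈ Γ) : topRow Γ ≤ p.1 :=
  csInf_le (Γ.finite_toSet.image _).bddBelow ⟨p, hp, rfl⟩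

theorem exists_mem_topRow {Γ : Finset Node} (h : Γ.Nonempty) : ∃ p ∈ Γ, p.1 = topRow Γ := by
  have := Int.csInf_mem (s := Prod.fst '' (Γ : Set Node)) ((Finset.coe_nonempty.2 h).image _)
    (Γ.finite_toSet.image _).bddBelow
  obtain ⟨p, hp, h⟩ := this
  exact ⟨p, hp, h⟩

theorem eq_topRow_of_not_mem_lower {Γ : Finset Node} {p : Node} (hp : p ∈ Γ) (h : p ∉ lower Γ) :
    p.1 = topRow Γ := by
  rw [mem_lower] at h
  have := topRow_le hp
  by_contra h'
  exact h ⟨hp, by omega⟩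

theorem IsOrdinary.nonempty {Γ : Finset Node} (hΓ : IsOrdinary Γ) : Γ.Nonempty := by
  obtain ⟨p⟩ := hΓ.connected.nonempty
  exact ⟨p, p.2⟩

theorem exists_stepping_sequence (S : ℕ → ℤ → Prop) (ε g : ℤ) (h0 : S 0 g)
    (h : ∀ n g, S n g → S (n + 1) g ∨ S (n + 1) (g + ε)) :
    ∃ d : ℕ → ℤ, d 0 = g ∧ ∀ n, S n (d n) ∧ (d (n + 1) = d n ∨ d (n + 1) = d n + ε) := by
  classical
  choose! f hf using fun n g (hg : S n g) =>
    show ∃ g', S (n + 1) g' ∧ (g' = g ∨ g' = g + ε) from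
      (h n g hg).elim (fun h => ⟨g, h, Or.inl rfl⟩) fun h => ⟨g + ε, h, Or.inr rfl⟩
  let d : ℕ → ℤ := fun n => Nat.rec g (fun n x => f n x) n
  have hd : ∀ n, S n (d n) := by
    intro n
    induction n with
    | zero => exact h0
    | succ n ih => exact (hf n _ ih).1
  exact ⟨d, rfl, fun n => ⟨hd n, (hf n _ (hd n)).2⟩⟩

/-- A missing vertex extends to a vertical curve that avoids the ordinary subgraph. -/
theorem IsOrdinary.exists_curve {Γ : Finset Node} (hΓ : IsOrdinary Γ) {i g : ℤ}
    (hi : topRow Γ ≤ i) (hg : (i, g) ∉ Γ) :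
    ∃ γ : ℤ → ℤ, γ i = g ∧ ∀ k, (k, γ k) ∉ Γ ∧ γ (k + 1) ≤ γ k ∧ γ k - 1 ≤ γ (k + 1) := by
  -- Downwards, if both candidates in the next row belonged to `Γ`, condition `above` would put the
  -- current vertex into `Γ`. Upwards, `below` plays the same role.
  obtain ⟨d, hd0, hd⟩ := exists_stepping_sequence (fun n g => (i + n, g) ∉ Γ) (-1) g
    (by simpa using hg) (by
      intro n g hg
      by_contra! h
      obtain ⟨h1, h2⟩ := h
      rw [Nat.cast_add, Nat.cast_one, ← add_assoc] at h1 h2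
      have := hΓ.above (i + n + 1) (g + -1) (by omega) h2 (by simpa using h1)
      apply hg
      simpa using this)
  obtain ⟨e, he0, he⟩ := exists_stepping_sequence (fun n g => (i - n, g) ∉ Γ) 1 g
    (by simpa using hg) (by
      intro n g hg
      by_contra! h
      obtain ⟨h1, h2⟩ := h
      have := hΓ.below _ _ h1 h2
      apply hg
      convert this using 2
      push_cast
      ring)
  refine ⟨fun k => if i ≤ k then d (k - i).toNat else e (i - k).toNat, by simp [hd0], ?_⟩
  intro k
  by_cases hk : i ≤ k
  · have e1 : (k + 1 - i).toNat = (k - i).toNat + 1 := by omega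
    have e2 : i + ((k - i).toNat : ℤ) = k := by omega
    obtain ⟨h1, h2⟩ := hd (k - i).toNat
    simp only [hk, show i ≤ k + 1 by omega, if_true, e1]
    rw [e2] at h1
    exact ⟨h1, by omega, by omega⟩
  · by_cases hk' : i ≤ k + 1
    · obtain rfl : i = k + 1 := by omega
      have := he 0
      have h1 := he 1
      simp only [hk, if_false, le_refl, if_true, sub_self, Int.toNat_zero, hd0,
        show (k + 1 - k).toNat = 1 by omega]
      simp only [he0] at this
      have e3 : k + 1 - ((1 : ℕ) : ℤ) = k := by omega
      rw [e3] at h1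
      refine ⟨h1.1, ?_, ?_⟩ <;> rcases this.2 with h | h <;> simp only [zero_add] at h <;> omega
    · have e1 : (i - k).toNat = (i - (k + 1)).toNat + 1 := by omega
      have h1 := (he (i - k).toNat).1
      have h2 := (he (i - (k + 1)).toNat).2
      rw [← e1] at h2
      simp only [hk, hk', if_false]
      rw [show i - ((i - k).toNat : ℤ) = k by omega] at h1
      exact ⟨h1, by omega, by omega⟩

/-- A gap in a row would extend to a curve missing `Γ`. No edge of the lattice joins a vertex to the
left of the curve with one to its right, so the curve would disconnect `Γ`. -/
theorem IsOrdinary.row_ordConnected {Γ : Finset Node} (hΓ : IsOrdinary Γ) {i j g k : ℤ}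
    (hj : (i, j) ∈ Γ) (hk : (i, k) ∈ Γ) (h1 : j ≤ g) (h2 : g ≤ k) : (i, g) ∈ Γ := by
  by_contra hg
  obtain ⟨γ, hγ, h⟩ := hΓ.exists_curve (topRow_le hj) hg
  have key : ∀ p q : (Γ : Set Node), (lattice.induce (Γ : Set Node)).Reachable p q →
      ((p : Node).2 < γ (p : Node).1 ↔ (q : Node).2 < γ (q : Node).1) := by
    rintro p q ⟨w⟩
    induction w with
    | nil => rfl
    | @cons u v w h' _ ih =>
      rw [← ih]
      obtain ⟨⟨i1, j1⟩, hu⟩ := u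
      obtain ⟨⟨i2, j2⟩, hv⟩ := v
      have hadj : lattice.Adj (i1, j1) (i2, j2) := h'
      rw [lattice_adj_iff] at hadj
      simp only [upL, upR, Prod.mk.injEq] at hadj
      have hu' : j1 ≠ γ i1 := by rintro rfl; exact (h i1).1 hu
      have hv' : j2 ≠ γ i2 := by rintro rfl; exact (h i2).1 hv
      have a1 := h i1
      have a2 := h i2
      have a3 := h (i1 - 1)
      have a4 := h (i2 - 1)
      simp only [sub_add_cancel] at a3 a4
      simp only
      rcases hadj with ⟨rfl, rfl⟩ | ⟨rfl, rfl⟩ | ⟨rfl, rfl⟩ | ⟨rfl, rfl⟩ <;> omega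
  have := key ⟨_, hj⟩ ⟨_, hk⟩ (hΓ.connected.preconnected _ _)
  simp only [hγ] at this
  have hj' : j ≠ g := by rintro rfl; exact hg hj
  omega

/-- A vertex without upper neighbours has no neighbours within its row either, by `above`. As rows
are intervals, it is alone in its row, and then no edge of `Γ` enters that row from above, contrary
to connectedness. -/
theorem IsOrdinary.up_mem {Γ : Finset Node} (hΓ : IsOrdinary Γ) {p : Node} (hp : p ∈ lower Γ) :
    upL p ∈ Γ ∨ upR p ∈ Γ := by
  by_contra! hn
  obtain ⟨hpΓ, hpt⟩ := mem_lower.1 hp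
  obtain ⟨i, j⟩ := p
  simp only [upL, upR] at hn hpt
  have hsingle : ∀ k, (i, k) ∈ Γ → k = j := by
    intro k hk
    rcases lt_trichotomy k j with h | h | h
    · have h' := hΓ.row_ordConnected hk hpΓ (show k ≤ j - 1 by omega) (by omega)
      have := hΓ.above i (j - 1) hpt h' (by simpa using hpΓ)
      simp only [sub_add_cancel] at this
      exact absurd this hn.1
    · exact h
    · have h' := hΓ.row_ordConnected hpΓ hk (show j ≤ j + 1 by omega) (by omega)
      exact absurd (hΓ.above i j hpt hpΓ h') hn.2
  have key : ∀ p q : (Γ : Set Node), (lattice.induce (Γ : Set Node)).Reachable p q →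
      (i ≤ (p : Node).1 ↔ i ≤ (q : Node).1) := by
    rintro p q ⟨w⟩
    induction w with
    | nil => rfl
    | @cons u v w h' _ ih =>
      rw [← ih]
      obtain ⟨⟨i1, j1⟩, hu⟩ := u
      obtain ⟨⟨i2, j2⟩, hv⟩ := v
      have hadj : lattice.Adj (i1, j1) (i2, j2) := h'
      rw [lattice_adj_iff] at hadj
      simp only [upL, upR, Prod.mk.injEq] at hadj
      simp only [SetLike.mem_coe] at hu hv ⊢
      constructor
      · intro hi
        by_contra hi2
        have e1 : i1 = i := by omega
        subst e1
        obtain rfl := hsingle _ hu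
        rcases hadj with ⟨rfl, rfl⟩ | ⟨rfl, rfl⟩ | ⟨rfl, rfl⟩ | ⟨rfl, rfl⟩
        · omega
        · omega
        · exact hn.1 hv
        · exact hn.2 hv
      · intro hi
        by_contra hi2
        have e1 : i2 = i := by omega
        subst e1
        obtain rfl := hsingle _ hv
        rcases hadj with ⟨rfl, rfl⟩ | ⟨rfl, rfl⟩ | ⟨rfl, rfl⟩ | ⟨rfl, rfl⟩
        · exact hn.1 hu
        · exact hn.2 hu
        · omega
        · omega
  obtain ⟨q, hq, hqt⟩ := exists_mem_topRow hΓ.nonempty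
  have := key ⟨_, hpΓ⟩ ⟨_, hq⟩ (hΓ.connected.preconnected _ _)
  simp only at this
  omega

/-- Vertices of the ordinary subgraph are reached from its top row by descending. -/
theorem node_induction {Γ : Finset Node} {motive : Node → Prop}
    (top : ∀ p ∈ Γ, p.1 = topRow Γ → motive p)
    (step : ∀ p ∈ lower Γ, (∀ q ∈ Γ, q.1 < p.1 → motive q) → motive p) :
    ∀ p ∈ Γ, motive p := by
  have : ∀ n : ℕ, ∀ p ∈ Γ, (p.1 - topRow Γ).toNat = n → motive p := by
    intro n
    induction n using Nat.strong_induction_on with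
    | _ n ih =>
      intro p hp hn
      by_cases h : p ∈ lower Γ
      · refine step p h fun q hq hlt => ih _ ?_ q hq rfl
        have := topRow_le hq
        omega
      · exact top p hp (eq_topRow_of_not_mem_lower hp h)
  exact fun p hp => this _ p hp rfl

theorem topNode_mem {Γ : Finset Node} (k : Fin (topCount Γ)) : topNode Γ k ∈ Γ := by
  have := Finset.orderEmbOfFin_mem (topPositions Γ) rfl k
  simp only [topPositions, Finset.mem_image, Finset.mem_filter] at this
  obtain ⟨⟨a, c⟩, ⟨h1, h2⟩, h3⟩ := this
  simp only at h2 h3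
  subst h2
  rw [topNode]
  convert h1 using 2
  exact h3.symm

theorem topNode_fst {Γ : Finset Node} (k : Fin (topCount Γ)) : (topNode Γ k).1 = topRow Γ := rfl

theorem exists_topNode {Γ : Finset Node} {p : Node} (hp : p ∈ Γ) (h : p.1 = topRow Γ) :
    ∃ k, topNode Γ k = p := by
  have h1 : p.2 ∈ topPositions Γ :=
    Finset.mem_image.2 ⟨p, Finset.mem_filter.2 ⟨hp, h⟩, rfl⟩
  have h2 := Finset.range_orderEmbOfFin (topPositions Γ) rfl
  rw [← Finset.mem_coe, ← h2] at h1
  obtain ⟨k, hk⟩ := h1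
  exact ⟨k, Prod.ext h.symm hk⟩

theorem topNode_snd_le {Γ : Finset Node} {k l : Fin (topCount Γ)} :
    (topNode Γ k).2 ≤ (topNode Γ l).2 ↔ k ≤ l :=
  ((topPositions Γ).orderEmbOfFin rfl).le_iff_le

theorem topNode_injective (Γ : Finset Node) : Function.Injective (topNode Γ) := fun _ _ h =>
  ((topPositions Γ).orderEmbOfFin rfl).injective (congrArg Prod.snd h)

/-! ### Local weights and continuants -/

/-- The ways in which a vertex can depend on its neighbours in the row above. -/
inductive Choice : Type
  | left | right | leftEq | rightEq | free

/-- The vertex of the row above that a vertex depends on (the vertex itself if there is none). -/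
def Choice.parent : Choice → Node → Node
  | left, p => upL p
  | right, p => upR p
  | leftEq, p => upL p
  | rightEq, p => upR p
  | free, p => p

/-- The weight of a vertex as a function of its distance to the parent. -/
def Choice.kernel : Choice → ℤ → ℤ[X]
  | left, n => if n = 0 then 1 else if n < 0 then 1 - X else 0
  | right, n => if n = 0 then 1 else if 0 < n then 1 - X else 0
  | leftEq, n => if n = 0 then 1 else 0
  | rightEq, n => if n = 0 then 1 else 0
  | free, _ => X - 1

/-- The edges that must be present for a choice to be possible. -/
def Choice.Allowed (H : Node → Node → Prop) (p : Node) : Choice → Prop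
  | left => H p (upL p)
  | right => H p (upR p)
  | leftEq => H p (upL p)
  | rightEq => H p (upR p)
  | free => H p (upL p) ∧ H p (upR p)

open Classical in
/-- The contribution of a choice at the vertex `p`. -/
def localWeight (H : Node → Node → Prop) (p : Node) (o : Choice) (x : Node → ℤ) : ℤ[X] :=
  if o.Allowed H p then o.kernel (x p - x (o.parent p)) else 0

/-- The total contribution of a vertex that is not paired with a neighbour in its row. -/
def singleWeight (H : Node → Node → Prop) (x : Node → ℤ) (p : Node) : ℤ[X] :=
  localWeight H p .left x + localWeight H p .right x + localWeight H p .free x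

/-- The contribution of a vertex `p` that is paired with its left neighbour `q`. -/
def pairWeight (H : Node → Node → Prop) (x : Node → ℤ) (q p : Node) : ℤ[X] :=
  if q = (p.1, p.2 - 1) then -X * (localWeight H p .leftEq x * localWeight H q .rightEq x) else 0

/-- The sum over all decompositions of a list of vertices into single vertices and pairs. -/
def continuant (H : Node → Node → Prop) (x : Node → ℤ) : List Node → ℤ[X]
  | [] => 1
  | [p] => singleWeight H x p
  | p :: q :: l => singleWeight H x p * continuant H x (q :: l) +
      pairWeight H x q p * continuant H x l

theorem continuant_cons_cons (H : Node → Node → Prop) (x : Node → ℤ) (p q : Node) (l : List Node) :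
    continuant H x (p :: q :: l) = singleWeight H x p * continuant H x (q :: l) +
      pairWeight H x q p * continuant H x l := by
  rw [continuant]

theorem list_induction_two {α : Type*} {motive : List α → Prop} (nil : motive [])
    (single : ∀ a, motive [a])
    (cons : ∀ a b l, motive l → motive (b :: l) → motive (a :: b :: l)) : ∀ l, motive l := by
  have : ∀ l, motive l ∧ ∀ a, motive (a :: l) := by
    intro l
    induction l with
    | nil => exact ⟨nil, single⟩
    | cons b l ih => exact ⟨ih.2 b, fun a => cons a b l ih.1 (ih.2 b)⟩
  exact fun l => (this l).1

theorem continuant_congr {H H' : Node → Node → Prop} {x x' : Node → ℤ} (l : List Node)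
    (h1 : ∀ p ∈ l, singleWeight H x p = singleWeight H' x' p)
    (h2 : ∀ p ∈ l, ∀ q ∈ l, pairWeight H x q p = pairWeight H' x' q p) :
    continuant H x l = continuant H' x' l := by
  induction l using list_induction_two with
  | nil => rfl
  | single a => exact h1 a (by simp)
  | cons a b l ih1 ih2 =>
    rw [continuant_cons_cons, continuant_cons_cons, h1 a (by simp), h2 a (by simp) b (by simp),
      ih1 (fun p hp => h1 p (by simp [hp])) (fun p hp q hq => h2 p (by simp [hp]) q (by simp [hq])),
      ih2 (fun p hp => h1 p (List.mem_cons_of_mem _ hp))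
        (fun p hp q hq => h2 p (List.mem_cons_of_mem _ hp) q (List.mem_cons_of_mem _ hq))]

theorem continuant_append {H : Node → Node → Prop} {x : Node → ℤ} (l l' : List Node)
    (h : ∀ p ∈ l, ∀ q ∈ l', pairWeight H x q p = 0) :
    continuant H x (l ++ l') = continuant H x l * continuant H x l' := by
  induction l using list_induction_two with
  | nil => simp [continuant]
  | single a =>
    cases l' with
    | nil => simp [continuant]
    | cons b l' =>
      rw [List.singleton_append, continuant_cons_cons, h a (by simp) b (by simp)]
      simp [continuant]
  | cons a b l ih1 ih2 =>
    have e1 := ih1 (fun p hp q hq => h p (by simp [hp]) q hq)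
    have e2 := ih2 (fun p hp q hq => h p (List.mem_cons_of_mem _ hp) q hq)
    simp only [List.cons_append] at e2 ⊢
    rw [continuant_cons_cons, continuant_cons_cons, e1, e2]
    ring

/-- In every decomposition `p` is either single, or the right member of a pair, or the left one; the
three hypotheses kill these three cases. -/
theorem continuant_eq_zero {H : Node → Node → Prop} {x : Node → ℤ} {p : Node}
    (h0 : singleWeight H x p = 0) (hL : localWeight H p .leftEq x = 0)
    (hR : localWeight H p .rightEq x = 0) (l : List Node) (hp : p ∈ l) :
    continuant H x l = 0 := by
  have e1 : ∀ q, pairWeight H x q p = 0 := fun q => by simp [pairWeight, hL]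
  have e2 : ∀ q, pairWeight H x p q = 0 := fun q => by simp [pairWeight, hR]
  induction l using list_induction_two with
  | nil => simp at hp
  | single a =>
    obtain rfl : p = a := by simpa using hp
    exact h0
  | cons a b l ih1 ih2 =>
    rw [continuant_cons_cons]
    simp only [List.mem_cons] at hp ih2
    rcases hp with rfl | rfl | hp
    · simp [h0, e1]
    · simp [ih2, e2]
    · simp [ih1 hp, ih2 (Or.inr hp)]

/-- The continuant as a sum of products of local weights; the choices involved do not depend on
the edges and on the coordinates. -/
theorem exists_continuant_expansion (l : List Node) (hl : l.Nodup) :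
    ∃ T : List (ℤ[X] × (Node → Choice)), ∀ (H : Node → Node → Prop) (x : Node → ℤ),
      continuant H x l =
        (T.map fun t => t.1 * (l.map fun p => localWeight H p (t.2 p) x).prod).sum := by
  classical
  have upd : ∀ (H : Node → Node → Prop) (x : Node → ℤ) (l : List Node) (p : Node) (o : Choice)
      (τ : Node → Choice), p ∉ l →
      (l.map fun q => localWeight H q (Function.update τ p o q) x) =
        (l.map fun q => localWeight H q (τ q) x) := by
    intro H x l p o τ hp
    apply List.map_congr_left
    intro q hq
    rw [Function.update_of_ne (by rintro rfl; exact hp hq)]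
  have step : ∀ (p : Node) (l : List Node), p ∉ l → (∃ T : List (ℤ[X] × (Node → Choice)),
      ∀ (H : Node → Node → Prop) (x : Node → ℤ), continuant H x l =
        (T.map fun t => t.1 * (l.map fun p => localWeight H p (t.2 p) x).prod).sum) →
      ∃ T : List (ℤ[X] × (Node → Choice)), ∀ (H : Node → Node → Prop) (x : Node → ℤ),
        singleWeight H x p * continuant H x l =
        (T.map fun t => t.1 * ((p :: l).map fun p => localWeight H p (t.2 p) x).prod).sum := by
    rintro p l hp ⟨T, hT⟩
    -- Each term for `l` is tripled according to the three summands of the single weight of `p`.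
    -- Overwriting the choice at `p` is harmless since `p` is not in `l`.
    refine ⟨(T.map fun t => (t.1, Function.update t.2 p .left)) ++
      (T.map fun t => (t.1, Function.update t.2 p .right)) ++
      (T.map fun t => (t.1, Function.update t.2 p .free)), fun H x => ?_⟩
    simp only [List.map_append, List.map_map, List.sum_append, Function.comp_def, List.map_cons,
      List.prod_cons, Function.update_self, upd H x l p _ _ hp, singleWeight, hT, add_mul,
      ← List.sum_map_mul_left]
    rw [← List.sum_map_add, ← List.sum_map_add]
    congr 1
    apply List.map_congr_left
    intros
    ring
  induction l using list_induction_two with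
  | nil => exact ⟨[(1, fun _ => .free)], fun H x => by simp [continuant]⟩
  | single a =>
    obtain ⟨T, hT⟩ := step a [] (by simp) ⟨[(1, fun _ => .free)], fun H x => by simp [continuant]⟩
    refine ⟨T, fun H x => ?_⟩
    rw [← hT]
    simp [continuant]
  | cons a b l ih1 ih2 =>
    rw [List.nodup_cons, List.nodup_cons] at hl
    obtain ⟨ha, hb, hl⟩ := hl
    obtain ⟨T, hT⟩ := step a (b :: l) ha (ih2 (List.nodup_cons.2 ⟨hb, hl⟩))
    obtain ⟨T', hT'⟩ := ih1 hl
    have hal : a ∉ l := fun h => ha (by simp [h])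
    have hab : a ≠ b := by rintro rfl; exact ha (by simp)
    by_cases hn : b = (a.1, a.2 - 1)
    · refine ⟨T ++ T'.map fun t => (-X * t.1,
        Function.update (Function.update t.2 a .leftEq) b .rightEq), fun H x => ?_⟩
      rw [continuant_cons_cons, hT, List.map_append, List.sum_append, pairWeight, if_pos hn, hT',
        ← List.sum_map_mul_left, List.map_map]
      congr 2
      apply List.map_congr_left
      intro t _
      simp only [Function.comp_def, List.map_cons, List.prod_cons, Function.update_self,
        upd H x l b _ _ hb, upd H x l a _ _ hal, Function.update_of_ne hab]
      ring
    · refine ⟨T, fun H x => ?_⟩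
      rw [continuant_cons_cons, hT, pairWeight, if_neg hn, zero_mul, add_zero]

/-! ### The continuant of an interlacing row -/

/-- The `t`-number `1 + t + ... + t^{m-1}`. -/
def tNumber (m : ℕ) : ℤ[X] := ∑ j ∈ Finset.range m, X ^ j

theorem tNumber_succ (m : ℕ) : tNumber (m + 1) = 1 + X * tNumber m := by
  rw [tNumber, Finset.sum_range_succ', tNumber, Finset.mul_sum, pow_zero, add_comm]
  congr 1
  apply Finset.sum_congr rfl
  intros
  ring

theorem one_sub_mul_tNumber (m : ℕ) : (1 - X) * tNumber m = 1 - X ^ m := by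
  rw [tNumber, mul_comm, geom_sum_mul_neg]

theorem tFactorial_succ (m : ℕ) : tFactorial (m + 1) = tFactorial m * tNumber (m + 1) := by
  rw [tFactorial, Finset.prod_Icc_succ_top (by omega)]
  rfl

/-- The contribution of a value taken `m` times in a row and `n` times in the next row. -/
def valueFactor (m n : ℕ) : ℤ[X] :=
  if n = m + 1 then 1 - X else if n = m then 1 else if m = n + 1 then tNumber m else 0

theorem valueFactor_succ (m : ℕ) : valueFactor m (m + 1) = 1 - X := by simp [valueFactor]

theorem valueFactor_self (m : ℕ) : valueFactor m m = 1 := by simp [valueFactor]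

theorem valueFactor_pred (m : ℕ) : valueFactor (m + 1) m = tNumber (m + 1) := by
  rw [valueFactor, if_neg (by omega), if_neg (by omega), if_pos rfl]

/-- The one nontrivial identity is `1 - X^(m+1) = (1 - X)[m+1]_t`. Through it the weight trades its
factors `1 - X^l` for local factors, at the price of t-factorials that telescope down the rows. -/
theorem tFactorial_mul_valueFactor {m n : ℕ} (h1 : m ≤ n + 1) (h2 : n ≤ m + 1) :
    tFactorial m * (if n = m + 1 then 1 - X ^ n else 1) = tFactorial n * valueFactor m n := by
  obtain h | h | h : n = m + 1 ∨ n = m ∨ m = n + 1 := by omega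
  · subst h
    rw [if_pos rfl, valueFactor_succ, tFactorial_succ, ← one_sub_mul_tNumber]
    ring
  · subst h
    rw [if_neg (by omega), valueFactor_self]
  · subst h
    rw [if_neg (by omega), valueFactor_pred, tFactorial_succ, mul_one]

open Classical in
/-- The number of the first `n` positions starting from `k₀` at which a partially defined
sequence takes the value `a`. -/
def valueCount (P : ℤ → Prop) (B : ℤ → ℤ) (k₀ : ℤ) (n : ℕ) (a : ℤ) : ℕ :=
  ((Finset.range n).filter fun m : ℕ => P (k₀ + m) ∧ B (k₀ + m) = a).card

theorem valueCount_succ_of_eq {P : ℤ → Prop} {B : ℤ → ℤ} {k₀ : ℤ} {n : ℕ} (h : P (k₀ + n)) :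
    valueCount P B k₀ (n + 1) (B (k₀ + n)) = valueCount P B k₀ n (B (k₀ + n)) + 1 := by
  rw [valueCount, Finset.range_add_one, Finset.filter_insert, if_pos ⟨h, rfl⟩,
    Finset.card_insert_of_notMem (by simp), valueCount]

theorem valueCount_succ_of_ne {P : ℤ → Prop} {B : ℤ → ℤ} {k₀ : ℤ} {n : ℕ} {a : ℤ}
    (h : ¬ (P (k₀ + n) ∧ B (k₀ + n) = a)) :
    valueCount P B k₀ (n + 1) a = valueCount P B k₀ n a := by
  rw [valueCount, Finset.range_add_one, Finset.filter_insert, if_neg h, valueCount]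

theorem valueCount_eq_zero {P : ℤ → Prop} {B : ℤ → ℤ} {k₀ : ℤ} {n : ℕ} {a : ℤ}
    (h : ∀ j < k₀ + n, P j → B j ≠ a) : valueCount P B k₀ n a = 0 := by
  rw [valueCount, Finset.card_eq_zero, Finset.eq_empty_iff_forall_notMem]
  intro m hm
  simp only [Finset.mem_filter, Finset.mem_range] at hm
  obtain ⟨hm, h1, h2⟩ := hm
  exact h _ (by omega) h1 h2

theorem prod_eq_of_update {A : Finset ℤ} {z : ℤ} (hz : z ∈ A) {f g : ℤ → ℤ[X]}
    (h : ∀ a, a ≠ z → f a = g a) : ∏ a ∈ A, f a = f z * ∏ a ∈ A.erase z, g a := by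
  rw [← Finset.mul_prod_erase A f hz]
  congr 1
  exact Finset.prod_congr rfl fun a ha => h a (Finset.ne_of_mem_erase ha)

/-- Two partially defined sequences `B` and `C` of integers that interlace as neighbouring rows of
an ordinary subgraph do. -/
structure RowsInterlace (hb hc : ℤ → Prop) (B C : ℤ → ℤ) : Prop where
  mono : ∀ j k, j ≤ k → hb j → hb k → B k ≤ B j
  convUp : ∀ j g k, j ≤ g → g ≤ k → hb j → hb k → hb g
  convDown : ∀ j g k, j ≤ g → g ≤ k → hc j → hc k → hc g
  above : ∀ k, hc k → hc (k + 1) → hb (k + 1)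
  below : ∀ k, hb k → hb (k + 1) → hc k
  link : ∀ k, hc k → hb k ∨ hb (k + 1)
  le_left : ∀ k, hc k → hb k → C k ≤ B k
  right_le : ∀ k, hc k → hb (k + 1) → B (k + 1) ≤ C k

namespace RowsInterlace

variable {hb hc : ℤ → Prop} {B C : ℤ → ℤ}

theorem le_of_lt (h : RowsInterlace hb hc B C) {j k : ℤ} (hjk : j < k) (hj : hc j) (hk : hb k) :
    B k ≤ C j := by
  have h1 : hb (j + 1) := (h.link j hj).elim
    (fun h' => h.convUp j (j + 1) k (by omega) (by omega) h' hk) id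
  exact (h.mono _ _ (by omega) h1 hk).trans (h.right_le j hj h1)

theorem not_up_of_le (h : RowsInterlace hb hc B C) {j k : ℤ} (hk : hc k) (hk' : ¬ hb k)
    (hjk : j ≤ k) : ¬ hb j := fun hj => by
  have := (h.link k hk).resolve_left hk'
  exact hk' (h.convUp j k (k + 1) hjk (by omega) hj this)

theorem not_down_of_lt (h : RowsInterlace hb hc B C) {j k : ℤ} (hk : hc k) (hk' : ¬ hb k)
    (hjk : j < k) : ¬ hc j := fun hj => by
  have := h.convDown j (k - 1) k (by omega) (by omega) hj hk
  apply hk'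
  have := h.above (k - 1) this (by simpa using hk)
  simpa using this

theorem not_up_of_le' (h : RowsInterlace hb hc B C) {j k : ℤ} (hk : ¬ hc k) (hk' : hb (k + 1))
    (hjk : j ≤ k) : ¬ hb j := fun hj =>
  hk (h.below k (h.convUp j k (k + 1) hjk (by omega) hj hk') hk')

theorem not_down_of_le' (h : RowsInterlace hb hc B C) {j k : ℤ} (hk : ¬ hc k) (hk' : hb (k + 1))
    (hjk : j ≤ k) : ¬ hc j := fun hj => by
  have hne : j ≠ k := by rintro rfl; exact hk hj
  exact (h.link j hj).elim (h.not_up_of_le' hk hk' hjk) (h.not_up_of_le' hk hk' (by omega))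

/-- The zigzag `B k, C k, B (k+1), C (k+1), ...` is weakly decreasing, and vertices are absent only
at its ends. Hence the copies of a value are consecutive, and appending an entry changes only the
factor of the last value. The upper row is counted one position ahead of the lower one, so that each
step appends `C k` and then `B (k+1)`. The recursion has order two: `η` is the part of the
continuant in which the latest lower vertex is paired with its future right neighbour, and the last
clause of the invariant evaluates it. -/
theorem scan [DecidablePred hb] [DecidablePred hc] (h : RowsInterlace hb hc B C) (A : Finset ℤ) (hBA : ∀ k, hb k → B k ∈ A)
    (hCA : ∀ k, hc k → C k ∈ A) (k₀ : ℤ) (hk₀ : ¬ hb k₀) (eL eR : ℤ → ℤ[X])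
    (heL : ∀ k, eL k = if hb k ∧ B k = C k then 1 else 0)
    (heR : ∀ k, eR k = if hb (k + 1) ∧ B (k + 1) = C k then 1 else 0)
    (β η : ℕ → ℤ[X]) (hβ0 : β 0 = 1)
    (hβ : ∀ n : ℕ, β (n + 1) = if hc (k₀ + n) then
      (1 - X + X * eL (k₀ + n) + X * eR (k₀ + n)) * β n - X * eL (k₀ + n) * η n else β n)
    (hη : ∀ n : ℕ, η (n + 1) = if hc (k₀ + n) then eR (k₀ + n) * β n else 0) (n : ℕ) :
    (∀ a, valueCount hb B (k₀ + 1) n a ≤ valueCount hc C k₀ n a + 1 ∧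
      valueCount hc C k₀ n a ≤ valueCount hb B (k₀ + 1) n a + 1) ∧
    β n = ∏ a ∈ A, valueFactor (valueCount hb B (k₀ + 1) n a) (valueCount hc C k₀ n a) ∧
    (hb (k₀ + n) → 1 ≤ valueCount hb B (k₀ + 1) n (B (k₀ + n)) ∧
      valueCount hc C k₀ n (B (k₀ + n)) ≤ valueCount hb B (k₀ + 1) n (B (k₀ + n)) ∧
      η n = (if valueCount hc C k₀ n (B (k₀ + n)) = valueCount hb B (k₀ + 1) n (B (k₀ + n)) then 1
        else tNumber (valueCount hb B (k₀ + 1) n (B (k₀ + n)) - 1)) *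
        ∏ a ∈ A.erase (B (k₀ + n)),
          valueFactor (valueCount hb B (k₀ + 1) n a) (valueCount hc C k₀ n a)) := by
  induction n with
  | zero =>
    refine ⟨by simp [valueCount], by simp [valueCount, hβ0, valueFactor], ?_⟩
    intro hb'
    simp only [Nat.cast_zero, add_zero] at hb'
    exact absurd hb' hk₀
  | succ n ih =>
    obtain ⟨hgood, hβn, hcur⟩ := ih
    set k : ℤ := k₀ + n with hk
    have hk1 : k₀ + ((n + 1 : ℕ) : ℤ) = k + 1 := by push_cast; omega
    have hk1' : k₀ + 1 + (n : ℤ) = k + 1 := by omega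
    set mB := valueCount hb B (k₀ + 1) n with hmB
    set mC := valueCount hc C k₀ n with hmC
    set mB' := valueCount hb B (k₀ + 1) (n + 1) with hmB'
    set mC' := valueCount hc C k₀ (n + 1) with hmC'
    rw [hk1]
    have hzeroB : ∀ a, (∀ j ≤ k, hb j → B j ≠ a) → mB a = 0 := fun a ha =>
      valueCount_eq_zero fun j hj => ha j (by omega)
    have hzeroC : ∀ a, (∀ j < k, hc j → C j ≠ a) → mC a = 0 := fun a ha =>
      valueCount_eq_zero fun j hj => ha j (by omega)
    have hzeroC' : ∀ a, (∀ j ≤ k, hc j → C j ≠ a) → mC' a = 0 := fun a ha =>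
      valueCount_eq_zero fun j hj => ha j (by omega)
    -- appending the vertex of the lower row
    have half : (∀ a, mB a ≤ mC' a + 1 ∧ mC' a ≤ mB a + 1) ∧
        (if hc k then (1 - X + X * eL k) * β n - X * eL k * η n else β n) =
          ∏ a ∈ A, valueFactor (mB a) (mC' a) ∧
        (hc k → 1 ≤ mC' (C k) ∧ mB (C k) ≤ mC' (C k) ∧
          β n = valueFactor (mB (C k)) (mC' (C k) - 1) *
            ∏ a ∈ A.erase (C k), valueFactor (mB a) (mC' a)) := by
      by_cases hck : hc k
      · rw [if_pos hck]
        have eC : mC' (C k) = mC (C k) + 1 := valueCount_succ_of_eq hck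
        have neC : ∀ a, a ≠ C k → mC' a = mC a := fun a ha =>
          valueCount_succ_of_ne fun h => ha h.2.symm
        have zA := hCA k hck
        have p1 : β n = valueFactor (mB (C k)) (mC (C k)) *
            ∏ a ∈ A.erase (C k), valueFactor (mB a) (mC' a) := by
          rw [hβn]
          exact prod_eq_of_update zA fun a ha => by rw [neC a ha]
        have p2 : ∏ a ∈ A, valueFactor (mB a) (mC' a) = valueFactor (mB (C k)) (mC (C k) + 1) *
            ∏ a ∈ A.erase (C k), valueFactor (mB a) (mC' a) := by
          rw [← eC]
          exact prod_eq_of_update zA fun a ha => rfl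
        -- Either `C k` continues the current block of equal values, or its value is new and both of
        -- its counts so far are zero.
        by_cases hbk : hb k ∧ B k = C k
        · obtain ⟨c1, c2, c3⟩ := hcur hbk.1
          rw [hbk.2] at c1 c2 c3
          have g := hgood (C k)
          have p3 : ∏ a ∈ A.erase (C k), valueFactor (mB a) (mC a) =
              ∏ a ∈ A.erase (C k), valueFactor (mB a) (mC' a) :=
            Finset.prod_congr rfl fun a ha => by rw [neC a (Finset.ne_of_mem_erase ha)]
          refine ⟨fun a => ?_, ?_, fun _ => ⟨by omega, by omega, ?_⟩⟩
          · by_cases ha : a = C k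
            · subst ha; omega
            · rw [neC a ha]; exact hgood a
          · rw [heL, if_pos hbk, p2, c3, p1, p3]
            obtain e | ⟨m, e1, e2⟩ : mC (C k) = mB (C k) ∨
                ∃ m, mB (C k) = m + 1 ∧ mC (C k) = m := by
              by_cases e : mC (C k) = mB (C k)
              · exact Or.inl e
              · exact Or.inr ⟨mC (C k), by omega, rfl⟩
            · rw [e, valueFactor_self, valueFactor_succ, if_pos rfl]
              ring
            · rw [e1, e2, valueFactor_self, valueFactor_pred, if_neg (by omega),
                Nat.add_sub_cancel, tNumber_succ]
              ring
          · rw [p1, eC, Nat.add_sub_cancel]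
        · have z1 : mB (C k) = 0 := hzeroB _ fun j hj hbj he => by
            by_cases hbk' : hb k
            · have := h.mono j k hj hbj hbk'
              have := h.le_left k hck hbk'
              exact hbk ⟨hbk', by omega⟩
            · exact h.not_up_of_le hck hbk' hj hbj
          have z2 : mC (C k) = 0 := hzeroC _ fun j hj hcj he => by
            by_cases hbk' : hb k
            · have := h.le_of_lt hj hcj hbk'
              have := h.le_left k hck hbk'
              exact hbk ⟨hbk', by omega⟩
            · exact h.not_down_of_lt hck hbk' hj hcj
          refine ⟨fun a => ?_, ?_, fun _ => ⟨by omega, by omega, ?_⟩⟩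
          · by_cases ha : a = C k
            · subst ha; omega
            · rw [neC a ha]; exact hgood a
          · rw [heL, if_neg hbk, p2, p1, z1, z2, valueFactor_self, valueFactor_succ]
            ring
          · rw [p1, eC, Nat.add_sub_cancel]
      · rw [if_neg hck]
        have neC : ∀ a, mC' a = mC a := fun a => valueCount_succ_of_ne fun h => hck h.1
        refine ⟨fun a => by rw [neC]; exact hgood a, ?_, fun h => absurd h hck⟩
        rw [hβn]
        exact Finset.prod_congr rfl fun a _ => by rw [neC]
    obtain ⟨hgood', hγ, hcur'⟩ := half
    -- appending the vertex of the upper row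
    rw [hβ, hη]
    by_cases hbk : hb (k + 1)
    · have eB : mB' (B (k + 1)) = mB (B (k + 1)) + 1 := by
        have := valueCount_succ_of_eq (P := hb) (B := B) (k₀ := k₀ + 1) (n := n)
          (by rw [hk1']; exact hbk)
        rwa [hk1'] at this
      have neB : ∀ a, a ≠ B (k + 1) → mB' a = mB a := fun a ha =>
        valueCount_succ_of_ne fun h => ha (by rw [← h.2, hk1'])
      have zA := hBA _ hbk
      have p2 : ∏ a ∈ A, valueFactor (mB' a) (mC' a) =
          valueFactor (mB (B (k + 1)) + 1) (mC' (B (k + 1))) *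
          ∏ a ∈ A.erase (B (k + 1)), valueFactor (mB a) (mC' a) := by
        rw [← eB]
        exact prod_eq_of_update zA fun a ha => by rw [neB a ha]
      have p3 : ∏ a ∈ A.erase (B (k + 1)), valueFactor (mB' a) (mC' a) =
          ∏ a ∈ A.erase (B (k + 1)), valueFactor (mB a) (mC' a) :=
        Finset.prod_congr rfl fun a ha => by rw [neB a (Finset.ne_of_mem_erase ha)]
      have p1 : ∏ a ∈ A, valueFactor (mB a) (mC' a) =
          valueFactor (mB (B (k + 1))) (mC' (B (k + 1))) *
          ∏ a ∈ A.erase (B (k + 1)), valueFactor (mB a) (mC' a) :=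
        prod_eq_of_update zA fun a ha => rfl
      by_cases hck : hc k ∧ B (k + 1) = C k
      · obtain ⟨hck, he⟩ := hck
        obtain ⟨c1, c2, c3⟩ := hcur' hck
        rw [if_pos hck] at hγ ⊢
        rw [if_pos hck, heR, if_pos ⟨hbk, he⟩, p2, p3]
        rw [p1] at hγ
        rw [← he] at c1 c2 c3
        have g := hgood' (B (k + 1))
        refine ⟨fun a => ?_, ?_, fun _ => ⟨by omega, by omega, ?_⟩⟩
        · by_cases ha : a = B (k + 1)
          · rw [ha]; omega
          · rw [neB a ha]; exact hgood' a
        -- The first part is the product after appending `C k` alone. The extra `X * β n` is the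
        -- effect of `B (k+1)` prolonging the block of `C k`.
        · have : (1 - X + X * eL k + X * 1) * β n - X * eL k * η n =
              ((1 - X + X * eL k) * β n - X * eL k * η n) + X * β n := by ring
          rw [this, hγ, c3]
          obtain ⟨m, e1, e2⟩ | ⟨m, e1, e2⟩ : (∃ m, mC' (B (k + 1)) = m + 1 ∧ mB (B (k + 1)) = m) ∨
              ∃ m, mC' (B (k + 1)) = m + 1 ∧ mB (B (k + 1)) = m + 1 := by
            by_cases e : mC' (B (k + 1)) = mB (B (k + 1))
            · exact Or.inr ⟨mC' (B (k + 1)) - 1, by omega, by omega⟩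
            · exact Or.inl ⟨mB (B (k + 1)), by omega, rfl⟩
          · rw [e1, e2, valueFactor_succ, Nat.add_sub_cancel, valueFactor_self, valueFactor_self]
            ring
          · rw [e1, e2, valueFactor_self, Nat.add_sub_cancel, valueFactor_pred, valueFactor_pred,
              tNumber_succ (m + 1)]
            ring
        · rw [eB, one_mul, c3, Nat.add_sub_cancel]
          congr 1
          by_cases e : mC' (B (k + 1)) = mB (B (k + 1))
          · rw [if_neg (by omega), ← e]
            obtain ⟨m, hm⟩ : ∃ m, mC' (B (k + 1)) = m + 1 := ⟨mC' (B (k + 1)) - 1, by omega⟩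
            rw [hm, Nat.add_sub_cancel, valueFactor_pred]
          · have e' : mC' (B (k + 1)) = mB (B (k + 1)) + 1 := by omega
            rw [if_pos e', e', Nat.add_sub_cancel, valueFactor_self]
      -- Here `B (k+1)` starts a new block: the zigzag decreases and its preceding entry, if any, is
      -- different.
      · have z1 : mB (B (k + 1)) = 0 := hzeroB _ fun j hj hbj heq => by
          by_cases hck' : hc k
          · have hbk' : hb k := h.convUp j k (k + 1) hj (by omega) hbj hbk
            have := h.mono j k hj hbj hbk'
            have := h.le_left k hck' hbk'
            have := h.right_le k hck' hbk
            exact hck ⟨hck', by omega⟩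
          · exact h.not_up_of_le' hck' hbk hj hbj
        have z2 : mC' (B (k + 1)) = 0 := hzeroC' _ fun j hj hcj heq => by
          by_cases hck' : hc k
          · rcases hj.lt_or_eq with hj | rfl
            · have hbk' : hb k := by
                rcases h.link j hcj with h' | h'
                · exact h.convUp j k (k + 1) hj.le (by omega) h' hbk
                · exact h.convUp (j + 1) k (k + 1) (by omega) (by omega) h' hbk
              have := h.le_of_lt hj hcj hbk'
              have := h.le_left k hck' hbk'
              have := h.right_le k hck' hbk
              exact hck ⟨hck', by omega⟩
            · exact hck ⟨hck', heq.symm⟩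
          · exact h.not_down_of_le' hck' hbk hj hcj
        have eR0 : hc k → eR k = 0 := fun hck' => by
          rw [heR, if_neg fun h' => hck ⟨hck', h'.2⟩]
        rw [z1, z2, valueFactor_self] at p1
        rw [z1, z2, valueFactor_pred] at p2
        have hβ' : (if hc k then (1 - X + X * eL k + X * eR k) * β n - X * eL k * η n else β n) =
            ∏ a ∈ A, valueFactor (mB a) (mC' a) := by
          rw [← hγ]
          by_cases hck' : hc k
          · rw [if_pos hck', if_pos hck', eR0 hck']; ring
          · rw [if_neg hck', if_neg hck']
        have hη' : (if hc k then eR k * β n else 0) = 0 := by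
          by_cases hck' : hc k
          · rw [if_pos hck', eR0 hck', zero_mul]
          · rw [if_neg hck']
        rw [hβ', hη', p1, p2, eB, z1, z2]
        refine ⟨fun a => ?_, ?_, fun _ => ⟨by omega, by omega, ?_⟩⟩
        · by_cases ha : a = B (k + 1)
          · rw [ha]; omega
          · rw [neB a ha]; exact hgood' a
        · simp [tNumber]
        · simp [tNumber]
    · have neB : ∀ a, mB' a = mB a := fun a =>
        valueCount_succ_of_ne fun h => hbk (by rw [← hk1']; exact h.1)
      refine ⟨fun a => by rw [neB]; exact hgood' a, ?_, fun h => absurd h hbk⟩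
      have : ∏ a ∈ A, valueFactor (mB' a) (mC' a) = ∏ a ∈ A, valueFactor (mB a) (mC' a) :=
        Finset.prod_congr rfl fun a _ => by rw [neB]
      rw [this, ← hγ]
      by_cases hck' : hc k
      · rw [if_pos hck', if_pos hck', heR, if_neg fun h' => hbk h'.1]; ring
      · rw [if_neg hck', if_neg hck']

end RowsInterlace

/-! ### Integer arrays on an ordinary subgraph -/

/-- All edges of `Γ` are present. -/
def fullEdges (Γ : Finset Node) : Node → Node → Prop := fun _ q => q ∈ Γ

/-- The inequalities between a vertex and its neighbours in the row above. -/
def InterlacesAt {α : Type*} [LinearOrder α] (Γ : Finset Node) (x : Node → α) (p : Node) : Prop :=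
  (upL p ∈ Γ → x p ≤ x (upL p)) ∧ (upR p ∈ Γ → x (upR p) ≤ x p)

/-- The coordinates in the top row weakly decrease from left to right. -/
def TopAntitone {α : Type*} [LinearOrder α] (Γ : Finset Node) (x : Node → α) : Prop :=
  Antitone fun k => x (topNode Γ k)

theorem TopAntitone.le {α : Type*} [LinearOrder α] {Γ : Finset Node} {x : Node → α}
    (hx : TopAntitone Γ x) {p q : Node}
    (hp : p ∈ Γ) (hq : q ∈ Γ) (hpt : p.1 = topRow Γ) (hqt : q.1 = topRow Γ) (h : p.2 ≤ q.2) :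
    x q ≤ x p := by
  obtain ⟨k, rfl⟩ := exists_topNode hp hpt
  obtain ⟨l, rfl⟩ := exists_topNode hq hqt
  exact hx (topNode_snd_le.1 h)

theorem IsOrdinary.right_le_left {α : Type*} [LinearOrder α] {Γ : Finset Node}
    (hΓ : IsOrdinary Γ) {x : Node → α}
    (hx : TopAntitone Γ x) {i j : ℤ} (h : ∀ q ∈ Γ, q.1 ≤ i → InterlacesAt Γ x q)
    (hL : (i, j) ∈ Γ) (hR : (i, j + 1) ∈ Γ) : x (i, j + 1) ≤ x (i, j) := by
  by_cases ht : topRow Γ < i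
  · have hm := hΓ.above i j ht hL hR
    have h1 := (h _ hL le_rfl).2 hm
    have h2 := (h _ hR le_rfl).1 hm
    exact h2.trans h1
  · have := topRow_le hL
    exact hx.le hL hR (by simp only at this ⊢; omega) (by simp only at this ⊢; omega) (by simp)

theorem IsOrdinary.row_antitone {α : Type*} [LinearOrder α] {Γ : Finset Node}
    (hΓ : IsOrdinary Γ) {x : Node → α}
    (hx : TopAntitone Γ x) (h : ∀ q ∈ Γ, InterlacesAt Γ x q) {i j k : ℤ}
    (hj : (i, j) ∈ Γ) (hk : (i, k) ∈ Γ) (hjk : j ≤ k) : x (i, k) ≤ x (i, j) := by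
  induction k, hjk using Int.leInduction with
  | base => exact le_rfl
  | succ k hjk ih =>
    have hk' := hΓ.row_ordConnected hj hk hjk (by omega)
    exact (hΓ.right_le_left hx (fun q hq _ => h q hq) hk' hk).trans (ih hk')

theorem localWeight_leftEq_full {Γ : Finset Node} {x : Node → ℤ} {p : Node} :
    localWeight (fullEdges Γ) p .leftEq x = 
      if upL p ∈ Γ ∧ x (upL p) = x p then 1 else 0 := by
  by_cases h1 : upL p ∈ Γ
  · simp [localWeight, Choice.Allowed, fullEdges, h1, Choice.kernel, Choice.parent, sub_eq_zero,
      eq_comm]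
  · simp [localWeight, Choice.Allowed, fullEdges, h1]

theorem localWeight_rightEq_full {Γ : Finset Node} {x : Node → ℤ} {p : Node} :
    localWeight (fullEdges Γ) p .rightEq x = 
      if upR p ∈ Γ ∧ x (upR p) = x p then 1 else 0 := by
  by_cases h1 : upR p ∈ Γ
  · simp [localWeight, Choice.Allowed, fullEdges, h1, Choice.kernel, Choice.parent, sub_eq_zero,
      eq_comm]
  · simp [localWeight, Choice.Allowed, fullEdges, h1]

theorem localWeight_of_allowed {H : Node → Node → Prop} {p : Node} {o : Choice} {x : Node → ℤ}
    (h : o.Allowed H p) : localWeight H p o x = o.kernel (x p - x (o.parent p)) := if_pos h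

theorem localWeight_of_not_allowed {H : Node → Node → Prop} {p : Node} {o : Choice}
    {x : Node → ℤ} (h : ¬ o.Allowed H p) : localWeight H p o x = 0 := if_neg h

theorem singleWeight_of_both {H : Node → Node → Prop} {p : Node} {x : Node → ℤ}
    (h1 : H p (upL p)) (h2 : H p (upR p)) : singleWeight H x p =
      Choice.left.kernel (x p - x (upL p)) + Choice.right.kernel (x p - x (upR p)) + (X - 1) := by
  rw [singleWeight, localWeight_of_allowed (o := .left) h1,
    localWeight_of_allowed (o := .right) h2, localWeight_of_allowed (o := .free) ⟨h1, h2⟩]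
  rfl

theorem singleWeight_of_left {H : Node → Node → Prop} {p : Node} {x : Node → ℤ}
    (h1 : H p (upL p)) (h2 : ¬ H p (upR p)) :
    singleWeight H x p = Choice.left.kernel (x p - x (upL p)) := by
  rw [singleWeight, localWeight_of_allowed (o := .left) h1,
    localWeight_of_not_allowed (o := .right) h2,
    localWeight_of_not_allowed (o := .free) fun h => h2 h.2, add_zero, add_zero]
  rfl

theorem singleWeight_of_right {H : Node → Node → Prop} {p : Node} {x : Node → ℤ}
    (h1 : ¬ H p (upL p)) (h2 : H p (upR p)) :
    singleWeight H x p = Choice.right.kernel (x p - x (upR p)) := by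
  rw [singleWeight, localWeight_of_not_allowed (o := .left) h1,
    localWeight_of_allowed (o := .right) h2,
    localWeight_of_not_allowed (o := .free) fun h => h1 h.1, add_zero, zero_add]
  rfl

/-- The interval function at work: inside the interval the half-lines and the free term add up to `1
- X`, and every end point that is attained adds another `X`. With just one upper neighbour a single
half-line remains, and the formula is the same. -/
theorem singleWeight_full {Γ : Finset Node} {x : Node → ℤ} {p : Node}
    (hup : upL p ∈ Γ ∨ upR p ∈ Γ) (h : InterlacesAt Γ x p) :
    singleWeight (fullEdges Γ) x p = 1 - X + X * localWeight (fullEdges Γ) p .leftEq x +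
      X * localWeight (fullEdges Γ) p .rightEq x := by
  obtain ⟨hL, hR⟩ := h
  rw [localWeight_leftEq_full, localWeight_rightEq_full]
  by_cases h1 : upL p ∈ Γ <;> by_cases h2 : upR p ∈ Γ
  · rw [singleWeight_of_both h1 h2]
    have hL := hL h1
    have hR := hR h2
    simp only [h1, h2, true_and, Choice.kernel]
    split_ifs <;> first | omega | ring1
  · rw [singleWeight_of_left h1 h2]
    have hL := hL h1
    simp only [h1, h2, true_and, false_and, if_false, Choice.kernel]
    split_ifs <;> first | omega | ring1
  · rw [singleWeight_of_right h1 h2]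
    have hR := hR h2
    simp only [h1, h2, true_and, false_and, if_false, Choice.kernel]
    split_ifs <;> first | omega | ring1
  · exact absurd hup (by tauto)

/-- Beyond one end of the interval, one half-line function vanishes while the other equals `1 - X`
and cancels the free term. This needs the end points in the right order, whence `hdec`. -/
theorem localWeight_full_eq_zero {Γ : Finset Node} {x : Node → ℤ} {p : Node}
    (hdec : upL p ∈ Γ → upR p ∈ Γ → x (upR p) ≤ x (upL p)) (h : ¬ InterlacesAt Γ x p) :
    singleWeight (fullEdges Γ) x p = 0 ∧ localWeight (fullEdges Γ) p .leftEq x = 0 ∧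
      localWeight (fullEdges Γ) p .rightEq x = 0 := by
  rw [localWeight_leftEq_full, localWeight_rightEq_full]
  rw [InterlacesAt] at h
  by_cases h1 : upL p ∈ Γ <;> by_cases h2 : upR p ∈ Γ
  · rw [singleWeight_of_both h1 h2]
    have hdec := hdec h1 h2
    simp only [h1, h2, true_imp_iff] at h
    simp only [h1, h2, true_and, Choice.kernel]
    refine ⟨?_, ?_, ?_⟩ <;> (split_ifs <;> first | omega | ring1)
  · rw [singleWeight_of_left h1 h2]
    simp only [h1, h2, true_imp_iff, false_imp_iff, and_true] at h
    simp only [h1, h2, true_and, false_and, if_false, and_true, Choice.kernel]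
    refine ⟨?_, ?_⟩ <;> (split_ifs <;> first | omega | ring1)
  · rw [singleWeight_of_right h1 h2]
    simp only [h1, h2, true_imp_iff, false_imp_iff, true_and] at h
    simp only [h1, h2, true_and, false_and, if_false, Choice.kernel]
    refine ⟨?_, ?_⟩ <;> (split_ifs <;> first | omega | ring1)
  · exact absurd h (by tauto)

/-- Descending from the top row: interlacing in the higher rows orders the upper neighbours of `p`,
so a violated inequality at `p` would make all local contributions of `p`, and with them the
continuant, vanish. -/
theorem IsOrdinary.interlacesAt_of_continuant_ne_zero {Γ : Finset Node} (hΓ : IsOrdinary Γ)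
    {x : Node → ℤ} (hx : TopAntitone Γ x) {l : List Node} (hl : ∀ p ∈ lower Γ, p ∈ l)
    (h : continuant (fullEdges Γ) x l ≠ 0) : ∀ p ∈ Γ, InterlacesAt Γ x p := by
  refine node_induction ?_ ?_
  · intro p hp hpt
    constructor <;> intro hq <;> have := topRow_le hq <;> simp only [upL, upR] at this <;> omega
  · intro p hp ih
    by_contra hn
    obtain ⟨h1, h2, h3⟩ := localWeight_full_eq_zero (fun hL hR => hΓ.right_le_left hx
      (fun q hq hqi => ih q hq (by omega)) hL hR) hn
    exact h (continuant_eq_zero h1 h2 h3 l (hl p hp))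

/-! ### Lists of the vertices of a row and of all lower rows -/

/-- The vertices of `Γ` in row `i`, at the first `n` positions from `k₀` on, in reverse order. -/
def rowList (Γ : Finset Node) (i k₀ : ℤ) : ℕ → List Node
  | 0 => []
  | n + 1 => if (i, k₀ + n) ∈ Γ then (i, k₀ + n) :: rowList Γ i k₀ n else rowList Γ i k₀ n

theorem mem_rowList {Γ : Finset Node} {i k₀ : ℤ} {n : ℕ} {p : Node} :
    p ∈ rowList Γ i k₀ n ↔ p ∈ Γ ∧ p.1 = i ∧ k₀ ≤ p.2 ∧ p.2 < k₀ + n := by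
  induction n with
  | zero =>
    simp only [rowList, List.not_mem_nil, Nat.cast_zero, false_iff]
    omega
  | succ n ih =>
    obtain ⟨a, c⟩ := p
    rw [rowList]
    by_cases h : (i, k₀ + (n : ℤ)) ∈ Γ
    · rw [if_pos h, List.mem_cons, ih, Prod.mk.injEq]
      constructor
      · rintro (⟨rfl, rfl⟩ | ⟨h1, h2, h3, h4⟩)
        · exact ⟨h, rfl, by simp, by simp⟩
        · exact ⟨h1, h2, h3, by push_cast; simp only at h4 ⊢; omega⟩
      · rintro ⟨h1, h2, h3, h4⟩
        simp only at h2 h3 h4 ⊢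
        push_cast at h4
        by_cases hc : c = k₀ + n
        · exact Or.inl ⟨h2, hc⟩
        · exact Or.inr ⟨h1, h2, h3, by omega⟩
    · rw [if_neg h, ih]
      constructor
      · rintro ⟨h1, h2, h3, h4⟩
        exact ⟨h1, h2, h3, by push_cast; simp only at h4 ⊢; omega⟩
      · rintro ⟨h1, h2, h3, h4⟩
        refine ⟨h1, h2, h3, ?_⟩
        simp only at h2 h3 h4 ⊢
        push_cast at h4
        have : c ≠ k₀ + n := by rintro rfl; exact h (h2 ▸ h1)
        omega

theorem rowList_nodup (Γ : Finset Node) (i k₀ : ℤ) (n : ℕ) : (rowList Γ i k₀ n).Nodup := by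
  induction n with
  | zero => exact List.nodup_nil
  | succ n ih =>
    rw [rowList]
    split_ifs with h
    · refine List.nodup_cons.2 ⟨fun h' => ?_, ih⟩
      have := (mem_rowList.1 h').2.2.2
      simp at this
    · exact ih

/-- The vertices of `Γ` in the first `r` rows below the top row, in reverse order. -/
def gridList (Γ : Finset Node) (k₀ : ℤ) (n : ℕ) : ℕ → List Node
  | 0 => []
  | r + 1 => rowList Γ (topRow Γ + r + 1) k₀ n ++ gridList Γ k₀ n r

theorem mem_gridList {Γ : Finset Node} {k₀ : ℤ} {n r : ℕ} {p : Node} :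
    p ∈ gridList Γ k₀ n r ↔ p ∈ Γ ∧ topRow Γ < p.1 ∧ p.1 ≤ topRow Γ + r ∧ k₀ ≤ p.2 ∧
      p.2 < k₀ + n := by
  induction r with
  | zero =>
    simp only [gridList, List.not_mem_nil, Nat.cast_zero, false_iff]
    omega
  | succ r ih =>
    rw [gridList, List.mem_append, ih, mem_rowList]
    push_cast
    constructor
    · rintro (⟨h1, h2, h3, h4⟩ | ⟨h1, h2, h3, h4, h5⟩)
      · exact ⟨h1, by omega, by omega, h3, h4⟩
      · exact ⟨h1, h2, by omega, h4, h5⟩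
    · rintro ⟨h1, h2, h3, h4, h5⟩
      by_cases h : p.1 = topRow Γ + r + 1
      · exact Or.inl ⟨h1, h, h4, h5⟩
      · exact Or.inr ⟨h1, h2, by omega, h4, h5⟩

theorem gridList_nodup (Γ : Finset Node) (k₀ : ℤ) (n r : ℕ) : (gridList Γ k₀ n r).Nodup := by
  induction r with
  | zero => exact List.nodup_nil
  | succ r ih =>
    rw [gridList, List.nodup_append]
    refine ⟨rowList_nodup .., ih, ?_⟩
    rintro p hp q hq rfl
    have h1 := (mem_rowList.1 hp).2.1
    have h2 := (mem_gridList.1 hq).2.2.1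
    omega

/-! ### Multiplicities of values in rows -/

/-- The number of coordinates in row `i` that are equal to `a`. -/
def rowMult (Γ : Finset Node) (x : Node → ℤ) (i a : ℤ) : ℕ :=
  (Γ.filter fun p => p.1 = i ∧ x p = a).card

/-- The contribution of row `i` to the weight. -/
def rowWeight (Γ : Finset Node) (x : Node → ℤ) (i : ℤ) : ℤ[X] :=
  ∏ a ∈ Γ.image x, if rowMult Γ x i a = rowMult Γ x (i - 1) a + 1 then
    1 - X ^ rowMult Γ x i a else 1

theorem valueCount_eq_rowMult {Γ : Finset Node} {x : Node → ℤ} {i k₀ : ℤ} {n : ℕ}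
    (h : ∀ p ∈ Γ, k₀ ≤ p.2 ∧ p.2 < k₀ + n) (a : ℤ) :
    valueCount (fun k => (i, k) ∈ Γ) (fun k => x (i, k)) k₀ n a = rowMult Γ x i a := by
  rw [valueCount, rowMult]
  refine Finset.card_bij (fun m _ => (i, k₀ + (m : ℤ))) ?_ ?_ ?_
  · intro m hm
    simp only [Finset.mem_filter] at hm ⊢
    exact ⟨hm.2.1, trivial, hm.2.2⟩
  · intro m _ m' _ he
    simp only [Prod.mk.injEq] at he
    omega
  · rintro ⟨i', j⟩ hp
    rw [Finset.mem_filter] at hp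
    obtain ⟨h1, h2, h3⟩ := hp
    simp only at h2 h3
    subst h2
    have := h _ h1
    simp only at this
    have e : k₀ + (((j - k₀).toNat : ℕ) : ℤ) = j := by omega
    refine ⟨(j - k₀).toNat, ?_, ?_⟩
    · simp only [Finset.mem_filter, Finset.mem_range, e]
      exact ⟨by omega, h1, h3⟩
    · rw [e]

theorem IsOrdinary.rowsInterlace {Γ : Finset Node} (hΓ : IsOrdinary Γ) {x : Node → ℤ}
    (hx : TopAntitone Γ x) (h : ∀ q ∈ Γ, InterlacesAt Γ x q) {i : ℤ} (hi : topRow Γ < i) :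
    RowsInterlace (fun k => (i - 1, k) ∈ Γ) (fun k => (i, k) ∈ Γ) (fun k => x (i - 1, k))
      (fun k => x (i, k)) where
  mono _ _ hjk hj hk := hΓ.row_antitone hx h hj hk hjk
  convUp _ _ _ h1 h2 hj hk := hΓ.row_ordConnected hj hk h1 h2
  convDown _ _ _ h1 h2 hj hk := hΓ.row_ordConnected hj hk h1 h2
  above k h1 h2 := hΓ.above i k hi h1 h2
  below k h1 h2 := by simpa using hΓ.below _ _ h1 h2
  link k hk := hΓ.up_mem (mem_lower.2 ⟨hk, hi⟩)
  le_left k hk hk' := (h _ hk).1 hk'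
  right_le k hk hk' := (h _ hk).2 hk'

theorem IsOrdinary.continuant_rowList {Γ : Finset Node} (hΓ : IsOrdinary Γ) {x : Node → ℤ}
    (hx : TopAntitone Γ x) (h : ∀ q ∈ Γ, InterlacesAt Γ x q) {i : ℤ} (hi : topRow Γ < i)
    {k₀ : ℤ} {n : ℕ} (hn : ∀ p ∈ Γ, k₀ < p.2 ∧ p.2 < k₀ + n) :
    (∀ a, rowMult Γ x (i - 1) a ≤ rowMult Γ x i a + 1 ∧
      rowMult Γ x i a ≤ rowMult Γ x (i - 1) a + 1) ∧
    continuant (fullEdges Γ) x (rowList Γ i k₀ n) =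
      ∏ a ∈ Γ.image x, valueFactor (rowMult Γ x (i - 1) a) (rowMult Γ x i a) := by
  let eL : ℤ → ℤ[X] := fun k => localWeight (fullEdges Γ) (i, k) .leftEq x
  let eR : ℤ → ℤ[X] := fun k => localWeight (fullEdges Γ) (i, k) .rightEq x
  let β : ℕ → ℤ[X] := fun n => continuant (fullEdges Γ) x (rowList Γ i k₀ n)
  -- The value at `0` reflects that the first position has no left neighbour to be paired with.
  let η : ℕ → ℤ[X] := fun n => Nat.casesOn n 0 fun m =>
    if (i, k₀ + (m : ℤ)) ∈ Γ then eR (k₀ + m) * β m else 0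
  have hβ : ∀ n : ℕ, β (n + 1) = if (i, k₀ + (n : ℤ)) ∈ Γ then
      (1 - X + X * eL (k₀ + n) + X * eR (k₀ + n)) * β n - X * eL (k₀ + n) * η n else β n := by
    intro n
    by_cases hm : (i, k₀ + (n : ℤ)) ∈ Γ
    · rw [if_pos hm]
      have hs := singleWeight_full (hΓ.up_mem (mem_lower.2 ⟨hm, hi⟩)) (h _ hm)
      have e1 : β (n + 1) = continuant (fullEdges Γ) x ((i, k₀ + (n : ℤ)) :: rowList Γ i k₀ n) := by
        simp only [β, rowList, if_pos hm]
      rw [e1]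
      cases n with
      | zero =>
        have e2 : η 0 = 0 := rfl
        rw [e2]
        simp only [rowList, continuant, β, hs, eL, eR]
        ring
      | succ n =>
        by_cases hm' : (i, k₀ + (n : ℤ)) ∈ Γ
        · have e2 : rowList Γ i k₀ (n + 1) = (i, k₀ + (n : ℤ)) :: rowList Γ i k₀ n := by
            rw [rowList, if_pos hm']
          have e3 : β (n + 1) = continuant (fullEdges Γ) x (rowList Γ i k₀ (n + 1)) := rfl
          have e4 : η (n + 1) = eR (k₀ + n) * β n := if_pos hm'
          rw [e3, e4, e2, continuant_cons_cons, hs, pairWeight, if_pos]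
          · simp only [eL, eR, β]
            ring
          · push_cast
            simp only [Prod.mk.injEq, true_and]
            omega
        · have e4 : η (n + 1) = 0 := if_neg hm'
          rw [e4, mul_zero, sub_zero]
          have hz : ∀ q ∈ rowList Γ i k₀ (n + 1),
              pairWeight (fullEdges Γ) x q (i, k₀ + ((n + 1 : ℕ) : ℤ)) = 0 := by
            intro q hq
            rw [pairWeight, if_neg]
            rintro rfl
            apply hm'
            have := (mem_rowList.1 hq).1
            convert this using 2
            push_cast
            ring
          have := continuant_append (H := fullEdges Γ) (x := x) [(i, k₀ + ((n + 1 : ℕ) : ℤ))]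
            (rowList Γ i k₀ (n + 1)) (by simpa using hz)
          rw [List.singleton_append] at this
          rw [this, continuant, hs]
    · simp only [β, rowList, if_neg hm]
  obtain ⟨g, hp, -⟩ := (hΓ.rowsInterlace hx h hi).scan (Γ.image x)
    (fun k hk => Finset.mem_image_of_mem x hk) (fun k hk => Finset.mem_image_of_mem x hk) k₀
    (fun hk => lt_irrefl _ (hn _ hk).1) eL eR
    (fun k => by simp only [eL, localWeight_leftEq_full]; rfl)
    (fun k => by simp only [eR, localWeight_rightEq_full]; rfl) β η rfl hβ (fun n => rfl) n
  have c1 : ∀ a, valueCount (fun k => (i - 1, k) ∈ Γ) (fun k => x (i - 1, k)) (k₀ + 1) n a =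
      rowMult Γ x (i - 1) a :=
    valueCount_eq_rowMult fun p hp => ⟨by have := hn p hp; omega, by have := hn p hp; omega⟩
  have c2 : ∀ a, valueCount (fun k => (i, k) ∈ Γ) (fun k => x (i, k)) k₀ n a =
      rowMult Γ x i a :=
    valueCount_eq_rowMult fun p hp => ⟨(hn p hp).1.le, (hn p hp).2⟩
  simp only [c1, c2] at g hp
  exact ⟨g, hp⟩

/-- Each row exchanges the t-factorials of its predecessor for its own, value by value. The
continuant is multiplicative over rows because pairs lie within one row. -/
theorem IsOrdinary.rowWeight_eq {Γ : Finset Node} (hΓ : IsOrdinary Γ) {x : Node → ℤ}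
    (hx : TopAntitone Γ x) (h : ∀ q ∈ Γ, InterlacesAt Γ x q) {k₀ : ℤ} {n : ℕ}
    (hn : ∀ p ∈ Γ, k₀ < p.2 ∧ p.2 < k₀ + n) (r : ℕ) :
    (∏ a ∈ Γ.image x, tFactorial (rowMult Γ x (topRow Γ) a)) *
        ∏ m ∈ Finset.range r, rowWeight Γ x (topRow Γ + m + 1) =
      (∏ a ∈ Γ.image x, tFactorial (rowMult Γ x (topRow Γ + r) a)) *
        continuant (fullEdges Γ) x (gridList Γ k₀ n r) := by
  induction r with
  | zero => simp [gridList, continuant]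
  | succ r ih =>
    obtain ⟨g, hc⟩ := hΓ.continuant_rowList hx h (i := topRow Γ + r + 1) (by omega) hn
    have e : topRow Γ + (r : ℤ) + 1 - 1 = topRow Γ + r := by ring
    have key : (∏ a ∈ Γ.image x, tFactorial (rowMult Γ x (topRow Γ + r) a)) *
        rowWeight Γ x (topRow Γ + r + 1) =
        (∏ a ∈ Γ.image x, tFactorial (rowMult Γ x (topRow Γ + r + 1) a)) *
        continuant (fullEdges Γ) x (rowList Γ (topRow Γ + r + 1) k₀ n) := by
      rw [hc, rowWeight, ← Finset.prod_mul_distrib, ← Finset.prod_mul_distrib]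
      refine Finset.prod_congr rfl fun a _ => ?_
      rw [e] at g ⊢
      exact tFactorial_mul_valueFactor (g a).1 (g a).2
    rw [Finset.prod_range_succ, ← mul_assoc, ih, gridList, continuant_append]
    · push_cast
      rw [← add_assoc]
      linear_combination continuant (fullEdges Γ) x (gridList Γ k₀ n r) * key
    · intro p hp q hq
      rw [pairWeight, if_neg]
      rintro rfl
      have h1 := (mem_rowList.1 hp).2.1
      have h2 := (mem_gridList.1 hq).2.2.1
      simp only at h2
      omega

/-! ### The weight in terms of multiplicities -/

/-- The graph on the vertices of `Γ` whose edges are the edges of `Γ` with equal coordinates at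
the end points. -/
def eqGraph (Γ : Finset Node) (x : Node → ℤ) : SimpleGraph {p : Node // p ∈ Γ} where
  Adj p q := lattice.Adj p q ∧ x p = x q
  symm := ⟨fun _ _ h => ⟨h.1.symm, h.2.symm⟩⟩
  loopless := ⟨fun _ h => h.1.ne rfl⟩

/-- The number of vertices of a connected component in a row. -/
def componentRowCount {Γ : Finset Node} {G : SimpleGraph {p : Node // p ∈ Γ}}
    (E : G.ConnectedComponent) (i : ℤ) : ℕ :=
  Set.ncard {p : {p : Node // p ∈ Γ} | p ∈ E.supp ∧ p.1.1 = i}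

/-- The statistic `d_l` of a graph on the vertices of `Γ`. -/
def graphStatistic (Γ : Finset Node) (G : SimpleGraph {p : Node // p ∈ Γ}) (l : ℕ) : ℕ :=
  Set.ncard {q : G.ConnectedComponent × ℤ |
    topRow Γ < q.2 ∧ componentRowCount q.1 (q.2 - 1) + 1 = l ∧ componentRowCount q.1 q.2 = l}

theorem weight_eq_of_faceGraph_eq {Γ : Finset Node} {F : Set Space}
    {G : SimpleGraph {p : Node // p ∈ Γ}} (h : faceGraph Γ F = G) :
    weight Γ F = ∏ l ∈ Finset.Icc 1 Γ.card, (1 - X ^ l) ^ graphStatistic Γ G l := by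
  subst h
  rfl

theorem ncard_subtype_eq_card_filter {α : Type*} (s : Finset α) (P : α → Prop) [DecidablePred P] :
    Set.ncard {p : {p : α // p ∈ s} | P p} = (s.filter P).card := by
  rw [← Set.ncard_coe_finset, ← Set.ncard_image_of_injective _ Subtype.val_injective]
  congr 1
  ext p
  simp only [Set.mem_image, Set.mem_ofPred_eq, Subtype.exists, exists_and_left, exists_prop,
    exists_eq_right_right, Finset.coe_filter]
  exact and_comm

theorem eq_of_reachable {Γ : Finset Node} {x : Node → ℤ} {p q : {p : Node // p ∈ Γ}}
    (h : (eqGraph Γ x).Reachable p q) : x p = x q := by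
  obtain ⟨w⟩ := h
  induction w with
  | nil => rfl
  | cons h _ ih => exact h.2.trans ih

/-- Equal neighbours in a row squeeze the vertex below and between them, which belongs to `Γ` by
`below`, so they are connected through it. Monotonicity of the row makes all intermediate vertices
equal. -/
theorem IsOrdinary.reachable_of_same_row {Γ : Finset Node} (hΓ : IsOrdinary Γ) {x : Node → ℤ}
    (hx : TopAntitone Γ x) (h : ∀ q ∈ Γ, InterlacesAt Γ x q) {i j k : ℤ} (hj : (i, j) ∈ Γ)
    (hk : (i, k) ∈ Γ) (hjk : j ≤ k) (he : x (i, j) = x (i, k)) :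
    (eqGraph Γ x).Reachable ⟨_, hj⟩ ⟨_, hk⟩ := by
  induction k, hjk using Int.leInduction with
  | base => exact SimpleGraph.Reachable.refl _
  | succ k hjk ih =>
    have hk' := hΓ.row_ordConnected hj hk hjk (by omega)
    have h1 := hΓ.row_antitone hx h hj hk' hjk
    have h2 := hΓ.row_antitone hx h hk' hk (by omega)
    have hm := hΓ.below _ _ hk' hk
    have h3 := (h _ hm).1
    have h4 := (h _ hm).2
    simp only [upL, upR, add_sub_cancel_right] at h3 h4
    have h3 := h3 hk'
    have h4 := h4 hk
    refine (ih hk' (by omega)).trans (SimpleGraph.Reachable.trans (v := ⟨_, hm⟩) ?_ ?_)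
    · refine SimpleGraph.Adj.reachable ⟨?_, ?_⟩
      · rw [lattice_adj_iff]; simp [upL]
      · simp only; omega
    · refine SimpleGraph.Adj.reachable ⟨?_, ?_⟩
      · rw [lattice_adj_iff]; simp [upR]
      · simp only; omega

theorem IsOrdinary.reachable_of_eq_row {Γ : Finset Node} (hΓ : IsOrdinary Γ) {x : Node → ℤ}
    (hx : TopAntitone Γ x) (h : ∀ q ∈ Γ, InterlacesAt Γ x q) {p q : {p : Node // p ∈ Γ}}
    (hrow : p.1.1 = q.1.1) (he : x p = x q) : (eqGraph Γ x).Reachable p q := by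
  obtain ⟨⟨i, j⟩, hp⟩ := p
  obtain ⟨⟨i', k⟩, hq⟩ := q
  simp only at hrow
  subst hrow
  rcases le_total j k with hjk | hjk
  · exact hΓ.reachable_of_same_row hx h hp hq hjk he
  · exact (hΓ.reachable_of_same_row hx h hq hp hjk he.symm).symm

theorem IsOrdinary.reachable_of_next_row {Γ : Finset Node} (hΓ : IsOrdinary Γ) {x : Node → ℤ}
    (hx : TopAntitone Γ x) (h : ∀ q ∈ Γ, InterlacesAt Γ x q) {p q : {p : Node // p ∈ Γ}}
    (hrow : p.1.1 = q.1.1 + 1) (he : x p = x q) : (eqGraph Γ x).Reachable p q := by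
  obtain ⟨⟨i, j⟩, hp⟩ := p
  obtain ⟨⟨i', k⟩, hq⟩ := q
  simp only at hrow
  subst hrow
  have hlow : (i' + 1, j) ∈ lower Γ := by
    refine mem_lower.2 ⟨hp, ?_⟩
    have := topRow_le hq
    simp only at this ⊢
    omega
  have hup := hΓ.up_mem hlow
  have h3 := (h _ hp).1
  have h4 := (h _ hp).2
  simp only [upL, upR, add_sub_cancel_right] at hup h3 h4
  simp only at he
  rcases le_or_gt k j with hjk | hjk
  · have hL : (i', j) ∈ Γ := hup.elim id fun hR => hΓ.row_ordConnected hq hR hjk (by omega)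
    have h3 := h3 hL
    have h5 := hΓ.row_antitone hx h hq hL hjk
    refine SimpleGraph.Reachable.trans (v := ⟨_, hL⟩) ?_
      (hΓ.reachable_of_eq_row hx h rfl (by simp only; omega))
    refine SimpleGraph.Adj.reachable ⟨?_, by simp only; omega⟩
    rw [lattice_adj_iff]; simp [upL]
  · have hR : (i', j + 1) ∈ Γ :=
      hup.elim (fun hL => hΓ.row_ordConnected hL hq (by omega) (by omega)) id
    have h4 := h4 hR
    have h5 := hΓ.row_antitone hx h hR hq (by omega)
    refine SimpleGraph.Reachable.trans (v := ⟨_, hR⟩) ?_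
      (hΓ.reachable_of_eq_row hx h rfl (by simp only; omega))
    refine SimpleGraph.Adj.reachable ⟨?_, by simp only; omega⟩
    rw [lattice_adj_iff]; simp [upR]

/-- The common coordinate of the vertices of a component. -/
def componentValue {Γ : Finset Node} {x : Node → ℤ} (E : (eqGraph Γ x).ConnectedComponent) : ℤ :=
  SimpleGraph.ConnectedComponent.lift (fun p : {p : Node // p ∈ Γ} => x p)
    (fun _ _ w _ => eq_of_reachable ⟨w⟩) E

theorem componentValue_mk {Γ : Finset Node} {x : Node → ℤ} (p : {p : Node // p ∈ Γ}) :
    componentValue ((eqGraph Γ x).connectedComponentMk p) = x p := rfl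

/-- Within a row, and between consecutive rows, equal vertices are connected. So in these rows the
component consists of all vertices with its value, whereas in distant rows the same value may belong
to other components. -/
theorem IsOrdinary.componentRowCount_mk {Γ : Finset Node} (hΓ : IsOrdinary Γ) {x : Node → ℤ}
    (hx : TopAntitone Γ x) (h : ∀ q ∈ Γ, InterlacesAt Γ x q) (p : {p : Node // p ∈ Γ}) {i : ℤ}
    (hi : i = p.1.1 ∨ i = p.1.1 - 1) :
    componentRowCount ((eqGraph Γ x).connectedComponentMk p) i = rowMult Γ x i (x p) := by
  rw [componentRowCount, rowMult, ← ncard_subtype_eq_card_filter]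
  congr 1
  ext q
  simp only [SimpleGraph.ConnectedComponent.mem_supp_iff, SimpleGraph.ConnectedComponent.eq,
    Set.mem_ofPred_eq]
  constructor
  · rintro ⟨h1, h2⟩
    exact ⟨h2, eq_of_reachable h1⟩
  · rintro ⟨h1, h2⟩
    refine ⟨?_, h1⟩
    rcases hi with hi | hi
    · exact hΓ.reachable_of_eq_row hx h (h1.trans hi) h2
    · exact (hΓ.reachable_of_next_row hx h (by omega) h2.symm).symm

theorem exists_mem_of_componentRowCount_pos {Γ : Finset Node}
    {G : SimpleGraph {p : Node // p ∈ Γ}} {E : G.ConnectedComponent} {i : ℤ}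
    (h : 1 ≤ componentRowCount E i) : ∃ p, G.connectedComponentMk p = E ∧ p.1.1 = i := by
  have hne : componentRowCount E i ≠ 0 := by omega
  obtain ⟨p, hp⟩ := Set.nonempty_of_ncard_ne_zero hne
  exact ⟨p, hp.1, hp.2⟩

/-- The pair of a component and a row corresponds to the pair of a row and a value. Since `1 ≤ l`,
the component meets the lower of the two rows and is therefore determined by its value there. -/
theorem IsOrdinary.graphStatistic_eq {Γ : Finset Node} (hΓ : IsOrdinary Γ) {x : Node → ℤ}
    (hx : TopAntitone Γ x) (h : ∀ q ∈ Γ, InterlacesAt Γ x q) {R : ℕ}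
    (hR : ∀ p ∈ Γ, p.1 ≤ topRow Γ + R) {l : ℕ} (hl : 1 ≤ l) :
    graphStatistic Γ (eqGraph Γ x) l = ((Finset.range R ×ˢ Γ.image x).filter fun q =>
      rowMult Γ x (topRow Γ + q.1) q.2 + 1 = l ∧ rowMult Γ x (topRow Γ + q.1 + 1) q.2 = l).card := by
  rw [graphStatistic, ← Set.ncard_coe_finset]
  refine Set.ncard_congr (fun q _ => ((q.2 - topRow Γ - 1).toNat, componentValue q.1)) ?_ ?_ ?_
  · rintro ⟨E, i⟩ ⟨h1, h2, h3⟩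
    simp only at h1 h2 h3
    obtain ⟨p, rfl, hpi⟩ := exists_mem_of_componentRowCount_pos (h3 ▸ hl)
    rw [hΓ.componentRowCount_mk hx h p (by omega)] at h2 h3
    have := hR p p.2
    have e : topRow Γ + ((i - topRow Γ - 1).toNat : ℤ) = i - 1 := by omega
    simp only [Finset.coe_filter, Set.mem_ofPred_eq, Finset.mem_product, Finset.mem_range,
      componentValue_mk, e, sub_add_cancel]
    exact ⟨⟨by omega, Finset.mem_image_of_mem x p.2⟩, h2, h3⟩
  · rintro ⟨E, i⟩ ⟨E', i'⟩ ⟨h1, h2, h3⟩ ⟨h1', h2', h3'⟩ he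
    simp only at h1 h2 h3 h1' h2' h3' he
    obtain ⟨p, rfl, hpi⟩ := exists_mem_of_componentRowCount_pos (h3 ▸ hl)
    obtain ⟨p', rfl, hpi'⟩ := exists_mem_of_componentRowCount_pos (h3' ▸ hl)
    simp only [Prod.mk.injEq, componentValue_mk] at he
    have hii : i = i' := by omega
    subst hii
    rw [Prod.mk.injEq]
    exact ⟨SimpleGraph.ConnectedComponent.eq.2
      (hΓ.reachable_of_eq_row hx h (hpi.trans hpi'.symm) he.2), rfl⟩
  · rintro ⟨m, a⟩ hq
    simp only [Finset.coe_filter, Set.mem_ofPred_eq] at hq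
    obtain ⟨-, h2, h3⟩ := hq
    have hpos : 0 < rowMult Γ x (topRow Γ + m + 1) a := by omega
    rw [rowMult, Finset.card_pos] at hpos
    obtain ⟨p, hp⟩ := hpos
    rw [Finset.mem_filter] at hp
    obtain ⟨hp, hpi, rfl⟩ := hp
    have c := fun i => hΓ.componentRowCount_mk hx h ⟨p, hp⟩ (i := i)
    refine ⟨((eqGraph Γ x).connectedComponentMk ⟨p, hp⟩, topRow Γ + m + 1), ⟨?_, ?_, ?_⟩, ?_⟩
    · simp only; omega
    · simp only
      rw [c _ (by simp only; omega), add_sub_cancel_right]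
      exact h2
    · simp only
      rw [c _ (by simp only; omega)]
      exact h3
    · simp only [componentValue_mk, Prod.mk.injEq, and_true]
      omega

/-- The weight of a face is the product of the contributions of the rows. -/
theorem IsOrdinary.weight_eq {Γ : Finset Node} (hΓ : IsOrdinary Γ) {x : Node → ℤ}
    (hx : TopAntitone Γ x) (h : ∀ q ∈ Γ, InterlacesAt Γ x q) {R : ℕ}
    (hR : ∀ p ∈ Γ, p.1 ≤ topRow Γ + R) {F : Set Space} (hF : faceGraph Γ F = eqGraph Γ x) :
    weight Γ F = ∏ m ∈ Finset.range R, rowWeight Γ x (topRow Γ + m + 1) := by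
  rw [weight_eq_of_faceGraph_eq hF]
  simp only [rowWeight, add_sub_cancel_right]
  rw [← Finset.prod_product', ← Finset.prod_filter,
    ← Finset.prod_fiberwise_of_maps_to (t := Finset.Icc 1 Γ.card)
      (g := fun q : ℕ × ℤ => rowMult Γ x (topRow Γ + q.1 + 1) q.2)]
  · refine Finset.prod_congr rfl fun l hl => ?_
    rw [hΓ.graphStatistic_eq hx h hR (Finset.mem_Icc.1 hl).1, ← Finset.prod_const,
      Finset.filter_filter]
    refine Finset.prod_congr ?_ ?_
    · ext q
      simp only [Finset.mem_filter]
      constructor <;> rintro ⟨h1, h2, h3⟩ <;> exact ⟨h1, by omega, by omega⟩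
    · intro q hq
      simp only [Finset.mem_filter] at hq
      rw [hq.2.2]
  · intro q hq
    rw [Finset.mem_filter] at hq
    rw [Finset.mem_Icc]
    exact ⟨by rw [hq.2]; omega, Finset.card_filter_le _ _⟩

/-! ### Faces, vertices and tangent cones of the polyhedra -/

theorem toReal_apply (u : Exponent) (p : Node) : toReal u p = (u p : ℝ) := by
  simp [toReal]

/-- The polyhedron given by the inequalities for the edges in `H`. -/
def edgePolyhedron (Γ : Finset Node) (b : Fin (topCount Γ) → ℤ) (H : Node → Node → Prop) :
    Set Space :=
  {s | (∀ p, p ∉ Γ → s p = 0) ∧ (∀ k, s (topNode Γ k) = (b k : ℝ)) ∧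
    ∀ p ∈ Γ, (H p (upL p) → s p ≤ s (upL p)) ∧ (H p (upR p) → s (upR p) ≤ s p)}

theorem polyhedron_eq (Γ : Finset Node) (b : Fin (topCount Γ) → ℤ) :
    polyhedron Γ b = edgePolyhedron Γ b (fullEdges Γ) := by
  ext s
  constructor
  · rintro ⟨h1, h2, h3⟩
    exact ⟨h1, h2, fun p hp => h3 p.1 p.2 hp⟩
  · rintro ⟨h1, h2, h3⟩
    exact ⟨h1, h2, fun i j hp => h3 (i, j) hp⟩

theorem mem_polyhedron_iff {Γ : Finset Node} {b : Fin (topCount Γ) → ℤ} {s : Space} :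
    s ∈ polyhedron Γ b ↔ (∀ p, p ∉ Γ → s p = 0) ∧ (∀ k, s (topNode Γ k) = (b k : ℝ)) ∧
      ∀ p ∈ Γ, InterlacesAt Γ s p := by
  rw [polyhedron_eq]
  rfl

/-- The edges of `Γ` with equal coordinates of `v` at the end points. -/
def equalEdges (Γ : Finset Node) (v : Node → ℤ) : Node → Node → Prop :=
  fun p q => q ∈ Γ ∧ v p = v q

theorem polyhedron_subset (Γ : Finset Node) (b : Fin (topCount Γ) → ℤ) (v : Node → ℤ) :
    polyhedron Γ b ⊆ edgePolyhedron Γ b (equalEdges Γ v) := by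
  rw [polyhedron_eq]
  rintro s ⟨h1, h2, h3⟩
  exact ⟨h1, h2, fun p hp => ⟨fun h => (h3 p hp).1 h.1, fun h => (h3 p hp).2 h.1⟩⟩

theorem isFace_of_le {P : Set Space} {l : Module.Dual ℝ Space} {c : ℝ} (hl : ∀ y ∈ P, l y ≤ c)
    {x : Space} (hx : x ∈ P) (hxc : l x = c) : IsFace P {y | y ∈ P ∧ l y = c} := by
  refine ⟨⟨x, hx, hxc⟩, l, ?_⟩
  ext y
  constructor
  · rintro ⟨h1, h2⟩
    exact ⟨h1, fun z hz => h2 ▸ hl z hz⟩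
  · rintro ⟨h1, h2⟩
    exact ⟨h1, le_antisymm (hl y h1) (hxc ▸ h2 x hx)⟩

theorem mem_minFace (P : Set Space) (x : Space) : x ∈ minFace P x := fun _ h => h.2

/-- The difference of the two coordinates has maximum `0` on `P`, attained at `x`; its zero locus is
therefore a face through `x` and contains the minimal one. -/
theorem eq_of_mem_minFace {P : Set Space} {x s : Space} {p q : Node} (hx : x ∈ P)
    (h : ∀ y ∈ P, y p ≤ y q) (he : x p = x q) (hs : s ∈ minFace P x) : s p = s q := by
  have hF := isFace_of_le (P := P) (l := Finsupp.lapply p - Finsupp.lapply q) (c := 0)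
    (fun y hy => by simpa using h y hy) hx (by simpa [sub_eq_zero] using he)
  have := hs _ ⟨hF, hx, by simpa [sub_eq_zero] using he⟩
  simpa [sub_eq_zero] using this.2

theorem eq_of_mem_minFace_edgePolyhedron {Γ : Finset Node} {b : Fin (topCount Γ) → ℤ}
    {H : Node → Node → Prop} {x s : Space} {p q : Node} (hp : p ∈ Γ)
    (hq : q = upL p ∨ q = upR p) (hH : H p q) (hx : x ∈ edgePolyhedron Γ b H) (he : x p = x q)
    (hs : s ∈ minFace (edgePolyhedron Γ b H) x) : s p = s q := by
  rcases hq with rfl | rfl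
  · exact eq_of_mem_minFace hx (fun y hy => (hy.2.2 p hp).1 hH) he hs
  · exact (eq_of_mem_minFace hx (fun y hy => (hy.2.2 p hp).2 hH) he.symm hs).symm

theorem faceGraph_minFace {Γ : Finset Node} {b : Fin (topCount Γ) → ℤ} {u : Exponent}
    (hu : toReal u ∈ polyhedron Γ b) :
    faceGraph Γ (minFace (polyhedron Γ b) (toReal u)) = eqGraph Γ u := by
  ext ⟨p, hp⟩ ⟨q, hq⟩
  refine and_congr_right fun hadj => ⟨fun h => ?_, fun h s hs => ?_⟩
  · have := h _ (mem_minFace _ _)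
    rw [toReal_apply, toReal_apply] at this
    exact_mod_cast this
  · have he : toReal u p = toReal u q := by
      rw [toReal_apply, toReal_apply]
      exact_mod_cast h
    rw [polyhedron_eq] at hu hs
    simp only
    rw [lattice_adj_iff] at hadj
    simp only at hadj
    rcases hadj with h | h | h | h
    · exact (eq_of_mem_minFace_edgePolyhedron hq (Or.inl h) hp hu he.symm hs).symm
    · exact (eq_of_mem_minFace_edgePolyhedron hq (Or.inr h) hp hu he.symm hs).symm
    · exact eq_of_mem_minFace_edgePolyhedron hp (Or.inl h) hq hu he hs
    · exact eq_of_mem_minFace_edgePolyhedron hp (Or.inr h) hq hu he hs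

open Filter Topology in
theorem eventually_add_mul_le {a a' c c' : ℝ} (h : a ≤ a') (h' : a = a' → c ≤ c') :
    ∀ᶠ ε : ℝ in 𝓝[>] 0, a + ε * c ≤ a' + ε * c' := by
  rcases h.lt_or_eq with h | h
  · have h1 : Tendsto (fun ε : ℝ => a + ε * c) (𝓝 0) (𝓝 (a + 0 * c)) :=
      Continuous.tendsto (by fun_prop) _
    have h2 : Tendsto (fun ε : ℝ => a' + ε * c') (𝓝 0) (𝓝 (a' + 0 * c')) :=
      Continuous.tendsto (by fun_prop) _
    filter_upwards [nhdsWithin_le_nhds (h1.eventually_lt h2 (by simpa using h))] with ε hε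
    exact hε.le
  · filter_upwards [self_mem_nhdsWithin] with ε hε
    have : ε * c ≤ ε * c' := mul_le_mul_of_nonneg_left (h' h) (le_of_lt hε)
    linarith

open Filter Topology in
/-- A direction that does not violate the inequalities that are tight at a point leads into the
polyhedron. -/
theorem exists_add_smul_mem {Γ : Finset Node} {b : Fin (topCount Γ) → ℤ} {x d : Space}
    (hx : x ∈ polyhedron Γ b) (h0 : ∀ p, p ∉ Γ → d p = 0) (ht : ∀ k, d (topNode Γ k) = 0)
    (hd : ∀ p ∈ Γ, (upL p ∈ Γ → x p = x (upL p) → d p ≤ d (upL p)) ∧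
      (upR p ∈ Γ → x p = x (upR p) → d (upR p) ≤ d p)) :
    ∃ ε : ℝ, 0 < ε ∧ x + ε • d ∈ polyhedron Γ b := by
  have hx' := hx
  rw [mem_polyhedron_iff] at hx'
  obtain ⟨x1, x2, x3⟩ := hx'
  have hev : ∀ᶠ ε : ℝ in 𝓝[>] 0, ∀ p ∈ Γ, InterlacesAt Γ (x + ε • d) p := by
    rw [Filter.eventually_all_finset]
    intro p hp
    have hL : ∀ᶠ ε : ℝ in 𝓝[>] 0, upL p ∈ Γ → x p + ε * d p ≤ x (upL p) + ε * d (upL p) := by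
      by_cases h : upL p ∈ Γ
      · filter_upwards [eventually_add_mul_le ((x3 p hp).1 h) ((hd p hp).1 h)] with ε hε _ using hε
      · exact Eventually.of_forall fun ε h' => absurd h' h
    have hR : ∀ᶠ ε : ℝ in 𝓝[>] 0, upR p ∈ Γ → x (upR p) + ε * d (upR p) ≤ x p + ε * d p := by
      by_cases h : upR p ∈ Γ
      · filter_upwards [eventually_add_mul_le ((x3 p hp).2 h)
          fun he => (hd p hp).2 h he.symm] with ε hε _ using hε
      · exact Eventually.of_forall fun ε h' => absurd h' h
    filter_upwards [hL, hR] with ε h1 h2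
    exact ⟨by simpa using h1, by simpa using h2⟩
  obtain ⟨ε, h1, h2⟩ := (hev.and self_mem_nhdsWithin).exists
  refine ⟨ε, h2, mem_polyhedron_iff.2 ⟨fun p hp => by simp [x1 p hp, h0 p hp],
    fun k => by simp [x2 k, ht k], h1⟩⟩

/-- An integer array in the polyhedron all of whose lower vertices have an equal neighbour in the
row above. -/
def IsRooted (Γ : Finset Node) (v : Node → ℤ) : Prop :=
  ∀ p ∈ lower Γ, equalEdges Γ v p (upL p) ∨ equalEdges Γ v p (upR p)

theorem equalEdges_iff_toReal {Γ : Finset Node} {v : Exponent} {p q : Node} :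
    equalEdges Γ v p q ↔ q ∈ Γ ∧ toReal v p = toReal v q := by
  simp [equalEdges, toReal_apply]

theorem tangentCone_eq {Γ : Finset Node} {b : Fin (topCount Γ) → ℤ} {v : Exponent}
    (hv : toReal v ∈ polyhedron Γ b) :
    tangentCone (polyhedron Γ b) (toReal v) = edgePolyhedron Γ b (equalEdges Γ v) := by
  obtain ⟨v1, v2, v3⟩ := mem_polyhedron_iff.1 hv
  ext y
  constructor
  · rintro ⟨x, hx, c, hc, rfl⟩
    obtain ⟨x1, x2, x3⟩ := mem_polyhedron_iff.1 hx
    refine ⟨fun p hp => by simp [v1 p hp, x1 p hp], fun k => by simp [v2 k, x2 k],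
      fun p hp => ⟨fun h => ?_, fun h => ?_⟩⟩
    · rw [equalEdges_iff_toReal] at h
      have := mul_le_mul_of_nonneg_left ((x3 p hp).1 h.1) hc
      simp only [Finsupp.add_apply, Finsupp.smul_apply, Finsupp.sub_apply, smul_eq_mul, h.2]
      linarith
    · rw [equalEdges_iff_toReal] at h
      have := mul_le_mul_of_nonneg_left ((x3 p hp).2 h.1) hc
      simp only [Finsupp.add_apply, Finsupp.smul_apply, Finsupp.sub_apply, smul_eq_mul, h.2]
      linarith
  · rintro ⟨y1, y2, y3⟩
    obtain ⟨ε, hε, hmem⟩ := exists_add_smul_mem (d := y - toReal v) hv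
      (fun p hp => by simp [y1 p hp, v1 p hp]) (fun k => by simp [v2 k, y2 k]) fun p hp =>
        ⟨fun h1 h2 => by
          have := (y3 p hp).1 (equalEdges_iff_toReal.2 ⟨h1, h2⟩)
          simp only [Finsupp.sub_apply, h2]
          linarith,
        fun h1 h2 => by
          have := (y3 p hp).2 (equalEdges_iff_toReal.2 ⟨h1, h2⟩)
          simp only [Finsupp.sub_apply, h2]
          linarith⟩
    refine ⟨_, hmem, ε⁻¹, by positivity, ?_⟩
    rw [add_sub_cancel_left, smul_smul, inv_mul_cancel₀ hε.ne', one_smul, add_sub_cancel]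

/-- A face of the cone through `u` contains the apex `v`, and the trace on the polyhedron of the
minimal one determines the differences of `u` up to scaling from `v`. So an edge survives exactly
when it is tight both at `v` and at `u`. -/
theorem faceGraph_minFace_tangentCone {Γ : Finset Node} {b : Fin (topCount Γ) → ℤ}
    {v u : Exponent} (hv : toReal v ∈ polyhedron Γ b)
    (hu : toReal u ∈ tangentCone (polyhedron Γ b) (toReal v)) (p q : {p : Node // p ∈ Γ}) :
    (faceGraph Γ (minFace (tangentCone (polyhedron Γ b) (toReal v)) (toReal u) ∩
      polyhedron Γ b)).Adj p q ↔ lattice.Adj p q ∧ v p = v q ∧ u p = u q := by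
  refine and_congr_right fun hadj => ⟨fun h => ?_, fun h s hs => ?_⟩
  · obtain ⟨x, hx, c, hc, hxc⟩ := hu
    have hface : ∀ w ∈ polyhedron Γ b, (∃ a : ℝ, w = toReal v + a • (x - toReal v)) →
        (c = 0 → w = toReal v) →
        w ∈ minFace (tangentCone (polyhedron Γ b) (toReal v)) (toReal u) := by
      rintro w hw ⟨a, rfl⟩ hc0 F ⟨⟨-, l, rfl⟩, -, hF⟩
      have hv' : toReal v ∈ tangentCone (polyhedron Γ b) (toReal v) :=
        ⟨_, hv, 0, le_rfl, by simp⟩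
      have h1 := hF _ hv'
      -- Comparing `u` with the apex and with the point twice as far from it shows that a functional
      -- maximal at `u` is constant along the ray.
      have h2 := hF _ ⟨x, hx, c + c, by positivity, rfl⟩
      simp only [hxc, map_add, map_smul, smul_eq_mul] at h1 h2 hF
      have h3 : c * l (x - toReal v) = 0 := by nlinarith
      refine ⟨⟨_, hw, 1, zero_le_one, by simp⟩, fun y hy => ?_⟩
      have h4 := hF y hy
      rw [h3, add_zero] at h4
      rcases mul_eq_zero.1 h3 with h5 | h5
      · rw [hc0 h5]; exact h4
      · rw [map_add, map_smul, h5, smul_zero, add_zero]; exact h4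
    have e1 := h (toReal v) ⟨hface _ hv ⟨0, by simp⟩ fun _ => rfl, hv⟩
    have hvv : v p = v q := by
      rw [toReal_apply, toReal_apply] at e1
      exact_mod_cast e1
    refine ⟨hvv, ?_⟩
    have e3 : toReal u p = toReal u q := by
      by_cases hc0 : c = 0
      · rw [hxc, hc0, zero_smul, add_zero]; exact e1
      · have e2 := h x ⟨hface _ hx ⟨1, by simp⟩ fun h => absurd h hc0, hx⟩
        rw [hxc]
        simp [e1, e2]
    rw [toReal_apply, toReal_apply] at e3
    exact_mod_cast e3
  · obtain ⟨⟨p, hp⟩, ⟨q, hq⟩⟩ := p, q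
    simp only at h hadj ⊢
    have he : toReal u p = toReal u q := by
      rw [toReal_apply, toReal_apply]
      exact_mod_cast h.2
    have hs := hs.1
    rw [tangentCone_eq hv] at hu hs
    rw [lattice_adj_iff] at hadj
    rcases hadj with h' | h' | h' | h'
    · exact (eq_of_mem_minFace_edgePolyhedron hq (Or.inl h') ⟨hp, h.1.symm⟩ hu he.symm hs).symm
    · exact (eq_of_mem_minFace_edgePolyhedron hq (Or.inr h') ⟨hp, h.1.symm⟩ hu he.symm hs).symm
    · exact eq_of_mem_minFace_edgePolyhedron hp (Or.inl h') ⟨hq, h.1⟩ hu he hs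
    · exact eq_of_mem_minFace_edgePolyhedron hp (Or.inr h') ⟨hq, h.1⟩ hu he hs

open Classical in
/-- The sum of the differences of coordinates along the edges at which `v` has equal
coordinates. -/
def edgeFunctional (Γ : Finset Node) (v : Node → ℤ) : Module.Dual ℝ Space :=
  ∑ p ∈ Γ, ((if equalEdges Γ v p (upL p) then Finsupp.lapply p - Finsupp.lapply (upL p) else 0) +
    (if equalEdges Γ v p (upR p) then Finsupp.lapply (upR p) - Finsupp.lapply p else 0))

theorem edgeFunctional_spec {Γ : Finset Node} {b : Fin (topCount Γ) → ℤ} {v : Node → ℤ}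
    {s : Space} (hs : s ∈ edgePolyhedron Γ b (equalEdges Γ v)) :
    edgeFunctional Γ v s ≤ 0 ∧ (edgeFunctional Γ v s = 0 ↔
      ∀ p ∈ Γ, (equalEdges Γ v p (upL p) → s p = s (upL p)) ∧
        (equalEdges Γ v p (upR p) → s p = s (upR p))) := by
  classical
  obtain ⟨-, -, h⟩ := hs
  have e : edgeFunctional Γ v s =
      ∑ p ∈ Γ, ((if equalEdges Γ v p (upL p) then s p - s (upL p) else 0) +
        (if equalEdges Γ v p (upR p) then s (upR p) - s p else 0)) := by
    rw [edgeFunctional, LinearMap.sum_apply]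
    refine Finset.sum_congr rfl fun p _ => ?_
    rw [LinearMap.add_apply]
    congr 1 <;> split_ifs <;> simp
  have hL : ∀ p ∈ Γ, (if equalEdges Γ v p (upL p) then s p - s (upL p) else 0) ≤ 0 := by
    intro p hp
    split_ifs with h'
    · linarith [(h p hp).1 h']
    · exact le_rfl
  have hR : ∀ p ∈ Γ, (if equalEdges Γ v p (upR p) then s (upR p) - s p else 0) ≤ 0 := by
    intro p hp
    split_ifs with h'
    · linarith [(h p hp).2 h']
    · exact le_rfl
  rw [e]
  have hle := fun p hp => add_nonpos (hL p hp) (hR p hp)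
  refine ⟨Finset.sum_nonpos hle, ?_⟩
  rw [Finset.sum_eq_zero_iff_of_nonpos hle]
  refine forall₂_congr fun p hp => ?_
  have a1 := hL p hp
  have a2 := hR p hp
  constructor
  · intro h0
    constructor
    · intro h'
      rw [if_pos h'] at a1 h0
      linarith
    · intro h'
      rw [if_pos h'] at a2 h0
      linarith
  · rintro ⟨h1, h2⟩
    split_ifs with c1 c2 c2
    · linarith [h1 c1, h2 c2]
    · linarith [h1 c1]
    · linarith [h2 c2]
    · simp

/-- The functional exposes the array that is constant along the same edges as `v`. -/
theorem eq_of_edgeFunctional_eq_zero {Γ : Finset Node} {b : Fin (topCount Γ) → ℤ}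
    {v : Node → ℤ} (hr : IsRooted Γ v) {s w : Space} (hs : s ∈ polyhedron Γ b)
    (hw : w ∈ polyhedron Γ b) (hs0 : edgeFunctional Γ v s = 0) (hw0 : edgeFunctional Γ v w = 0) :
    s = w := by
  rw [(edgeFunctional_spec (polyhedron_subset Γ b v hs)).2] at hs0
  rw [(edgeFunctional_spec (polyhedron_subset Γ b v hw)).2] at hw0
  obtain ⟨s1, s2, -⟩ := mem_polyhedron_iff.1 hs
  obtain ⟨w1, w2, -⟩ := mem_polyhedron_iff.1 hw
  ext p
  by_cases hp : p ∈ Γ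
  · revert p
    refine node_induction ?_ ?_
    · intro p hp hpt
      obtain ⟨k, rfl⟩ := exists_topNode hp hpt
      rw [s2, w2]
    · intro p hp ih
      have hpΓ := (mem_lower.1 hp).1
      rcases hr p hp with h | h
      · rw [(hs0 p hpΓ).1 h, (hw0 p hpΓ).1 h, ih _ h.1 (by simp [upL])]
      · rw [(hs0 p hpΓ).2 h, (hw0 p hpΓ).2 h, ih _ h.1 (by simp [upR])]
  · rw [s1 p hp, w1 p hp]

theorem isFace_singleton {Γ : Finset Node} {b : Fin (topCount Γ) → ℤ} {v : Node → ℤ}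
    (hr : IsRooted Γ v) {w : Space} (hw : w ∈ polyhedron Γ b) (hw0 : edgeFunctional Γ v w = 0) :
    IsFace (polyhedron Γ b) {w} := by
  have := isFace_of_le (P := polyhedron Γ b) (l := edgeFunctional Γ v) (c := 0)
    (fun y hy => (edgeFunctional_spec (polyhedron_subset Γ b v hy)).1) hw hw0
  convert this using 1
  ext s
  constructor
  · rintro rfl
    exact ⟨hw, hw0⟩
  · rintro ⟨h1, h2⟩
    exact eq_of_edgeFunctional_eq_zero hr h1 hw h2 hw0

theorem edgeFunctional_self {Γ : Finset Node} {b : Fin (topCount Γ) → ℤ} {v : Exponent}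
    (hv : toReal v ∈ polyhedron Γ b) : edgeFunctional Γ v (toReal v) = 0 := by
  rw [(edgeFunctional_spec (polyhedron_subset Γ b v hv)).2]
  exact fun p _ => ⟨fun h => (equalEdges_iff_toReal.1 h).2, fun h => (equalEdges_iff_toReal.1 h).2⟩

/-- Every lower vertex has an equal neighbour in the row above at a vertex of the polyhedron. -/
theorem IsOrdinary.exists_up_eq_of_isVertex {Γ : Finset Node} (hΓ : IsOrdinary Γ)
    {b : Fin (topCount Γ) → ℤ} (hb : Antitone b) {x : Space} (hx : IsVertex (polyhedron Γ b) x) :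
    ∀ p ∈ lower Γ, (upL p ∈ Γ ∧ x p = x (upL p)) ∨ (upR p ∈ Γ ∧ x p = x (upR p)) := by
  classical
  intro p hp
  by_contra! hn
  obtain ⟨hnL, hnR⟩ := hn
  obtain ⟨hpΓ, hpt⟩ := mem_lower.1 hp
  obtain ⟨-, l, hl⟩ := hx
  have hxl : x ∈ {x | x ∈ polyhedron Γ b ∧ ∀ y ∈ polyhedron Γ b, l y ≤ l x} := hl ▸ rfl
  obtain ⟨hxP, hxmax⟩ := hxl
  obtain ⟨x1, x2, x3⟩ := mem_polyhedron_iff.1 hxP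
  have htop : TopAntitone Γ x := by
    intro k m hkm
    simp only [x2]
    exact_mod_cast hb hkm
  -- Equality with another vertex of the row would force equality with the intermediate upper
  -- neighbour of `p`, which is excluded.
  have huniq : ∀ q ∈ Γ, q.1 = p.1 → x q = x p → q = p := by
    rintro ⟨i, k⟩ hq hqi hqx
    obtain ⟨i', j⟩ := p
    simp only at hqi
    subst hqi
    rcases lt_trichotomy k j with h | h | h
    · have h1 := hΓ.row_ordConnected hq hpΓ (show k ≤ j - 1 by omega) (by omega)
      have h2 := hΓ.row_antitone htop x3 hq h1 (by omega)
      have hm := hΓ.above i (j - 1) hpt h1 (by simpa using hpΓ)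
      have h3 := (x3 _ h1).2 hm
      rw [sub_add_cancel] at hm
      have h4 := (x3 _ hpΓ).1 hm
      simp only [upL, upR, sub_add_cancel] at h3 h4
      exact absurd (le_antisymm h4 (h3.trans (h2.trans hqx.le))) (hnL hm)
    · rw [h]
    · have h1 := hΓ.row_ordConnected hpΓ hq (show j ≤ j + 1 by omega) (by omega)
      have h2 := hΓ.row_antitone htop x3 h1 hq (by omega)
      have hm := hΓ.above i j hpt hpΓ h1
      have h3 := (x3 _ hpΓ).2 hm
      have h4 := (x3 _ h1).1 hm
      simp only [upL, upR] at h3 h4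
      exact absurd (le_antisymm (hqx.symm.le.trans (h2.trans h4)) h3) (hnR hm)
  -- All vertices with the value of `p`, from its row downwards, move together. By `huniq` this
  -- block has no tight edge going out of it, so it can be moved both up and down inside the
  -- polyhedron.
  let d : Space := Finsupp.onFinset Γ
    (fun q => if q ∈ Γ ∧ p.1 ≤ q.1 ∧ x q = x p then 1 else 0) (by
      intro q hq
      by_contra h
      simp [h] at hq)
  have hd : ∀ q, d q = if q ∈ Γ ∧ p.1 ≤ q.1 ∧ x q = x p then 1 else 0 := fun q => rfl
  have hedge : ∀ q ∈ Γ, ∀ r ∈ Γ, (r = upL q ∨ r = upR q) → x q = x r → d q = d r := by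
    intro q hq r hr hqr he
    rw [hd, hd]
    have hrow : r.1 = q.1 - 1 := by rcases hqr with rfl | rfl <;> rfl
    congr 1
    simp only [hq, hr, true_and, he, eq_iff_iff]
    refine and_congr_left fun hxr => ⟨fun h => ?_, fun h => by omega⟩
    by_contra hlt
    have := huniq q hq (by omega) (he.trans hxr)
    subst this
    rcases hqr with rfl | rfl
    · exact hnL hr he
    · exact hnR hr he
  have h0 : ∀ q, q ∉ Γ → d q = 0 := fun q hq => by rw [hd, if_neg fun h => hq h.1]
  have ht : ∀ k, d (topNode Γ k) = 0 := fun k => by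
    rw [hd, if_neg]
    rintro ⟨-, h, -⟩
    rw [topNode_fst] at h
    omega
  obtain ⟨ε, hε, h1⟩ := exists_add_smul_mem hxP h0 ht fun q hq =>
    ⟨fun hr he => (hedge q hq _ hr (Or.inl rfl) he).le,
      fun hr he => (hedge q hq _ hr (Or.inr rfl) he).ge⟩
  obtain ⟨δ, hδ, h2⟩ := exists_add_smul_mem (d := -d) hxP (fun q hq => by simp [h0 q hq])
    (fun k => by simp [ht k]) fun q hq =>
    ⟨fun hr he => by simp [hedge q hq _ hr (Or.inl rfl) he],
      fun hr he => by simp [hedge q hq _ hr (Or.inr rfl) he]⟩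
  have a1 := hxmax _ h1
  have a2 := hxmax _ h2
  simp only [map_add, map_smul, map_neg, smul_eq_mul] at a1 a2
  have hld : l d = 0 := by nlinarith
  have : x + ε • d ∈ ({x} : Set Space) := by
    rw [hl]
    refine ⟨h1, fun y hy => ?_⟩
    rw [map_add, map_smul, hld, smul_zero, add_zero]
    exact hxmax y hy
  have hxd : x + ε • d = x := this
  have hp1 := DFunLike.congr_fun hxd p
  simp only [Finsupp.add_apply, Finsupp.smul_apply, hd, hpΓ, le_refl, and_self, if_true,
    smul_eq_mul] at hp1
  linarith

/-- The vertices of the polyhedron are integer arrays. -/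
theorem IsOrdinary.exists_exponent_of_isVertex {Γ : Finset Node} (hΓ : IsOrdinary Γ)
    {b : Fin (topCount Γ) → ℤ} (hb : Antitone b) {x : Space} (hx : IsVertex (polyhedron Γ b) x) :
    ∃ v : Exponent, toReal v = x ∧ IsRooted Γ v := by
  classical
  have hup := hΓ.exists_up_eq_of_isVertex hb hx
  have hxP : x ∈ polyhedron Γ b := by
    obtain ⟨-, l, hl⟩ := hx
    have hxl : x ∈ {x | x ∈ polyhedron Γ b ∧ ∀ y ∈ polyhedron Γ b, l y ≤ l x} := hl ▸ rfl
    exact hxl.1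
  obtain ⟨x1, x2, x3⟩ := mem_polyhedron_iff.1 hxP
  have key : ∀ p ∈ Γ, ∃ z : ℤ, x p = (z : ℝ) := by
    refine node_induction ?_ ?_
    · intro p hp hpt
      obtain ⟨k, rfl⟩ := exists_topNode hp hpt
      exact ⟨b k, x2 k⟩
    · intro p hp ih
      rcases hup p hp with h | h
      · obtain ⟨k, hk⟩ := ih _ h.1 (by simp [upL])
        exact ⟨k, h.2.trans hk⟩
      · obtain ⟨k, hk⟩ := ih _ h.1 (by simp [upR])
        exact ⟨k, h.2.trans hk⟩
  choose! κ hκ using key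
  let v : Exponent := Finsupp.onFinset Γ (fun p => if p ∈ Γ then κ p else 0) (by
    intro q hq
    by_contra h
    simp [h] at hq)
  have hv : ∀ p, v p = if p ∈ Γ then κ p else 0 := fun p => rfl
  have hvx : toReal v = x := by
    ext p
    rw [toReal_apply, hv]
    split_ifs with h
    · rw [hκ p h]
    · rw [x1 p h]; simp
  refine ⟨v, hvx, fun p hp => ?_⟩
  rw [equalEdges_iff_toReal, equalEdges_iff_toReal, hvx]
  exact hup p hp

open Classical in
/-- The vertices of the polyhedron as integer arrays. -/
def vertexSet (Γ : Finset Node) (b : Fin (topCount Γ) → ℤ) : Finset Exponent :=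
  (Γ.finsupp fun _ => Finset.univ.image b).filter fun v =>
    toReal v ∈ polyhedron Γ b ∧ IsRooted Γ v

theorem IsRooted.mem_range {Γ : Finset Node} {b : Fin (topCount Γ) → ℤ}
    {v : Exponent} (hr : IsRooted Γ v) (hv : toReal v ∈ polyhedron Γ b) :
    ∀ p ∈ Γ, v p ∈ Set.range b := by
  obtain ⟨x1, x2, x3⟩ := mem_polyhedron_iff.1 hv
  refine node_induction ?_ ?_
  · intro p hp hpt
    obtain ⟨k, rfl⟩ := exists_topNode hp hpt
    have := x2 k
    rw [toReal_apply] at this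
    exact ⟨k, by exact_mod_cast this.symm⟩
  · intro p hp ih
    rcases hr p hp with h | h
    · rw [h.2]; exact ih _ h.1 (by simp [upL])
    · rw [h.2]; exact ih _ h.1 (by simp [upR])

theorem mem_vertexSet {Γ : Finset Node} {b : Fin (topCount Γ) → ℤ} {v : Exponent} :
    v ∈ vertexSet Γ b ↔ toReal v ∈ polyhedron Γ b ∧ IsRooted Γ v := by
  classical
  rw [vertexSet, Finset.mem_filter, Finset.mem_finsupp_iff]
  refine ⟨fun h => h.2, fun h => ⟨⟨?_, fun p hp => ?_⟩, h⟩⟩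
  · intro p hp
    by_contra hpΓ
    have := (mem_polyhedron_iff.1 h.1).1 p hpΓ
    rw [toReal_apply] at this
    rw [Finsupp.mem_support_iff] at hp
    exact hp (by exact_mod_cast this)
  · have := IsRooted.mem_range h.2 h.1 p hp
    simpa using this

theorem IsOrdinary.isVertex_iff {Γ : Finset Node} (hΓ : IsOrdinary Γ)
    {b : Fin (topCount Γ) → ℤ} (hb : Antitone b) (x : Space) :
    IsVertex (polyhedron Γ b) x ↔ ∃ v ∈ vertexSet Γ b, toReal v = x := by
  constructor
  · intro hx
    obtain ⟨v, rfl, hr⟩ := hΓ.exists_exponent_of_isVertex hb hx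
    refine ⟨v, mem_vertexSet.2 ⟨?_, hr⟩, rfl⟩
    obtain ⟨-, l, hl⟩ := hx
    have hxl : toReal v ∈ {x | x ∈ polyhedron Γ b ∧ ∀ y ∈ polyhedron Γ b, l y ≤ l x} := hl ▸ rfl
    exact hxl.1
  · rintro ⟨v, hv, rfl⟩
    obtain ⟨h1, h2⟩ := mem_vertexSet.1 hv
    exact isFace_singleton h2 h1 (edgeFunctional_self h1)

/-- Since `w` is constant along the edges tight at `v`, every displacement `y - w` inside the second
polyhedron is, after scaling, an admissible displacement at `v`; this gives the inclusion of normal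
cones. For minimality, the functional attached to the tight edges of `v` lies in the normal cone of
`v` and is maximal on the second polyhedron only at `w`. -/
theorem isDegenerationImage {Γ : Finset Node} {b b' : Fin (topCount Γ) → ℤ} {v w : Exponent}
    (hv : toReal v ∈ polyhedron Γ b) (hr : IsRooted Γ v) (hw : toReal w ∈ polyhedron Γ b')
    (hvw : ∀ p ∈ Γ, ∀ q, equalEdges Γ v p q → w p = w q) :
    IsDegenerationImage (polyhedron Γ b) (polyhedron Γ b') {toReal v} {toReal w} := by
  have hw0 : edgeFunctional Γ v (toReal w) = 0 := by
    rw [(edgeFunctional_spec (polyhedron_subset Γ b' v hw)).2]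
    refine fun p hp => ⟨fun h => ?_, fun h => ?_⟩ <;>
      rw [toReal_apply, toReal_apply, hvw p hp _ h]
  obtain ⟨w1, w2, w3⟩ := mem_polyhedron_iff.1 hw
  refine ⟨isFace_singleton hr hw hw0, ?_, ?_⟩
  · rintro l hl x rfl y hy
    obtain ⟨y1, y2, y3⟩ := mem_polyhedron_iff.1 hy
    obtain ⟨ε, hε, hmem⟩ := exists_add_smul_mem (d := y - toReal w) hv
      (fun p hp => by simp [y1 p hp, w1 p hp]) (fun k => by simp [y2 k, w2 k]) fun p hp =>
        ⟨fun h1 h2 => by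
          have e := hvw p hp _ (equalEdges_iff_toReal.2 ⟨h1, h2⟩)
          have := (y3 p hp).1 h1
          simp only [Finsupp.sub_apply, toReal_apply, e]
          linarith,
        fun h1 h2 => by
          have e := hvw p hp _ (equalEdges_iff_toReal.2 ⟨h1, h2⟩)
          have := (y3 p hp).2 h1
          simp only [Finsupp.sub_apply, toReal_apply, e]
          linarith⟩
    have := hl _ rfl _ hmem
    simp only [map_add, map_smul, smul_eq_mul, map_sub] at this
    nlinarith
  · intro G hG hsub l hl x hx y hy
    have hG' : ∀ z ∈ G, z ∈ polyhedron Γ b' := by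
      obtain ⟨-, m, rfl⟩ := hG
      exact fun z hz => hz.1
    have hmem : edgeFunctional Γ v ∈ normalCone (polyhedron Γ b) {toReal v} := by
      rintro z rfl y hy
      rw [edgeFunctional_self hv]
      exact (edgeFunctional_spec (polyhedron_subset Γ b v hy)).1
    have h1 := hsub hmem x hx _ hw
    rw [hw0] at h1
    have h2 := (edgeFunctional_spec (polyhedron_subset Γ b' v (hG' x hx))).1
    obtain rfl := eq_of_edgeFunctional_eq_zero hr (hG' x hx) hw (le_antisymm h2 h1) hw0
    exact hl _ rfl y hy

/-! ### The weighted series as continuants -/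

/-- Integer arrays that vanish outside `Γ` and have the prescribed top row. -/
def HasBase (Γ : Finset Node) (b : Fin (topCount Γ) → ℤ) (u : Node → ℤ) : Prop :=
  (∀ p, p ∉ Γ → u p = 0) ∧ ∀ k, u (topNode Γ k) = b k

theorem toReal_mem_polyhedron_iff {Γ : Finset Node} {b : Fin (topCount Γ) → ℤ} {u : Exponent} :
    toReal u ∈ polyhedron Γ b ↔ HasBase Γ b u ∧ ∀ p ∈ Γ, InterlacesAt Γ u p := by
  simp only [mem_polyhedron_iff, HasBase, InterlacesAt, toReal_apply, Int.cast_inj, Int.cast_le,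
    Int.cast_eq_zero, and_assoc]

theorem toReal_mem_edgePolyhedron_iff {Γ : Finset Node} {b : Fin (topCount Γ) → ℤ}
    {H : Node → Node → Prop} {u : Exponent} :
    toReal u ∈ edgePolyhedron Γ b H ↔ HasBase Γ b u ∧
      ∀ p ∈ Γ, (H p (upL p) → u p ≤ u (upL p)) ∧ (H p (upR p) → u (upR p) ≤ u p) := by
  simp only [edgePolyhedron, Set.mem_ofPred_eq, HasBase, toReal_apply, Int.cast_inj, Int.cast_le,
    Int.cast_eq_zero, and_assoc]

theorem exists_abs_le {α : Type*} (s : Finset α) (f : α → ℤ) : ∃ M : ℕ, ∀ p ∈ s, |f p| ≤ M := by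
  refine ⟨∑ p ∈ s, (f p).natAbs, fun p hp => ?_⟩
  have := Finset.single_le_sum (f := fun p => (f p).natAbs) (fun _ _ => Nat.zero_le _) hp
  rw [Int.abs_eq_natAbs]
  exact_mod_cast this

theorem card_filter_top {Γ : Finset Node} (x : Node → ℤ) (a : ℤ) :
    (Finset.univ.filter fun k => x (topNode Γ k) = a).card = rowMult Γ x (topRow Γ) a := by
  rw [rowMult, ← Finset.card_image_of_injective _ (topNode_injective Γ)]
  congr 1
  ext p
  simp only [Finset.mem_image, Finset.mem_filter, Finset.mem_univ, true_and]
  constructor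
  · rintro ⟨k, rfl, rfl⟩
    exact ⟨topNode_mem k, rfl, rfl⟩
  · rintro ⟨hp, hpt, rfl⟩
    obtain ⟨k, rfl⟩ := exists_topNode hp hpt
    exact ⟨k, rfl, rfl⟩

theorem multiplicityFactor_top {Γ : Finset Node} (x : Node → ℤ) :
    multiplicityFactor (fun k => x (topNode Γ k)) =
      ∏ a ∈ Γ.image x, tFactorial (rowMult Γ x (topRow Γ) a) := by
  rw [multiplicityFactor]
  simp only [card_filter_top]
  refine Finset.prod_subset ?_ fun a _ ha => ?_
  · intro a ha
    obtain ⟨k, -, rfl⟩ := Finset.mem_image.1 ha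
    exact Finset.mem_image_of_mem x (topNode_mem k)
  · rw [← card_filter_top, Finset.card_eq_zero.2, tFactorial]
    · simp
    · rw [Finset.filter_eq_empty_iff]
      exact fun k _ h => ha (Finset.mem_image.2 ⟨k, Finset.mem_univ _, h⟩)

theorem multiplicityFactor_of_injective {n : ℕ} {b : Fin n → ℤ} (hb : Function.Injective b) :
    multiplicityFactor b = 1 := by
  rw [multiplicityFactor]
  refine Finset.prod_eq_one fun c hc => ?_
  obtain ⟨k, -, rfl⟩ := Finset.mem_image.1 hc
  have : (Finset.univ.filter fun l => b l = b k) = {k} := by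
    ext l
    simp [hb.eq_iff]
  rw [this, Finset.card_singleton]
  simp [tFactorial]

/-- For a suitable list of the lower vertices, the continuant is the weight multiplied by the
multiplicity factor of the top row. -/
theorem IsOrdinary.exists_list {Γ : Finset Node} (hΓ : IsOrdinary Γ) :
    ∃ L : List Node, L.Nodup ∧ (∀ p, p ∈ L ↔ p ∈ lower Γ) ∧ ∀ x : Node → ℤ, TopAntitone Γ x →
      (∀ q ∈ Γ, InterlacesAt Γ x q) → ∀ F : Set Space, faceGraph Γ F = eqGraph Γ x →
      multiplicityFactor (fun k => x (topNode Γ k)) * weight Γ F =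
        continuant (fullEdges Γ) x L := by
  obtain ⟨M, hM⟩ := exists_abs_le Γ Prod.fst
  obtain ⟨N, hN⟩ := exists_abs_le Γ Prod.snd
  simp only [abs_le] at hM hN
  obtain ⟨p₀, hp₀, hp₀t⟩ := exists_mem_topRow hΓ.nonempty
  have ht := hM p₀ hp₀
  have hn : ∀ p ∈ Γ, (-N - 1 : ℤ) < p.2 ∧ p.2 < (-N - 1 : ℤ) + ((2 * N + 2 : ℕ) : ℤ) :=
    fun p hp => by have := hN p hp; push_cast; omega
  have hR : ∀ p ∈ Γ, p.1 < topRow Γ + ((2 * M + 1 : ℕ) : ℤ) :=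
    fun p hp => by have := hM p hp; push_cast; omega
  -- The range of positions starts with an empty column, as the scan requires, and the last row is
  -- beyond the bottom of `Γ`, so that its t-factorials are trivial.
  refine ⟨gridList Γ (-N - 1) (2 * N + 2) (2 * M + 1), gridList_nodup .., fun p => ?_,
    fun x hx h F hF => ?_⟩
  · rw [mem_gridList, mem_lower]
    refine ⟨fun h => ⟨h.1, h.2.1⟩, fun h => ⟨h.1, h.2, (hR p h.1).le, (hn p h.1).1.le,
      (hn p h.1).2⟩⟩
  · rw [hΓ.weight_eq hx h (fun p hp => (hR p hp).le) hF, multiplicityFactor_top,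
      hΓ.rowWeight_eq hx h hn]
    rw [Finset.prod_eq_one, one_mul]
    intro a _
    have : rowMult Γ x (topRow Γ + ((2 * M + 1 : ℕ) : ℤ)) a = 0 := by
      rw [rowMult, Finset.card_eq_zero, Finset.filter_eq_empty_iff]
      rintro p hp ⟨h1, -⟩
      have := hR p hp
      omega
    rw [this]
    simp [tFactorial]

/-- The list of lower vertices of an ordinary subgraph that is used for continuants. -/
def IsOrdinary.list {Γ : Finset Node} (hΓ : IsOrdinary Γ) : List Node := hΓ.exists_list.choose

theorem IsOrdinary.nodup_list {Γ : Finset Node} (hΓ : IsOrdinary Γ) : hΓ.list.Nodup :=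
  hΓ.exists_list.choose_spec.1

theorem IsOrdinary.mem_list {Γ : Finset Node} (hΓ : IsOrdinary Γ) {p : Node} :
    p ∈ hΓ.list ↔ p ∈ lower Γ :=
  hΓ.exists_list.choose_spec.2.1 p

theorem IsOrdinary.weight_eq_continuant {Γ : Finset Node} (hΓ : IsOrdinary Γ) {x : Node → ℤ}
    (hx : TopAntitone Γ x) (h : ∀ q ∈ Γ, InterlacesAt Γ x q) {F : Set Space}
    (hF : faceGraph Γ F = eqGraph Γ x) :
    multiplicityFactor (fun k => x (topNode Γ k)) * weight Γ F =
      continuant (fullEdges Γ) x hΓ.list :=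
  hΓ.exists_list.choose_spec.2.2 x hx h F hF

theorem HasBase.topAntitone {Γ : Finset Node} {b : Fin (topCount Γ) → ℤ} {u : Node → ℤ}
    (hu : HasBase Γ b u) (hb : Antitone b) : TopAntitone Γ u := by
  have : (fun k => u (topNode Γ k)) = b := funext hu.2
  rw [TopAntitone, this]
  exact hb

open Classical in
/-- The series of continuants of the arrays with a given top row. -/
def continuantSeries {Γ : Finset Node} (hΓ : IsOrdinary Γ) (b : Fin (topCount Γ) → ℤ)
    (H : Node → Node → Prop) (u : Exponent) : ℤ[X] :=
  if HasBase Γ b u then continuant H u hΓ.list else 0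

/-- No case distinction on membership survives on the right: the continuant by itself vanishes at
arrays violating an inequality. This is what permits a termwise expansion. -/
theorem IsOrdinary.weightedSeries_polyhedron {Γ : Finset Node} (hΓ : IsOrdinary Γ)
    {b : Fin (topCount Γ) → ℤ} (hb : Antitone b) (u : Exponent) :
    multiplicityFactor b * weightedSeries (weight Γ) (polyhedron Γ b) u =
      continuantSeries hΓ b (fullEdges Γ) u := by
  rw [weightedSeries, continuantSeries]
  by_cases hu : HasBase Γ b u
  · rw [if_pos hu]
    split_ifs with hP
    · rw [← hΓ.weight_eq_continuant (hu.topAntitone hb) (toReal_mem_polyhedron_iff.1 hP).2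
        (faceGraph_minFace hP)]
      congr 2
      exact (funext hu.2).symm
    · rw [mul_zero]
      by_contra hne
      exact hP (toReal_mem_polyhedron_iff.2 ⟨hu, hΓ.interlacesAt_of_continuant_ne_zero
        (hu.topAntitone hb) (fun p hp => hΓ.mem_list.2 hp) (Ne.symm hne)⟩)
  · rw [if_neg hu, if_neg fun hP => hu (toReal_mem_polyhedron_iff.1 hP).1, mul_zero]

/-- Far along the array `v`, the local weights for all edges and for the edges on which `v` is
constant agree. -/
theorem localWeight_eq_of_far {Γ : Finset Node} {v u : Node → ℤ} {N : ℤ}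
    (hN : ∀ p ∈ Γ, ∀ q ∈ Γ, |u p - u q| < N) {p : Node} (hp : p ∈ Γ)
    (hv : InterlacesAt Γ v p) :
    (upL p ∈ Γ → v p ≠ v (upL p) → (u p + N * v p) - (u (upL p) + N * v (upL p)) < 0) ∧
    (upR p ∈ Γ → v p ≠ v (upR p) → 0 < (u p + N * v p) - (u (upR p) + N * v (upR p))) := by
  constructor
  · intro h hne
    have h1 := abs_lt.1 (hN p hp _ h)
    have h2 := hv.1 h
    have h3 : v p - v (upL p) ≤ -1 := by omega
    have h4 : 0 < N := by omega
    nlinarith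
  · intro h hne
    have h1 := abs_lt.1 (hN p hp _ h)
    have h2 := hv.2 h
    have h3 : 1 ≤ v p - v (upR p) := by omega
    have h4 : 0 < N := by omega
    nlinarith

/-- Adding `N v` does not change differences along tight edges. Along a non-tight edge it makes the
half-line function equal to `1 - X`, which cancels the free term, and it kills the equality kernels.
Rootedness leaves at least one tight edge at every lower vertex. -/
theorem continuant_far {Γ : Finset Node} {v u : Node → ℤ} {N : ℤ} (hr : IsRooted Γ v)
    (hv : ∀ p ∈ Γ, InterlacesAt Γ v p) (hN : ∀ p ∈ Γ, ∀ q ∈ Γ, |u p - u q| < N)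
    {l : List Node} (hl : ∀ p ∈ l, p ∈ lower Γ) :
    continuant (fullEdges Γ) (fun p => u p + N * v p) l = continuant (equalEdges Γ v) u l := by
  have hL : ∀ p ∈ Γ, localWeight (fullEdges Γ) p .leftEq (fun p => u p + N * v p) =
      localWeight (equalEdges Γ v) p .leftEq u := by
    intro p hp
    have hfar := (localWeight_eq_of_far hN hp (hv p hp)).1
    by_cases h : upL p ∈ Γ
    · by_cases he : v p = v (upL p)
      · rw [localWeight_of_allowed (H := equalEdges Γ v) (p := p) (o := .leftEq)
            (show equalEdges Γ v p _ from ⟨h, he⟩),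
          localWeight_of_allowed (H := fullEdges Γ) (p := p) (o := .leftEq)
            (show fullEdges Γ p _ from h)]
        simp [Choice.parent, he]
      · rw [localWeight_of_not_allowed (H := equalEdges Γ v) (p := p) (o := .leftEq)
            (show ¬ equalEdges Γ v p _ from
          fun h' => he h'.2), localWeight_of_allowed (H := fullEdges Γ) (p := p) (o := .leftEq)
            (show fullEdges Γ p _ from h)]
        exact if_neg (hfar h he).ne
    · rw [localWeight_of_not_allowed (H := equalEdges Γ v) (p := p) (o := .leftEq)
            (show ¬ equalEdges Γ v p _ from
          fun h' => h h'.1), localWeight_of_not_allowed (H := fullEdges Γ) (p := p) (o := .leftEq)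
            (show ¬ fullEdges Γ p _ from h)]
  have hR : ∀ p ∈ Γ, localWeight (fullEdges Γ) p .rightEq (fun p => u p + N * v p) =
      localWeight (equalEdges Γ v) p .rightEq u := by
    intro p hp
    have hfar := (localWeight_eq_of_far hN hp (hv p hp)).2
    by_cases h : upR p ∈ Γ
    · by_cases he : v p = v (upR p)
      · rw [localWeight_of_allowed (H := equalEdges Γ v) (p := p) (o := .rightEq)
            (show equalEdges Γ v p _ from ⟨h, he⟩),
          localWeight_of_allowed (H := fullEdges Γ) (p := p) (o := .rightEq)
            (show fullEdges Γ p _ from h)]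
        simp [Choice.parent, he]
      · rw [localWeight_of_not_allowed (H := equalEdges Γ v) (p := p) (o := .rightEq)
            (show ¬ equalEdges Γ v p _ from
          fun h' => he h'.2), localWeight_of_allowed (H := fullEdges Γ) (p := p) (o := .rightEq)
            (show fullEdges Γ p _ from h)]
        exact if_neg (hfar h he).ne'
    · rw [localWeight_of_not_allowed (H := equalEdges Γ v) (p := p) (o := .rightEq)
            (show ¬ equalEdges Γ v p _ from
          fun h' => h h'.1), localWeight_of_not_allowed (H := fullEdges Γ) (p := p) (o := .rightEq)
            (show ¬ fullEdges Γ p _ from h)]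
  refine continuant_congr l (fun p hp => ?_) fun p hp q hq => ?_
  · have hpΓ := (mem_lower.1 (hl p hp)).1
    obtain ⟨hfL, hfR⟩ := localWeight_eq_of_far hN hpΓ (hv p hpΓ)
    have hr := hr p (hl p hp)
    by_cases h1 : equalEdges Γ v p (upL p) <;> by_cases h2 : equalEdges Γ v p (upR p)
    · rw [singleWeight_of_both h1 h2,
        singleWeight_of_both (show fullEdges Γ p _ from h1.1) (show fullEdges Γ p _ from h2.1)]
      simp [← h1.2, ← h2.2]
    · rw [singleWeight_of_left h1 h2]
      by_cases h3 : upR p ∈ Γ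
      · rw [singleWeight_of_both (show fullEdges Γ p _ from h1.1) (show fullEdges Γ p _ from h3)]
        have h4 := hfR h3 fun he => h2 ⟨h3, he⟩
        have h5 : Choice.right.kernel (u p + N * v p - (u (upR p) + N * v (upR p))) = 1 - X := by
          simp only [Choice.kernel]
          rw [if_neg (by omega), if_pos h4]
        rw [h5, ← h1.2, add_sub_add_right_eq_sub]
        ring
      · rw [singleWeight_of_left (show fullEdges Γ p _ from h1.1) (show ¬ fullEdges Γ p _ from h3),
          ← h1.2, add_sub_add_right_eq_sub]
    · rw [singleWeight_of_right h1 h2]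
      by_cases h3 : upL p ∈ Γ
      · rw [singleWeight_of_both (show fullEdges Γ p _ from h3) (show fullEdges Γ p _ from h2.1)]
        have h4 := hfL h3 fun he => h1 ⟨h3, he⟩
        have h5 : Choice.left.kernel (u p + N * v p - (u (upL p) + N * v (upL p))) = 1 - X := by
          simp only [Choice.kernel]
          rw [if_neg (by omega), if_pos h4]
        rw [h5, ← h2.2, add_sub_add_right_eq_sub]
        ring
      · rw [singleWeight_of_right (show ¬ fullEdges Γ p _ from h3)
          (show fullEdges Γ p _ from h2.1), ← h2.2, add_sub_add_right_eq_sub]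
    · exact absurd hr (by tauto)
  · rw [pairWeight, pairWeight, hL p (mem_lower.1 (hl p hp)).1, hR q (mem_lower.1 (hl q hq)).1]

/-- The array `u + N v` satisfies all inequalities exactly when `u` lies in the cone, and its
equalities along edges are those of the face of `u`. Its top row is strictly decreasing because `b`
is, hence no t-factorials appear. -/
theorem IsOrdinary.weightedSeries_tangentCone {Γ : Finset Node} (hΓ : IsOrdinary Γ)
    {b : Fin (topCount Γ) → ℤ} (hb : StrictAnti b) {v : Exponent}
    (hv : toReal v ∈ polyhedron Γ b) (hr : IsRooted Γ v) (u : Exponent) :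
    weightedSeries (coneWeight (weight Γ) (polyhedron Γ b))
      (tangentCone (polyhedron Γ b) (toReal v)) u = continuantSeries hΓ b (equalEdges Γ v) u := by
  obtain ⟨hvb, hvi⟩ := toReal_mem_polyhedron_iff.1 hv
  rw [weightedSeries, continuantSeries]
  have hcone : toReal u ∈ tangentCone (polyhedron Γ b) (toReal v) ↔ HasBase Γ b u ∧
      ∀ p ∈ Γ, (equalEdges Γ v p (upL p) → u p ≤ u (upL p)) ∧
        (equalEdges Γ v p (upR p) → u (upR p) ≤ u p) := by
    rw [tangentCone_eq hv, toReal_mem_edgePolyhedron_iff]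
  by_cases hu : HasBase Γ b u
  swap
  · rw [if_neg hu, if_neg fun hP => hu (hcone.1 hP).1]
  rw [if_pos hu]
  obtain ⟨M, hM⟩ := exists_abs_le Γ u
  -- Larger than any difference of two coordinates of `u` on `Γ`, while `v` jumps by at least `1`
  -- along an edge that is not tight.
  let N : ℤ := 2 * M + 1
  have hN0 : 0 < N := by omega
  have hN : ∀ p ∈ Γ, ∀ q ∈ Γ, |u p - u q| < N := by
    intro p hp q hq
    have h1 := abs_le.1 (hM p hp)
    have h2 := abs_le.1 (hM q hq)
    rw [abs_lt]
    constructor <;> simp only [N] <;> omega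
  let x : Node → ℤ := fun p => u p + N * v p
  have hxtop : (fun k => x (topNode Γ k)) = fun k => b k + N * b k := by
    funext k
    simp only [x, hu.2, hvb.2]
  have hxanti : StrictAnti fun k => x (topNode Γ k) := by
    rw [hxtop]
    intro k l hkl
    have := hb hkl
    have := mul_lt_mul_of_pos_left this hN0
    simp only
    omega
  have hcont := continuant_far hr hvi hN (l := hΓ.list) fun p hp => hΓ.mem_list.1 hp
  have hint : (∀ p ∈ Γ, InterlacesAt Γ x p) ↔
      ∀ p ∈ Γ, (equalEdges Γ v p (upL p) → u p ≤ u (upL p)) ∧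
        (equalEdges Γ v p (upR p) → u (upR p) ≤ u p) := by
    refine forall₂_congr fun p hp => and_congr ?_ ?_
    · constructor
      · intro h h'
        have := h h'.1
        simp only [x, h'.2] at this
        omega
      · intro h h'
        by_cases he : v p = v (upL p)
        · have := h ⟨h', he⟩
          simp only [x, he]
          omega
        · have := (localWeight_eq_of_far hN hp (hvi p hp)).1 h' he
          simp only [x]
          omega
    · constructor
      · intro h h'
        have := h h'.1
        simp only [x, h'.2] at this
        omega
      · intro h h'
        by_cases he : v p = v (upR p)
        · have := h ⟨h', he⟩
          simp only [x, he]
          omega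
        · have := (localWeight_eq_of_far hN hp (hvi p hp)).2 h' he
          simp only [x]
          omega
  split_ifs with hP
  · have hint' := hint.2 (hcone.1 hP).2
    have hF : faceGraph Γ (minFace (tangentCone (polyhedron Γ b) (toReal v)) (toReal u) ∩
        polyhedron Γ b) = eqGraph Γ x := by
      ext p q
      rw [faceGraph_minFace_tangentCone hv hP]
      refine and_congr_right fun hadj => ⟨fun h => ?_, fun h => ?_⟩
      · simp only [x, h.1, h.2]
      · have key : ∀ p ∈ Γ, ∀ q ∈ Γ, (q = upL p ∨ q = upR p) → x p = x q → v p = v q := by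
          rintro p hp q hq (rfl | rfl) he
          · by_contra hne
            have := (localWeight_eq_of_far hN hp (hvi p hp)).1 hq hne
            simp only [x] at he
            omega
          · by_contra hne
            have := (localWeight_eq_of_far hN hp (hvi p hp)).2 hq hne
            simp only [x] at he
            omega
        have hvv : v p = v q := by
          rw [lattice_adj_iff] at hadj
          rcases hadj with h' | h' | h' | h'
          · exact (key q q.2 p p.2 (Or.inl h') h.symm).symm
          · exact (key q q.2 p p.2 (Or.inr h') h.symm).symm
          · exact key p p.2 q q.2 (Or.inl h') h
          · exact key p p.2 q q.2 (Or.inr h') h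
        refine ⟨hvv, ?_⟩
        simp only [x, hvv] at h
        omega
    have := hΓ.weight_eq_continuant hxanti.antitone hint' hF
    rw [multiplicityFactor_of_injective hxanti.injective, one_mul] at this
    rw [coneWeight, this]
    exact hcont
  · by_contra hne
    apply hP
    rw [← hcont] at hne
    exact hcone.2 ⟨hu, hint.1 (hΓ.interlacesAt_of_continuant_ne_zero hxanti.antitone
      (fun p hp => hΓ.mem_list.2 hp) (Ne.symm hne))⟩

/-! ### Series of products over the edges of a forest -/

open Classical in
/-- The series whose coefficient at an array with a given top row is the product over the lower
vertices of functions of the differences between a vertex and its parent. -/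
def treeSeries (Γ : Finset Node) (b : Fin (topCount Γ) → ℤ) (par : Node → Node)
    (κ : Node → ℤ → ℤ[X]) (u : Exponent) : ℤ[X] :=
  if HasBase Γ b u then ∏ p ∈ lower Γ, κ p (u p - u (par p)) else 0

/-- Every lower vertex is its own parent or has a parent in a higher row. -/
def IsParentMap (Γ : Finset Node) (par : Node → Node) : Prop :=
  ∀ p ∈ lower Γ, par p = p ∨ (par p ∈ Γ ∧ (par p).1 < p.1)

theorem exists_iterate_iff {α : Type*} (f : α → α) {p q : α} (h : q ≠ p) :
    (∃ n : ℕ, f^[n] q = p) ↔ ∃ n : ℕ, f^[n] (f q) = p := by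
  constructor
  · rintro ⟨n, hn⟩
    cases n with
    | zero => exact absurd hn h
    | succ n => exact ⟨n, by rwa [Function.iterate_succ_apply] at hn⟩
  · rintro ⟨n, hn⟩
    exact ⟨n + 1, by rwa [Function.iterate_succ_apply]⟩

/-- The indicator of the set of descendants of a lower vertex. -/
theorem IsParentMap.exists_descendants {Γ : Finset Node} {par : Node → Node}
    (hpar : IsParentMap Γ par) {p : Node} (hp : p ∈ lower Γ) :
    ∃ d : Exponent, d p = 1 ∧ (∀ q, q ∉ lower Γ → d q = 0) ∧
      (∀ q ∈ lower Γ, q ≠ p → d q = d (par q)) ∧ (par p ≠ p → d (par p) = 0) := by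
  classical
  -- The parent map is made the identity outside the lower vertices, so that iterating it stops at
  -- the top row.
  let f : Node → Node := fun q => if q ∈ lower Γ then par q else q
  have hf : ∀ q ∈ lower Γ, f q = par q := fun q hq => if_pos hq
  have hf' : ∀ q, q ∉ lower Γ → ∀ n : ℕ, f^[n] q = q := fun q hq n => by
    have : f q = q := if_neg hq
    exact Function.iterate_fixed this n
  have hrow : ∀ (n : ℕ) (q : Node), (f^[n] q).1 ≤ q.1 := by
    intro n
    induction n with
    | zero => exact fun q => le_rfl
    | succ n ih =>
      intro q
      rw [Function.iterate_succ_apply]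
      refine (ih _).trans ?_
      by_cases hq : q ∈ lower Γ
      · rw [hf q hq]
        rcases hpar q hq with h | h
        · rw [h]
        · exact h.2.le
      · rw [show f q = q from if_neg hq]
  let d : Exponent := Finsupp.onFinset Γ
    (fun q => if q ∈ Γ ∧ ∃ n : ℕ, f^[n] q = p then 1 else 0) (by
      intro q hq
      by_contra h
      simp [h] at hq)
  have hd : ∀ q, d q = if q ∈ Γ ∧ ∃ n : ℕ, f^[n] q = p then 1 else 0 := fun q => rfl
  refine ⟨d, ?_, ?_, ?_, ?_⟩
  · rw [hd, if_pos ⟨(mem_lower.1 hp).1, 0, rfl⟩]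
  · intro q hq
    rw [hd, if_neg]
    rintro ⟨-, n, hn⟩
    rw [hf' q hq] at hn
    exact hq (hn ▸ hp)
  · intro q hq hqp
    rw [hd, hd, exists_iterate_iff f hqp, hf q hq]
    have h1 := (mem_lower.1 hq).1
    have h2 : par q ∈ Γ := by
      rcases hpar q hq with h | h
      · rwa [h]
      · exact h.1
    simp only [h1, h2, true_and]
  · intro hne
    rw [hd, if_neg]
    rintro ⟨-, n, hn⟩
    have h1 := hrow n (par p)
    have h2 := ((hpar p hp).resolve_left hne).2
    rw [hn] at h1
    omega

theorem HasBase.sub_iff {Γ : Finset Node} {b b' : Fin (topCount Γ) → ℤ} {u d : Exponent}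
    (h0 : ∀ p, p ∉ Γ → d p = 0) (ht : ∀ k, d (topNode Γ k) = b k - b' k) :
    HasBase Γ b' ⇑(u - d) ↔ HasBase Γ b u := by
  refine and_congr (forall₂_congr fun p hp => ?_) (forall_congr' fun k => ?_)
  · rw [Finsupp.sub_apply, h0 p hp, sub_zero]
  · rw [Finsupp.sub_apply, ht k]
    omega

theorem topNode_not_mem_lower {Γ : Finset Node} (k : Fin (topCount Γ)) :
    topNode Γ k ∉ lower Γ := fun h => by
  have := (mem_lower.1 h).2
  rw [topNode_fst] at this
  omega

/-- Take `Q = 1 - e^d` with `d` the indicator of the descendants of `p`. Shifting by `d` preserves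
all differences to parents except the one at `p`. If `p` is its own parent, that one is preserved
too and the series is periodic. -/
theorem IsParentMap.mulSeries_treeSeries {Γ : Finset Node} {b : Fin (topCount Γ) → ℤ}
    {par : Node → Node} (hpar : IsParentMap Γ par) {p : Node} (hp : p ∈ lower Γ) :
    ∃ Q : Laurent, Q ≠ 0 ∧ ∀ κ : Node → ℤ → ℤ[X],
      (par p = p → mulSeries Q (treeSeries Γ b par κ) = 0) ∧
      (par p ≠ p → mulSeries Q (treeSeries Γ b par κ) =
        treeSeries Γ b par (Function.update κ p fun n => κ p n - κ p (n - 1))) := by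
  classical
  obtain ⟨d, hdp, hd0, hdpar, hdp'⟩ := hpar.exists_descendants hp
  have hdne : d ≠ 0 := by
    rintro rfl
    simp at hdp
  have hbase : ∀ u : Exponent, HasBase Γ b ⇑(u - d) ↔ HasBase Γ b u := fun u =>
    HasBase.sub_iff (fun q hq => hd0 q fun h => hq (mem_lower.1 h).1)
      fun k => by rw [hd0 _ (topNode_not_mem_lower k), sub_self]
  refine ⟨_, one_sub_single_ne_zero hdne, fun κ => ⟨fun h => ?_, fun h => ?_⟩⟩
  · funext u
    rw [mulSeries_one_sub_single, treeSeries, treeSeries, hbase, Pi.zero_apply, sub_eq_zero]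
    congr 1
    refine Finset.prod_congr rfl fun q hq => ?_
    by_cases hqp : q = p
    · rw [hqp, h, sub_self, sub_self]
    · rw [Finsupp.sub_apply, Finsupp.sub_apply, hdpar q hq hqp, sub_sub_sub_cancel_right]
  · funext u
    rw [mulSeries_one_sub_single, treeSeries, treeSeries, treeSeries, hbase]
    split_ifs
    · rw [← Finset.mul_prod_erase _ _ hp, ← Finset.mul_prod_erase _ _ hp,
        ← Finset.mul_prod_erase _ _ hp]
      have e1 : ∏ q ∈ (lower Γ).erase p, κ q ((u - d) q - (u - d) (par q)) =
          ∏ q ∈ (lower Γ).erase p, κ q (u q - u (par q)) := by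
        refine Finset.prod_congr rfl fun q hq => ?_
        rw [Finset.mem_erase] at hq
        rw [Finsupp.sub_apply, Finsupp.sub_apply, hdpar q hq.2 hq.1, sub_sub_sub_cancel_right]
      have e2 : ∏ q ∈ (lower Γ).erase p,
          (Function.update κ p fun n => κ p n - κ p (n - 1)) q (u q - u (par q)) =
          ∏ q ∈ (lower Γ).erase p, κ q (u q - u (par q)) := by
        refine Finset.prod_congr rfl fun q hq => ?_
        rw [Function.update_of_ne (Finset.ne_of_mem_erase hq)]
      have e3 : (u - d) p - (u - d) (par p) = u p - u (par p) - 1 := by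
        rw [Finsupp.sub_apply, Finsupp.sub_apply, hdp, hdp' h]
        ring
      rw [e1, e2, e3, Function.update_self]
      ring
    · ring

/-- The top row is fixed, and each coordinate differs from its parent by one of finitely many
amounts; descending along the forest bounds every coordinate. -/
theorem IsParentMap.treeSeries_finite_support {Γ : Finset Node} {b : Fin (topCount Γ) → ℤ}
    {par : Node → Node} (hpar : IsParentMap Γ par) (hne : ∀ p ∈ lower Γ, par p ≠ p)
    {κ : Node → ℤ → ℤ[X]} (hκ : ∀ p ∈ lower Γ, (κ p).support.Finite) :
    (treeSeries Γ b par κ).support.Finite := by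
  classical
  set S := (treeSeries Γ b par κ).support with hS
  have hmem : ∀ u ∈ S, HasBase Γ b u ∧ ∀ p ∈ lower Γ, κ p (u p - u (par p)) ≠ 0 := by
    intro u hu
    rw [hS, Function.mem_support, treeSeries] at hu
    by_cases hb : HasBase Γ b u
    · rw [if_pos hb] at hu
      exact ⟨hb, fun p hp => Finset.prod_ne_zero_iff.1 hu p hp⟩
    · rw [if_neg hb] at hu
      exact absurd rfl hu
  have hfin : ∀ p ∈ Γ, ((fun u : Exponent => u p) '' S).Finite := by
    refine node_induction ?_ ?_
    · intro p hp hpt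
      obtain ⟨k, rfl⟩ := exists_topNode hp hpt
      refine (Set.finite_singleton (b k)).subset ?_
      rintro _ ⟨u, hu, rfl⟩
      exact (hmem u hu).1.2 k
    · intro p hp ih
      have h := (hpar p hp).resolve_left (hne p hp)
      refine (Set.Finite.image2 (fun m n => m + n) (ih _ h.1 h.2) (hκ p hp)).subset ?_
      rintro _ ⟨u, hu, rfl⟩
      exact ⟨u (par p), ⟨u, hu, rfl⟩, u p - u (par p), (hmem u hu).2 p hp, by simp⟩
  choose! t ht using fun p (hp : p ∈ Γ) => (hfin p hp).exists_finset_coe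
  refine (Γ.finsupp t).finite_toSet.subset fun u hu => ?_
  rw [Finset.mem_coe, Finset.mem_finsupp_iff]
  constructor
  · intro p hp
    by_contra hpΓ
    exact (Finsupp.mem_support_iff.1 hp) ((hmem u hu).1.1 p hpΓ)
  · intro p hp
    rw [← Finset.mem_coe, ht p hp]
    exact ⟨u, hu, rfl⟩

/-- Here `s` collects the vertices whose kernels are not yet known to be finitely supported. Each
induction step differences one kernel, contributing one factor to the denominator, until the series
is a Laurent polynomial. -/
theorem IsParentMap.exists_represents {Γ : Finset Node} {b : Fin (topCount Γ) → ℤ}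
    {par : Node → Node} (hpar : IsParentMap Γ par) (hne : ∀ p ∈ lower Γ, par p ≠ p)
    (s : Finset Node) (hs : s ⊆ lower Γ) (κ : Node → ℤ → ℤ[X])
    (h1 : ∀ p ∈ lower Γ, p ∉ s → (κ p).support.Finite)
    (h2 : ∀ p ∈ s, (Function.support fun n => κ p n - κ p (n - 1)).Finite) :
    ∃ r, Represents (treeSeries Γ b par κ) r := by
  classical
  induction s using Finset.induction_on generalizing κ with
  | empty =>
    exact Represents.of_finite_support (hpar.treeSeries_finite_support hne
      fun p hp => h1 p hp (Finset.notMem_empty p))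
  | insert p s hps ih =>
    have hp : p ∈ lower Γ := hs (Finset.mem_insert_self p s)
    obtain ⟨Q, hQ, hQκ⟩ := hpar.mulSeries_treeSeries (b := b) hp
    obtain ⟨r, hr⟩ := ih (fun q hq => hs (Finset.mem_insert_of_mem hq))
      (Function.update κ p fun n => κ p n - κ p (n - 1))
      (fun q hq hqs => by
        by_cases hqp : q = p
        · subst hqp
          rw [Function.update_self]
          exact h2 q (Finset.mem_insert_self q s)
        · rw [Function.update_of_ne hqp]
          exact h1 q hq (by simp [hqp, hqs]))
      (fun q hq => by
        have hqp : q ≠ p := by rintro rfl; exact hps hq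
        rw [Function.update_of_ne hqp]
        exact h2 q (Finset.mem_insert_of_mem hq))
    rw [← (hQκ κ).2 (hne p hp)] at hr
    exact ⟨_, hr.of_mulSeries hQ⟩

theorem Choice.finite_support_kernel_sub (o : Choice) :
    (Function.support fun n => o.kernel n - o.kernel (n - 1)).Finite := by
  refine (Set.toFinite {0, 1}).subset fun n hn => ?_
  by_contra h
  simp only [Set.mem_insert_iff, Set.mem_singleton_iff, not_or] at h
  apply hn
  cases o <;> simp only [Choice.kernel] <;> first | ring1 | (split_ifs <;> first | omega | ring1)

/-- All choices at lower vertices are possible and none of them is free. -/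
def IsForest (Γ : Finset Node) (H : Node → Node → Prop) (τ : Node → Choice) : Prop :=
  ∀ p ∈ lower Γ, (τ p).Allowed H p ∧ τ p ≠ .free

theorem Choice.parent_of_allowed {o : Choice} {H : Node → Node → Prop} {p : Node}
    (h : o.Allowed H p) (hne : o ≠ .free) :
    (o.parent p = upL p ∨ o.parent p = upR p) ∧ H p (o.parent p) := by
  cases o with
  | left => exact ⟨Or.inl rfl, h⟩
  | right => exact ⟨Or.inr rfl, h⟩
  | leftEq => exact ⟨Or.inl rfl, h⟩
  | rightEq => exact ⟨Or.inr rfl, h⟩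
  | free => exact absurd rfl hne

theorem Choice.allowed_of_parent {o : Choice} {H : Node → Node → Prop} {p : Node}
    (hne : o ≠ .free) (h : H p (o.parent p)) : o.Allowed H p := by
  cases o with
  | left => exact h
  | right => exact h
  | leftEq => exact h
  | rightEq => exact h
  | free => exact absurd rfl hne

theorem Choice.parent_fst {o : Choice} (hne : o ≠ .free) (p : Node) :
    (o.parent p).1 = p.1 - 1 := by
  cases o <;> first | rfl | exact absurd rfl hne

open Classical in
/-- The rational function of a forest (zero if there are free choices). -/
def forestFunction (Γ : Finset Node) (b : Fin (topCount Γ) → ℤ) (τ : Node → Choice) : RatFun :=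
  if h : ∃ r, Represents (treeSeries Γ b (fun p => (τ p).parent p) fun p => (τ p).kernel) r
  then h.choose else 0

open Classical in
-- The edge relation `H` only decides whether a term is present; the rational function of a forest
-- does not involve it. Terms with a forbidden choice vanish identically, and those with a free
-- vertex are annihilated by a binomial.
theorem IsOrdinary.represents_term {Γ : Finset Node} (hΓ : IsOrdinary Γ)
    (b : Fin (topCount Γ) → ℤ) {H : Node → Node → Prop} (hH : ∀ p q, H p q → q ∈ Γ)
    (τ : Node → Choice) :
    Represents (fun u : Exponent => if HasBase Γ b u then
      (hΓ.list.map fun p => localWeight H p (τ p) u).prod else 0)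
      (if IsForest Γ H τ then forestFunction Γ b τ else 0) := by
  have hprod : ∀ u : Node → ℤ, (hΓ.list.map fun p => localWeight H p (τ p) u).prod =
      ∏ p ∈ lower Γ, localWeight H p (τ p) u := by
    intro u
    rw [← List.prod_toFinset _ hΓ.nodup_list]
    congr 1
    ext p
    rw [List.mem_toFinset, hΓ.mem_list]
  simp only [hprod]
  by_cases hall : ∀ p ∈ lower Γ, (τ p).Allowed H p
  · have hser : (fun u : Exponent => if HasBase Γ b u then
        ∏ p ∈ lower Γ, localWeight H p (τ p) u else 0) =
        treeSeries Γ b (fun p => (τ p).parent p) fun p => (τ p).kernel := by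
      funext u
      rw [treeSeries]
      congr 1
      exact Finset.prod_congr rfl fun p hp => localWeight_of_allowed (hall p hp)
    rw [hser]
    have hpar : IsParentMap Γ fun p => (τ p).parent p := by
      intro p hp
      by_cases hf : τ p = .free
      · exact Or.inl (by simp only [hf]; rfl)
      · refine Or.inr ⟨hH _ _ (Choice.parent_of_allowed (hall p hp) hf).2, ?_⟩
        have := Choice.parent_fst hf p
        simp only
        omega
    by_cases hforest : IsForest Γ H τ
    · rw [if_pos hforest]
      have hex := hpar.exists_represents (b := b) (fun p hp he => by
        have := Choice.parent_fst (hforest p hp).2 p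
        rw [show (τ p).parent p = p from he] at this
        omega) (lower Γ) (Finset.Subset.refl _) (fun p => (τ p).kernel)
        (fun p hp hp' => absurd hp hp') fun p _ => (τ p).finite_support_kernel_sub
      rw [forestFunction, dif_pos hex]
      exact hex.choose_spec
    · rw [if_neg hforest]
      obtain ⟨p, hp, hf⟩ : ∃ p ∈ lower Γ, τ p = .free := by
        by_contra! h
        exact hforest fun p hp => ⟨hall p hp, h p hp⟩
      obtain ⟨Q, hQ, hQκ⟩ := hpar.mulSeries_treeSeries (b := b) hp
      have h0 : Represents (mulSeries Q (treeSeries Γ b (fun p => (τ p).parent p)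
          fun p => (τ p).kernel)) 0 := by
        rw [(hQκ _).1 (by simp only [hf]; rfl)]
        exact Represents.zero
      have := h0.of_mulSeries hQ
      rwa [zero_div] at this
  · rw [if_neg fun h => hall fun p hp => (h p hp).1]
    push Not at hall
    obtain ⟨p, hp, hpn⟩ := hall
    convert Represents.zero using 1
    funext u
    rw [Finset.prod_eq_zero hp (localWeight_of_not_allowed hpn), ite_self]
    rfl

open Classical in
-- The list `T` precedes the quantifier over `H`, so the polyhedron and all cones are compared term
-- by term.
theorem IsOrdinary.exists_represents_continuantSeries {Γ : Finset Node} (hΓ : IsOrdinary Γ)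
    (b : Fin (topCount Γ) → ℤ) :
    ∃ T : List (ℤ[X] × (Node → Choice)), ∀ H : Node → Node → Prop, (∀ p q, H p q → q ∈ Γ) →
      Represents (continuantSeries hΓ b H)
        (T.map fun t => scalar t.1 *
          if IsForest Γ H t.2 then forestFunction Γ b t.2 else 0).sum := by
  obtain ⟨T, hT⟩ := exists_continuant_expansion hΓ.list hΓ.nodup_list
  refine ⟨T, fun H hH => ?_⟩
  have := Represents.list_sum T _ _ fun t _ => (hΓ.represents_term b hH t.2).const_mul t.1
  convert this using 1
  funext u
  rw [continuantSeries]
  split_ifs with hu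
  · rw [hT]
  · simp

/-! ### Forests and vertices -/

theorem equalEdges_mem {Γ : Finset Node} {v : Node → ℤ} (p q : Node) (h : equalEdges Γ v p q) :
    q ∈ Γ := h.1

theorem IsForest.full {Γ : Finset Node} {v : Node → ℤ} {τ : Node → Choice}
    (h : IsForest Γ (equalEdges Γ v) τ) : IsForest Γ (fullEdges Γ) τ := fun p hp =>
  ⟨Choice.allowed_of_parent (h p hp).2 (Choice.parent_of_allowed (h p hp).1 (h p hp).2).2.1,
    (h p hp).2⟩

/-- The array that is constant on the trees of a forest is a vertex of the polyhedron. -/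
theorem IsOrdinary.exists_vertex_of_isForest {Γ : Finset Node} (hΓ : IsOrdinary Γ)
    {b : Fin (topCount Γ) → ℤ} (hb : Antitone b) {τ : Node → Choice}
    (hτ : IsForest Γ (fullEdges Γ) τ) :
    ∃ v ∈ vertexSet Γ b, IsForest Γ (equalEdges Γ v) τ := by
  classical
  let f : Node → Node := fun p => (τ p).parent p
  -- Each step to the parent rises by one row, so this number of iterations leads to the root of the
  -- tree, where the top coordinate is read. The default `0` plays no role on `Γ`.
  let g : Node → ℤ := fun p => Function.extend (topNode Γ) b 0 (f^[(p.1 - topRow Γ).toNat] p)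
  have hgtop : ∀ k, g (topNode Γ k) = b k := by
    intro k
    simp only [g, topNode_fst, sub_self, Int.toNat_zero, Function.iterate_zero, id_eq]
    exact (topNode_injective Γ).extend_apply _ _ _
  have hgpar : ∀ p ∈ lower Γ, g p = g (f p) := by
    intro p hp
    have h1 : (f p).1 = p.1 - 1 := Choice.parent_fst (hτ p hp).2 p
    have h2 := (mem_lower.1 hp).2
    have h3 : (p.1 - topRow Γ).toNat = ((f p).1 - topRow Γ).toNat + 1 := by omega
    simp only [g]
    rw [h3, Function.iterate_succ_apply]
  have hpar : ∀ p ∈ lower Γ, (f p = upL p ∨ f p = upR p) ∧ f p ∈ Γ := fun p hp =>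
    Choice.parent_of_allowed (hτ p hp).1 (hτ p hp).2
  let v : Exponent := Finsupp.onFinset Γ (fun p => if p ∈ Γ then g p else 0) (by
    intro q hq
    by_contra h
    simp [h] at hq)
  have hv : ∀ p ∈ Γ, v p = g p := fun p hp => if_pos hp
  have hvpar : ∀ p ∈ lower Γ, v p = v (f p) := fun p hp => by
    rw [hv p (mem_lower.1 hp).1, hv _ (hpar p hp).2, hgpar p hp]
  have hbase : HasBase Γ b v :=
    ⟨fun p hp => if_neg hp, fun k => by rw [hv _ (topNode_mem k), hgtop]⟩
  have hint : ∀ p ∈ Γ, InterlacesAt Γ v p := by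
    refine node_induction ?_ ?_
    · intro p hp hpt
      constructor <;> intro hq <;> have := topRow_le hq <;> simp only [upL, upR] at this <;> omega
    · intro p hp ih
      have hrow : upL p ∈ Γ → upR p ∈ Γ → v (upR p) ≤ v (upL p) := fun hL hR =>
        hΓ.right_le_left (hbase.topAntitone hb) (fun q hq hqi => ih q hq (by omega)) hL hR
      obtain ⟨h1, h2⟩ := hpar p hp
      have h3 := hvpar p hp
      rcases h1 with h1 | h1 <;> rw [h1] at h2 h3
      · exact ⟨fun _ => h3.le, fun hR => h3 ▸ hrow h2 hR⟩
      · exact ⟨fun hL => h3 ▸ hrow hL h2, fun _ => h3.ge⟩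
  have hforest : IsForest Γ (equalEdges Γ v) τ := fun p hp =>
    ⟨Choice.allowed_of_parent (hτ p hp).2 ⟨(hpar p hp).2, hvpar p hp⟩, (hτ p hp).2⟩
  refine ⟨v, mem_vertexSet.2 ⟨toReal_mem_polyhedron_iff.2 ⟨hbase, hint⟩, fun p hp => ?_⟩, hforest⟩
  have h := hpar p hp
  rcases h.1 with h1 | h1
  · exact Or.inl ⟨h1 ▸ h.2, h1 ▸ hvpar p hp⟩
  · exact Or.inr ⟨h1 ▸ h.2, h1 ▸ hvpar p hp⟩

theorem IsForest.vertex_unique {Γ : Finset Node} {b : Fin (topCount Γ) → ℤ} {τ : Node → Choice}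
    {v w : Exponent} (hv : HasBase Γ b v) (hw : HasBase Γ b w)
    (hvτ : IsForest Γ (equalEdges Γ v) τ) (hwτ : IsForest Γ (equalEdges Γ w) τ) : v = w := by
  ext p
  by_cases hp : p ∈ Γ
  · revert p
    refine node_induction ?_ ?_
    · intro p hp hpt
      obtain ⟨k, rfl⟩ := exists_topNode hp hpt
      rw [hv.2, hw.2]
    · intro p hp ih
      have h1 := (Choice.parent_of_allowed (hvτ p hp).1 (hvτ p hp).2).2
      have h2 := (Choice.parent_of_allowed (hwτ p hp).1 (hwτ p hp).2).2
      rw [h1.2, h2.2]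
      refine ih _ h1.1 ?_
      have := Choice.parent_fst (hvτ p hp).2 p
      omega
  · rw [hv.1 p hp, hw.1 p hp]

open Classical in
-- A forest determines the array constant on its trees, which is a vertex of the polyhedron and the
-- only one with all edges of the forest tight. So each forest is counted exactly once.
theorem IsOrdinary.sum_vertexSet {Γ : Finset Node} (hΓ : IsOrdinary Γ)
    {b : Fin (topCount Γ) → ℤ} (hb : Antitone b) (τ : Node → Choice) (r : RatFun) :
    ∑ v ∈ vertexSet Γ b, (if IsForest Γ (equalEdges Γ v) τ then r else 0) =
      if IsForest Γ (fullEdges Γ) τ then r else 0 := by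
  have hbase : ∀ v ∈ vertexSet Γ b, HasBase Γ b v := fun v hv =>
    (toReal_mem_polyhedron_iff.1 (mem_vertexSet.1 hv).1).1
  split_ifs with h
  · obtain ⟨v, hv, hvτ⟩ := hΓ.exists_vertex_of_isForest hb h
    rw [Finset.sum_eq_single_of_mem v hv, if_pos hvτ]
    intro w hw hwv
    rw [if_neg]
    exact fun hwτ => hwv (IsForest.vertex_unique (hbase w hw) (hbase v hv) hwτ hvτ)
  · exact Finset.sum_eq_zero fun v _ => if_neg fun hv => h hv.full

/-! ### The degeneration map and the main identity -/

open Classical in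
/-- The map on integer arrays that replaces every value `b k` by `b' k`. -/
def degenerate (Γ : Finset Node) (b b' : Fin (topCount Γ) → ℤ) (v : Exponent) : Exponent :=
  Finsupp.onFinset Γ (fun p => if p ∈ Γ then Function.extend b b' 0 (v p) else 0) (by
    intro q hq
    by_contra h
    simp [h] at hq)

theorem degenerate_apply {Γ : Finset Node} {b b' : Fin (topCount Γ) → ℤ} {v : Exponent} {p : Node}
    (hp : p ∈ Γ) : degenerate Γ b b' v p = Function.extend b b' 0 (v p) := if_pos hp

theorem degenerate_of_not_mem {Γ : Finset Node} {b b' : Fin (topCount Γ) → ℤ} {v : Exponent}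
    {p : Node} (hp : p ∉ Γ) : degenerate Γ b b' v p = 0 := if_neg hp

theorem degenerate_eq {Γ : Finset Node} {b b' : Fin (topCount Γ) → ℤ} {v : Exponent} {p q : Node}
    (hp : p ∈ Γ) (h : equalEdges Γ v p q) : degenerate Γ b b' v p = degenerate Γ b b' v q := by
  rw [degenerate_apply hp, degenerate_apply h.1, h.2]

theorem degenerate_topNode {Γ : Finset Node} {b b' : Fin (topCount Γ) → ℤ} (hb : StrictAnti b)
    {v : Exponent} (hv : HasBase Γ b v) (k : Fin (topCount Γ)) :
    degenerate Γ b b' v (topNode Γ k) = b' k := by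
  rw [degenerate_apply (topNode_mem k), hv.2, hb.injective.extend_apply]

/-- All coordinates of a vertex are among the `b k`, and the replacement of `b k` by `b' k` is
weakly increasing, so no inequality is lost. -/
theorem degenerate_mem_polyhedron {Γ : Finset Node} {b b' : Fin (topCount Γ) → ℤ}
    (hb : StrictAnti b) (hb' : Antitone b') {v : Exponent} (hv : v ∈ vertexSet Γ b) :
    toReal (degenerate Γ b b' v) ∈ polyhedron Γ b' := by
  obtain ⟨hvP, hr⟩ := mem_vertexSet.1 hv
  obtain ⟨hbase, hint⟩ := toReal_mem_polyhedron_iff.1 hvP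
  have hmono : ∀ p ∈ Γ, ∀ q ∈ Γ, v p ≤ v q → degenerate Γ b b' v p ≤ degenerate Γ b b' v q := by
    intro p hp q hq h
    rw [degenerate_apply hp, degenerate_apply hq]
    obtain ⟨k, hk⟩ := hr.mem_range hvP p hp
    obtain ⟨l, hl⟩ := hr.mem_range hvP q hq
    rw [← hk, ← hl, hb.injective.extend_apply, hb.injective.extend_apply]
    rw [← hk, ← hl, hb.le_iff_ge] at h
    exact hb' h
  refine toReal_mem_polyhedron_iff.2 ⟨⟨fun p hp => degenerate_of_not_mem hp,
    degenerate_topNode hb hbase⟩, fun p hp => ⟨fun h => ?_, fun h => ?_⟩⟩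
  · exact hmono _ hp _ h ((hint p hp).1 h)
  · exact hmono _ h _ hp ((hint p hp).2 h)

theorem localWeight_add {H : Node → Node → Prop} {p : Node} {o : Choice} {u d : Node → ℤ}
    (hd : ∀ q, H p q → d p = d q) : localWeight H p o (fun q => u q + d q) =
      localWeight H p o u := by
  by_cases h : o.Allowed H p
  · rw [localWeight_of_allowed h, localWeight_of_allowed h]
    by_cases hf : o = .free
    · rw [hf]; rfl
    · have := hd _ (Choice.parent_of_allowed h hf).2
      rw [this, add_sub_add_right_eq_sub]
  · rw [localWeight_of_not_allowed h, localWeight_of_not_allowed h]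

theorem continuant_add {H : Node → Node → Prop} {u d : Node → ℤ} {l : List Node}
    (hd : ∀ p ∈ l, ∀ q, H p q → d p = d q) :
    continuant H (fun q => u q + d q) l = continuant H u l := by
  refine continuant_congr l (fun p hp => ?_) fun p hp q hq => ?_
  · simp only [singleWeight, localWeight_add (hd p hp)]
  · simp only [pairWeight, localWeight_add (hd p hp), localWeight_add (hd q hq)]

/-- Both `v` and its degeneration are constant along the tight edges of `v`, so translation by their
difference does not affect the local weights and only changes the prescribed top row. -/
theorem IsOrdinary.continuantSeries_degenerate {Γ : Finset Node} (hΓ : IsOrdinary Γ)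
    {b b' : Fin (topCount Γ) → ℤ} (hb : StrictAnti b) {v : Exponent} (hv : v ∈ vertexSet Γ b)
    (u : Exponent) :
    continuantSeries hΓ b (equalEdges Γ v) u =
      continuantSeries hΓ b' (equalEdges Γ v) (u - (v - degenerate Γ b b' v)) := by
  obtain ⟨hbase, -⟩ := toReal_mem_polyhedron_iff.1 (mem_vertexSet.1 hv).1
  have h1 : HasBase Γ b' ⇑(u - (v - degenerate Γ b b' v)) ↔ HasBase Γ b u := by
    refine HasBase.sub_iff (fun p hp => ?_) fun k => ?_
    · rw [Finsupp.sub_apply, hbase.1 p hp, degenerate_of_not_mem hp, sub_zero]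
    · rw [Finsupp.sub_apply, hbase.2, degenerate_topNode hb hbase]
  rw [continuantSeries, continuantSeries, h1]
  congr 1
  have h2 : ⇑(u - (v - degenerate Γ b b' v)) = fun q => u q + (degenerate Γ b b' v - v) q := by
    funext q
    simp only [Finsupp.sub_apply]
    ring
  rw [h2, continuant_add]
  intro p hp q hpq
  have hpΓ := (mem_lower.1 (hΓ.mem_list.1 hp)).1
  rw [Finsupp.sub_apply, Finsupp.sub_apply, degenerate_eq hpΓ hpq, hpq.2]

theorem monomialExp_mul (d e : Exponent) : monomialExp d * monomialExp e = monomialExp (d + e) := by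
  rw [monomialExp, monomialExp, monomialExp, ← map_mul, AddMonoidAlgebra.single_mul_single, one_mul]

theorem monomialExp_zero : monomialExp 0 = 1 := by
  rw [monomialExp, ← AddMonoidAlgebra.one_def, map_one]

theorem tFactorial_eval_zero (l : ℕ) : (tFactorial l).eval 0 = 1 := by
  induction l with
  | zero => simp [tFactorial]
  | succ l ih => rw [tFactorial_succ, tNumber_succ, eval_mul, ih]; simp

/-- The constant term in `t` is `1`. Nonvanishing is needed to divide by this factor, which gives
the existence of the transform of the second polyhedron. -/
theorem multiplicityFactor_ne_zero {n : ℕ} (b : Fin n → ℤ) : multiplicityFactor b ≠ 0 := by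
  intro h
  have := congrArg (eval 0) h
  rw [multiplicityFactor, eval_prod] at this
  simp [tFactorial_eval_zero] at this

theorem Represents.of_const_mul {S : Exponent → ℤ[X]} {r : RatFun} {c : ℤ[X]} (hc : c ≠ 0)
    (h : Represents (fun u => c * S u) r) : ∃ r', Represents S r' ∧ scalar c * r' = r := by
  have hM : (AddMonoidAlgebra.single 0 c : Laurent) ≠ 0 := AddMonoidAlgebra.single_ne_zero.2 hc
  have h' : Represents (GTPolyhedra.mulSeries (AddMonoidAlgebra.single 0 c) S) r := by
    convert h using 1
    funext u
    rw [mulSeries_single, sub_zero]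
  refine ⟨_, h'.of_mulSeries hM, ?_⟩
  exact mul_div_cancel₀ r (algebraMap_laurent_ne_zero hM)

theorem sum_list_map_sum {ι α : Type*} (s : Finset ι) (l : List α) (f : ι → α → RatFun) :
    ∑ v ∈ s, (l.map (f v)).sum = (l.map fun t => ∑ v ∈ s, f v t).sum := by
  induction l with
  | nil => simp
  | cons t l ih => simp only [List.map_cons, List.sum_cons, Finset.sum_add_distrib, ih]

end GTPolyhedra

end

open GTPolyhedra in
/-- The finite set `V` and the map `π` on it are uniquely determined by the first two clauses: `V`
is the set of vertices of `D_Γ(b)` (they are integer points), and `π` is the map from the vertices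
of `D_Γ(b)` to the vertices of `D_Γ(b')` given by the degeneration. -/
theorem lemma4 (Γ : Finset Node) (hΓ : IsOrdinary Γ) (b b' : Fin (topCount Γ) → ℤ)
    (hb : StrictAnti b) (hb' : Antitone b') :
    ∃ (V : Finset Exponent) (π : Exponent → Exponent),
      (∀ x : Space, IsVertex (polyhedron Γ b) x ↔ ∃ v ∈ V, toReal v = x) ∧
      (∀ v ∈ V, IsDegenerationImage (polyhedron Γ b) (polyhedron Γ b')
        {toReal v} {toReal (π v)}) ∧
      HasIPT (weight Γ) (polyhedron Γ b') ∧
      (∀ v ∈ V, HasIPT (coneWeight (weight Γ) (polyhedron Γ b))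
        (tangentCone (polyhedron Γ b) (toReal v))) ∧
      scalar (multiplicityFactor b') * ipt (weight Γ) (polyhedron Γ b') =
        ∑ v ∈ V, monomialExp (π v - v) *
          ipt (coneWeight (weight Γ) (polyhedron Γ b))
            (tangentCone (polyhedron Γ b) (toReal v)) := by
  classical
  -- Everything is expanded with top row `b'`; the cones of the first polyhedron enter after
  -- translation.
  obtain ⟨T, hT⟩ := hΓ.exists_represents_continuantSeries b'
  have hfull := hT (fullEdges Γ) fun _ _ h => h
  rw [show continuantSeries hΓ b' (fullEdges Γ) = fun u => multiplicityFactor b' *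
    weightedSeries (weight Γ) (polyhedron Γ b') u from
      funext fun u => (hΓ.weightedSeries_polyhedron hb' u).symm] at hfull
  obtain ⟨r, hr, hrT⟩ := hfull.of_const_mul (multiplicityFactor_ne_zero b')
  have hcone : ∀ v ∈ vertexSet Γ b, Represents
      (weightedSeries (coneWeight (weight Γ) (polyhedron Γ b))
        (tangentCone (polyhedron Γ b) (toReal v)))
      (monomialExp (v - degenerate Γ b b' v) * (T.map fun t => scalar t.1 *
          if IsForest Γ (equalEdges Γ v) t.2 then forestFunction Γ b' t.2 else 0).sum) := by
    intro v hv
    obtain ⟨hvP, hvr⟩ := mem_vertexSet.1 hv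
    have := (hT (equalEdges Γ v) equalEdges_mem).shift (v - degenerate Γ b b' v)
    convert this using 1
    funext u
    rw [hΓ.weightedSeries_tangentCone hb hvP hvr, hΓ.continuantSeries_degenerate hb hv]
  refine ⟨vertexSet Γ b, degenerate Γ b b', hΓ.isVertex_iff hb.antitone, fun v hv => ?_,
    ⟨r, hr⟩, fun v hv => ⟨_, hcone v hv⟩, ?_⟩
  · obtain ⟨hvP, hvr⟩ := mem_vertexSet.1 hv
    exact isDegenerationImage hvP hvr (degenerate_mem_polyhedron hb hb' hv)
      fun p hp q h => degenerate_eq hp h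
  · rw [hr.ipt_eq, hrT]
    have e : ∀ v ∈ vertexSet Γ b, monomialExp (degenerate Γ b b' v - v) *
        ipt (coneWeight (weight Γ) (polyhedron Γ b)) (tangentCone (polyhedron Γ b) (toReal v)) =
        (T.map fun t => scalar t.1 *
          if IsForest Γ (equalEdges Γ v) t.2 then forestFunction Γ b' t.2 else 0).sum := by
      intro v hv
      rw [(hcone v hv).ipt_eq, ← mul_assoc, monomialExp_mul, sub_add_sub_cancel, sub_self,
        monomialExp_zero, one_mul]
    -- After the translations cancel, the sums over vertices and over terms are interchanged, and
    -- for each term exactly one vertex contributes if it is a forest, none otherwise.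
    rw [Finset.sum_congr rfl e, sum_list_map_sum]
    congr 1
    refine List.map_congr_left fun t _ => ?_
    rw [← Finset.mul_sum, hΓ.sum_vertexSet hb.antitone]
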